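/- Let $k$ be a commutative ring and let $\mathcal{A}=(A=\bigoplus_{i\in\mathbb{Z}}A^i,d)$ be a differential graded (associative, unital) $k$-algebra such that $A^i=0$ for $i<0$, the ring $A^0$ is semisimple, and $d(A^0)=0$. Let $A^+=\bigoplus_{i>0}A^i$. Let $\mathrm{dgMod}$ be the category of right dg $\mathcal{A}$-modules and $\mathrm{dgHot}$ its homotopy category, with shift $(\{1\}M)^i=M^{i+1}$, $d_{\{1\}M}=-d_M$, and the triangulated structure given by mapping cones. Let $\mathrm{dgPer}\subset\mathrm{dgHot}$ be the smallest full triangulated subcategory that contains $\mathcal{A}$ and is closed under direct summands. For a dg module $M$ put $\overline{M}=M/MA^+=M\otimes_{\mathcal{A}}\mathcal{A}^0$, where $\mathcal{A}^0$ denotes $A^0$ regarded as a dg algebra concentrated in degree $0$. Let $\heartsuit$ be the full subcategory of $\mathrm{dgHot}$ whose objects are the $M\in\mathrm{dgPer}$ with $H^i(\overline{M})=0$ for all $i\neq 0$. Let $(L_x)_{x\in W}$ represent the isomorphism classes of simple right $A^0$-modules and put $\hat L_x=L_x\otimes_{A^0}\mathcal{A}$, with differential $l\otimes a\mapsto l\otimes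 d(a)$; these dg modules are objects of $\heartsuit$. Let $I$ be an object of $\heartsuit$ such that 1. $H^1(I)=0$, and 2. for every $x\in W$ there is a monomorphism $\hat L_x\to I$ in $\heartsuit$. Then, for every $M\in\heartsuit$, the left $\operatorname{End}_{\heartsuit}(I)$-module $\operatorname{Hom}_{\heartsuit}(M,I)$ is finitely generated, and the functor $$\operatorname{Hom}_{\heartsuit}(?,I)\colon\ \heartsuit\longrightarrow\big(\operatorname{End}_{\heartsuit}(I)\text{-}\mathrm{mof}\big)^{\mathrm{op}}$$ is an equivalence between $\heartsuit$ and the opposite of the category of finitely generated left $\operatorname{End}_{\heartsuit}(I)$-modules. -/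

import Mathlib

open CategoryTheory
open scoped TensorProduct MulOpposite

universe w u

noncomputable section

/-- A differential graded `k`-algebra: a `ℤ`-graded associative unital `k`-algebra with a
`k`-linear differential of degree `1` satisfying the graded Leibniz rule. -/
structure DGAlgebra (k : Type w) [CommRing k] where
  carrier : Type u
  [ring : Ring carrier]
  [algebra : Algebra k carrier]
  gr : ℤ → Submodule k carrier
  [graded : GradedAlgebra gr]
  diff : carrier →ₗ[k] carrier
  diff_mem : ∀ (i : ℤ) (a : carrier), a ∈ gr i → diff a ∈ gr (i + 1)
  diff_diff : ∀ a : carrier, diff (diff a) = 0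
  leibniz : ∀ (i : ℤ) (a b : carrier), a ∈ gr i →
    diff (a * b) = diff a * b + i.negOnePow • (a * diff b)

attribute [instance] DGAlgebra.ring DGAlgebra.algebra DGAlgebra.graded

namespace DGAlgebra

variable {k : Type w} [CommRing k] (R : DGAlgebra.{w, u} k)

/-- The multiplication `A^i × A^j → A^n` for `i + j = n`. -/
def mul {i j n : ℤ} (h : i + j = n) : R.gr i →+ R.gr j →+ R.gr n :=
  AddMonoidHom.mk' (fun a => AddMonoidHom.mk'
      (fun b => ⟨(a : R.carrier) * b, h ▸ SetLike.mul_mem_graded a.2 b.2⟩)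
      (fun b b' => by ext; simp [mul_add])) (fun a a' => by ext; simp [add_mul])

/-- The differential `A^i → A^j` for `i + 1 = j`. -/
def d {i j : ℤ} (h : i + 1 = j) : R.gr i →+ R.gr j where
  toFun a := ⟨R.diff a, h ▸ R.diff_mem i a a.2⟩
  map_zero' := by ext; simp
  map_add' a b := by ext; simp

@[simp] lemma coe_mul {i j n : ℤ} (h : i + j = n) (a : R.gr i) (b : R.gr j) :
    ((R.mul h a b : R.gr n) : R.carrier) = a * b := rfl

@[simp] lemma coe_d {i j : ℤ} (h : i + 1 = j) (a : R.gr i) :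
    ((R.d h a : R.gr j) : R.carrier) = R.diff a := rfl

/-- The standing conditions on the dg algebra: it is positively graded, its degree zero part is a
semisimple ring, and the differential vanishes on the degree zero part. -/
class Admissible : Prop where
  positive : ∀ i : ℤ, i < 0 → R.gr i = ⊥
  semisimple : IsSemisimpleRing (R.gr 0)
  diff_zero : ∀ a ∈ R.gr 0, R.diff a = 0

end DGAlgebra

/-- A right dg module over the dg algebra `R`, given by its homogeneous components `X i`, the
biadditive action maps `X^i × A^j → X^n` for `i + j = n`, and the differential `X^i → X^j` for
`i + 1 = j`. (The action of `k` is the one induced by `k → A^0`; the differential is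
automatically `k`-linear, since the differential of `A` vanishes on the image of `k`.) -/
structure DGMod {k : Type w} [CommRing k] (R : DGAlgebra.{w, u} k) where
  X : ℤ → Type u
  [grp : ∀ i, AddCommGroup (X i)]
  act : ∀ {i j n : ℤ} (_ : i + j = n), X i →+ R.gr j →+ X n
  d : ∀ {i j : ℤ} (_ : i + 1 = j), X i →+ X j
  act_one : ∀ {i : ℤ} (x : X i), act (add_zero i) x (1 : R.gr 0) = x
  act_act : ∀ {i j l p q n : ℤ} (hij : i + j = p) (hpl : p + l = n) (hjl : j + l = q)
    (hiq : i + q = n) (x : X i) (a : R.gr j) (b : R.gr l),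
    act hpl (act hij x a) b = act hiq x (R.mul hjl a b)
  d_d : ∀ {i j l : ℤ} (hij : i + 1 = j) (hjl : j + 1 = l) (x : X i), d hjl (d hij x) = 0
  d_act : ∀ {i j n i' j' n' : ℤ} (h : i + j = n) (hn : n + 1 = n') (hi : i + 1 = i')
    (hj : j + 1 = j') (hl : i' + j = n') (hr : i + j' = n') (x : X i) (a : R.gr j),
    d hn (act h x a) = act hl (d hi x) a + i.negOnePow • act hr x (R.d hj a)

attribute [instance] DGMod.grp

namespace DGMod

variable {k : Type w} [CommRing k] {R : DGAlgebra.{w, u} k}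

/-- Morphisms of dg modules: homogeneous of degree zero, `A`-linear, compatible with the
differentials. -/
@[ext]
structure Hom (M N : DGMod R) where
  f : ∀ i : ℤ, M.X i →+ N.X i
  map_act : ∀ {i j n : ℤ} (h : i + j = n) (x : M.X i) (a : R.gr j),
    f n (M.act h x a) = N.act h (f i x) a
  map_d : ∀ {i j : ℤ} (h : i + 1 = j) (x : M.X i), f j (M.d h x) = N.d h (f i x)

/-- The category `dgMod` of dg modules. -/
instance : Category (DGMod R) where
  Hom M N := Hom M N
  id M := ⟨fun _ => AddMonoidHom.id _, fun _ _ _ => rfl, fun _ _ => rfl⟩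
  comp f g := ⟨fun i => (g.f i).comp (f.f i), fun h x a => by simp [f.map_act, g.map_act],
    fun h x => by simp [f.map_d, g.map_d]⟩

@[ext] lemma hom_ext {M N : DGMod R} {f g : M ⟶ N} (h : ∀ i x, f.f i x = g.f i x) : f = g :=
  Hom.ext (funext fun i => AddMonoidHom.ext (h i))

@[simp] lemma id_f (M : DGMod R) (i : ℤ) (x : M.X i) : (𝟙 M : M ⟶ M).f i x = x := rfl

@[simp] lemma comp_f {M N P : DGMod R} (f : M ⟶ N) (g : N ⟶ P) (i : ℤ) (x : M.X i) :
    (f ≫ g).f i x = g.f i (f.f i x) := rfl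

section Additive

variable {M N : DGMod R}

instance : Zero (M ⟶ N) := ⟨⟨fun _ => 0, by simp, by simp⟩⟩

instance : Add (M ⟶ N) := ⟨fun f g => ⟨fun i => f.f i + g.f i,
  by simp [f.map_act, g.map_act], by simp [f.map_d, g.map_d]⟩⟩

instance : Neg (M ⟶ N) := ⟨fun f => ⟨fun i => -f.f i,
  by simp [f.map_act], by simp [f.map_d]⟩⟩

@[simp] lemma zero_f (i : ℤ) (x : M.X i) : (0 : M ⟶ N).f i x = 0 := rfl

@[simp] lemma add_f (f g : M ⟶ N) (i : ℤ) (x : M.X i) :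
    (f + g).f i x = f.f i x + g.f i x := rfl

@[simp] lemma neg_f (f : M ⟶ N) (i : ℤ) (x : M.X i) : (-f).f i x = -f.f i x := rfl

instance : AddCommGroup (M ⟶ N) where
  add_assoc f g h := by ext; simp [add_assoc]
  zero_add f := by ext; simp
  add_zero f := by ext; simp
  add_comm f g := by ext; simp [add_comm]
  neg_add_cancel f := by ext; simp
  nsmul := nsmulRec
  zsmul := zsmulRec

end Additive

instance : Preadditive (DGMod R) where
  add_comp _ _ _ f f' g := by ext; simp
  comp_add _ _ _ f g g' := by ext; simp

/-- A homotopy from `f` to `g`: an `A`-linear map `s` of degree `-1` with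
`f - g = d s + s d`. -/
structure Homotopy {M N : DGMod R} (f g : M ⟶ N) where
  s : ∀ {i j : ℤ} (_ : j + 1 = i), M.X i →+ N.X j
  s_act : ∀ {i j n i' n' : ℤ} (h : i + j = n) (hi : i' + 1 = i) (hn : n' + 1 = n)
    (h' : i' + j = n') (x : M.X i) (a : R.gr j), s hn (M.act h x a) = N.act h' (s hi x) a
  comm : ∀ {h i j : ℤ} (hi : h + 1 = i) (hj : i + 1 = j) (x : M.X i),
    f.f i x = g.f i x + (N.d hi (s hi x) + s hj (M.d hj x))

variable (R) in
/-- The homotopy relation on morphisms of dg modules. -/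
def homotopic : HomRel (DGMod R) := fun _ _ f g => Nonempty (Homotopy f g)

lemma homotopic_add {M N : DGMod R} (f f' g g' : M ⟶ N) (h : homotopic R f f')
    (h' : homotopic R g g') : homotopic R (f + g) (f' + g') := by
  obtain ⟨h⟩ := h
  obtain ⟨h'⟩ := h'
  exact ⟨{
    s := fun e => h.s e + h'.s e
    s_act := fun e hi hn e' x a => by simp [h.s_act e hi hn e', h'.s_act e hi hn e']
    comm := fun hi hj x => by
      simp only [add_f, h.comm hi hj, h'.comm hi hj, AddMonoidHom.add_apply, map_add]
      abel }⟩

instance : Congruence (homotopic R) where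
  comp_left {M N P} f {g g'} := fun ⟨h⟩ => ⟨{
    s := fun e => (h.s e).comp (f.f _)
    s_act := fun e hi hn e' x a => by simp [f.map_act, h.s_act e hi hn e']
    comm := fun hi hj x => by simp [h.comm hi hj, f.map_d] }⟩
  comp_right {M N P f f'} g := fun ⟨h⟩ => ⟨{
    s := fun e => (g.f _).comp (h.s e)
    s_act := fun e hi hn e' x a => by simp [g.map_act, h.s_act e hi hn e']
    comm := fun hi hj x => by simp [h.comm hi hj, g.map_d] }⟩
  equivalence {M N} :=
    { refl := fun f => ⟨{ s := fun _ => 0, s_act := by simp, comm := by simp }⟩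
      symm := fun {f g} ⟨h⟩ => ⟨{
        s := fun e => -h.s e
        s_act := fun e hi hn e' x a => by simp [h.s_act e hi hn e']
        comm := fun hi hj x => by
          simp only [h.comm hi hj, AddMonoidHom.neg_apply, map_neg]; abel }⟩
      trans := fun {f g l} ⟨h⟩ ⟨h'⟩ => ⟨{
        s := fun e => h.s e + h'.s e
        s_act := fun e hi hn e' x a => by simp [h.s_act e hi hn e', h'.s_act e hi hn e']
        comm := fun hi hj x => by
          simp only [h.comm hi hj, h'.comm hi hj, AddMonoidHom.add_apply, map_add]
          abel }⟩ }

variable (R) in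
/-- The homotopy category `dgHot` of dg modules. -/
abbrev Hot := CategoryTheory.Quotient (homotopic R)

instance : Preadditive (Hot R) :=
  CategoryTheory.Quotient.preadditive _ fun _ _ f g f' g' h h' => homotopic_add f g f' g' h h'

variable (R) in
/-- The canonical functor `dgMod ⥤ dgHot`. -/
abbrev toHot : DGMod R ⥤ Hot R := CategoryTheory.Quotient.functor (homotopic R)

variable (R) in
/-- The dg algebra as a right dg module over itself. -/
def free : DGMod R where
  X i := R.gr i
  act h := R.mul h
  d h := R.d h
  act_one x := by ext; simp
  act_act _ _ _ _ x a b := by ext; simp [mul_assoc]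
  d_d _ _ x := by ext; simp [R.diff_diff]
  d_act {i _ _ _ _ _} _ _ _ _ _ _ x a := by
    ext
    simp [R.leibniz i x a x.2, Units.smul_def]

/-- The shift `{n}M`, with components `({n}M)^i = M^(i+n)` and differential `(-1)^n d`. -/
def shift (n : ℤ) (M : DGMod R) : DGMod R where
  X i := M.X (i + n)
  act h := M.act (by omega)
  d h := n.negOnePow • M.d (by omega)
  act_one x := by
    have := M.act_one x
    exact this
  act_act _ _ hjl _ x a b := M.act_act _ _ hjl _ x a b
  d_d _ _ x := by simp [Units.smul_def, M.d_d]
  d_act {i j m i' j' m'} h hm hi hj hl hr x a := by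
    have e := M.d_act (by omega : i + n + j = m + n) (by omega : m + n + 1 = m' + n)
      (by omega : i + n + 1 = i' + n) hj (by omega) (by omega) x a
    have s : n.negOnePow * (i + n).negOnePow = i.negOnePow := by
      rw [Int.negOnePow_add, mul_left_comm, Int.units_mul_self, mul_one]
    simp only [AddMonoidHom.smul_apply, e, smul_add, smul_smul, s]
    simp [Units.smul_def]

/-- The mapping cone `N ⊕ {1}M` of `f : M ⟶ N`, with differential
`(y, x) ↦ (d y + f x, - d x)`. -/
def cone {M N : DGMod R} (f : M ⟶ N) : DGMod R where
  X i := N.X i × M.X (i + 1)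
  act {i j n} h := AddMonoidHom.mk' (fun x => AddMonoidHom.mk'
      (fun a => (N.act h x.1 a, M.act (by omega : i + 1 + j = n + 1) x.2 a))
      (fun a a' => Prod.ext (by simp) (by simp)))
      (fun x x' => AddMonoidHom.ext fun a => Prod.ext (by simp) (by simp))
  d {i j} h := AddMonoidHom.mk'
      (fun x => (N.d h x.1 + f.f j (h ▸ x.2), -M.d (by omega : i + 1 + 1 = j + 1) x.2))
      (fun x x' => by
        subst h
        exact Prod.ext (by simp only [Prod.fst_add, Prod.snd_add, map_add]; abel)
          (by simp only [Prod.snd_add, map_add]; abel))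
  act_one x := Prod.ext (N.act_one x.1) (by
    have := M.act_one x.2
    exact this)
  act_act _ _ hjl _ x a b := Prod.ext (N.act_act _ _ hjl _ x.1 a b)
    (M.act_act _ _ hjl _ x.2 a b)
  d_d hij hjl x := by
    subst hij hjl
    exact Prod.ext (by simp [N.d_d, f.map_d]) (by simp [M.d_d])
  d_act {i j m i' j' m'} h hm hi hj hl hr x a := by
    subst h hm hi hj
    have e := N.d_act rfl rfl rfl rfl hl hr x.1 a
    have e' := M.d_act (by omega : i + 1 + j = i + j + 1) rfl rfl rfl (by omega) (by omega) x.2 a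
    rw [Int.negOnePow_succ] at e'
    have key : ∀ (p : ℤ) (hp : p = i + j + 1) (h1 : i + 1 + j = p),
        f.f p (hp ▸ M.act (by omega : i + 1 + j = i + j + 1) x.2 a)
          = N.act h1 (f.f (i + 1) x.2) a := by
      intro p hp h1
      subst hp
      exact f.map_act _ _ _
    refine Prod.ext ?_ ?_
    · have := key _ rfl hl
      simp [e, this]
      simp only [Units.smul_def]
      abel
    · simp [e', Units.smul_def]
      abel

/-- The submodule `MA^+` in degree `n`: generated by the products `x a` with `a` homogeneous of
positive degree. -/
def plus (M : DGMod R) (n : ℤ) : AddSubgroup (M.X n) :=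
  AddSubgroup.closure {y | ∃ (i j : ℤ) (h : i + j = n) (_ : 0 < j) (x : M.X i) (a : R.gr j),
    y = M.act h x a}

lemma act_mem_plus [R.Admissible] (M : DGMod R) {i j n : ℤ} (h : i + j = n) {x : M.X i}
    (hx : x ∈ M.plus i) (a : R.gr j) : M.act h x a ∈ M.plus n := by
  rcases lt_or_ge j 0 with hj | hj
  · have : a = 0 := Subtype.ext ((Submodule.mem_bot k).1
      (DGAlgebra.Admissible.positive (R := R) j hj ▸ a.2))
    simp [this]
  · induction hx using AddSubgroup.closure_induction with
    | mem y hy =>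
      obtain ⟨p, q, e, hq, x, b, rfl⟩ := hy
      rw [M.act_act e h (rfl : q + j = q + j) (by omega)]
      exact AddSubgroup.subset_closure ⟨_, _, _, by omega, _, _, rfl⟩
    | zero => simp
    | add y z _ _ hy hz => simpa using add_mem hy hz
    | neg y _ hy => simpa using hy

lemma d_mem_plus (M : DGMod R) {n m : ℤ} (h : n + 1 = m) {x : M.X n} (hx : x ∈ M.plus n) :
    M.d h x ∈ M.plus m := by
  induction hx using AddSubgroup.closure_induction with
  | mem y hy =>
    obtain ⟨i, j, e, hj, x, b, rfl⟩ := hy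
    rw [M.d_act e h rfl rfl (by omega) (by omega), Units.smul_def]
    refine add_mem (AddSubgroup.subset_closure ⟨_, _, _, hj, _, _, rfl⟩)
      (zsmul_mem (AddSubgroup.subset_closure ?_) _)
    exact ⟨_, _, _, by omega, _, _, rfl⟩
  | zero => simp
  | add y z _ _ hy hz => simpa using add_mem hy hz
  | neg y _ hy => simpa using hy

/-- The quotient dg module `M̄ = M / MA^+ = M ⊗_A A^0`. -/
def bar [R.Admissible] (M : DGMod R) : DGMod R where
  X i := M.X i ⧸ M.plus i
  act {i j n} h := QuotientAddGroup.lift (M.plus i)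
    (AddMonoidHom.mk' (fun x => (QuotientAddGroup.mk' (M.plus n)).comp (M.act h x))
      (fun x x' => by ext; simp))
    (fun x hx => by
      ext a
      simpa using M.act_mem_plus h hx a)
  d {i j} h := QuotientAddGroup.map _ _ (M.d h) (fun x hx => M.d_mem_plus h hx)
  act_one x := by
    induction x using QuotientAddGroup.induction_on with
    | H x => exact congrArg (QuotientAddGroup.mk' (M.plus _)) (M.act_one x)
  act_act hij hpl hjl hiq x a b := by
    induction x using QuotientAddGroup.induction_on with
    | H x => exact congrArg (QuotientAddGroup.mk' (M.plus _)) (M.act_act hij hpl hjl hiq x a b)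
  d_d hij hjl x := by
    induction x using QuotientAddGroup.induction_on with
    | H x => exact congrArg (QuotientAddGroup.mk' (M.plus _)) (M.d_d hij hjl x)
  d_act h hm hi hj hl hr x a := by
    induction x using QuotientAddGroup.induction_on with
    | H x => exact congrArg (QuotientAddGroup.mk' (M.plus _)) (M.d_act h hm hi hj hl hr x a)

/-- The cohomology `H^n(M)`: cycles modulo boundaries. -/
abbrev cohomology (M : DGMod R) (n : ℤ) : Type u :=
  (M.d (rfl : n + 1 = n + 1)).ker ⧸
    ((M.d (sub_add_cancel n 1)).range.addSubgroupOf (M.d (rfl : n + 1 = n + 1)).ker)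

section Hat

variable (L : Type u) [AddCommGroup L] [Module (R.gr 0)ᵐᵒᵖ L]

variable (R) in
/-- The relations `(l a) ⊗ b = l ⊗ (a b)`, for `a ∈ A^0`. -/
def balance (i : ℤ) : Submodule ℤ (L ⊗[ℤ] R.gr i) :=
  Submodule.span ℤ {t | ∃ (l : L) (a : R.gr 0) (b : R.gr i),
    t = (MulOpposite.op a • l) ⊗ₜ[ℤ] b - l ⊗ₜ[ℤ] (R.mul (zero_add i) a b)}

variable (R) in
/-- The tensor product `L ⊗_{A^0} A^i` of a right and a left `A^0`-module. -/
abbrev Ten (i : ℤ) : Type u := (L ⊗[ℤ] R.gr i) ⧸ balance R L i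

variable {L} in
/-- The pure tensor `l ⊗ b`. -/
def ten (i : ℤ) : L →+ R.gr i →+ Ten R L i :=
  AddMonoidHom.mk' (fun l => AddMonoidHom.mk' (fun b => Submodule.Quotient.mk (l ⊗ₜ[ℤ] b))
    (fun b b' => by simp [TensorProduct.tmul_add])) (fun l l' => by
      ext b; simp [TensorProduct.add_tmul])

variable {L}

lemma ten_smul {i : ℤ} (l : L) (a : R.gr 0) (b : R.gr i) :
    ten i (MulOpposite.op a • l) b = ten i l (R.mul (zero_add i) a b) :=
  (Submodule.Quotient.eq _).2 (Submodule.subset_span ⟨l, a, b, rfl⟩)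

lemma ten_induction {i : ℤ} {P : Ten R L i → Prop} (t : Ten R L i)
    (h : ∀ l b, P (ten i l b)) (h0 : P 0) (hadd : ∀ x y, P x → P y → P (x + y)) : P t := by
  induction t using Submodule.Quotient.induction_on with
  | H t =>
    induction t using TensorProduct.induction_on with
    | zero => exact h0
    | tmul l b => exact h l b
    | add x y hx hy => exact hadd _ _ hx hy

lemma ten_hom_ext {i : ℤ} {G : Type u} [AddCommGroup G] {f g : Ten R L i →+ G}
    (h : ∀ l b, f (ten i l b) = g (ten i l b)) (t : Ten R L i) : f t = g t := by
  induction t using ten_induction with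
  | h l b => exact h l b
  | h0 => simp
  | hadd x y hx hy => simp only [map_add, hx, hy]

/-- The map out of `L ⊗_{A^0} A^i` induced by a balanced biadditive map. -/
def tenLift {i : ℤ} {G : Type u} [AddCommGroup G] (φ : L →+ R.gr i →+ G)
    (h : ∀ l (a : R.gr 0) b, φ (MulOpposite.op a • l) b = φ l (R.mul (zero_add i) a b)) :
    Ten R L i →+ G :=
  ((balance R L i).liftQ (TensorProduct.liftAddHom φ (by simp)).toIntLinearMap (by
    rw [balance, Submodule.span_le]
    rintro _ ⟨l, a, b, rfl⟩
    simp [h])).toAddMonoidHom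

@[simp] lemma tenLift_ten {i : ℤ} {G : Type u} [AddCommGroup G] (φ : L →+ R.gr i →+ G)
    (h : ∀ l (a : R.gr 0) b, φ (MulOpposite.op a • l) b = φ l (R.mul (zero_add i) a b))
    (l : L) (b : R.gr i) : tenLift φ h (ten i l b) = φ l b := rfl

variable (L) [R.Admissible]

lemma d_mul_zero {i j : ℤ} (h : i + 1 = j) (a : R.gr 0) (b : R.gr i) :
    R.d h (R.mul (zero_add i) a b) = R.mul (zero_add j) a (R.d h b) := by
  ext
  simp [R.leibniz 0 a b a.2, DGAlgebra.Admissible.diff_zero (R := R) a.1 a.2]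

variable (R) in
/-- The dg module `L̂ = L ⊗_{A^0} A` attached to a right `A^0`-module `L`, with
`(l ⊗ b) a = l ⊗ (b a)` and `d (l ⊗ b) = l ⊗ d b`. -/
def hat : DGMod R where
  X i := Ten R L i
  act {i j n} h := tenLift (AddMonoidHom.mk' (fun l => (AddMonoidHom.compHom (ten n l)).comp
      (R.mul h)) (fun l l' => by ext; simp)) (fun l a b => by
        ext c
        have e : R.mul h (R.mul (zero_add i) a b) c = R.mul (zero_add n) a (R.mul h b c) := by
          ext; simp [mul_assoc]
        simp [ten_smul, e])
  d {i j} h := tenLift (AddMonoidHom.mk' (fun l => (ten j l).comp (R.d h))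
      (fun l l' => by ext; simp)) (fun l a b => by simp [ten_smul, d_mul_zero])
  act_one x := by
    induction x using ten_induction with
    | h l b =>
      have e : R.mul (add_zero _) b (1 : R.gr 0) = b := by ext; simp
      simp [e]
    | h0 => simp
    | hadd x y hx hy => simp only [map_add, AddMonoidHom.add_apply, hx, hy]
  act_act {i j l p q n} hij hpl hjl hiq x a c := by
    induction x using ten_induction with
    | h l b =>
      have e : R.mul hpl (R.mul hij b a) c = R.mul hiq b (R.mul hjl a c) := by
        ext; simp [mul_assoc]
      simp [e]
    | h0 => simp
    | hadd x y hx hy => simp only [map_add, AddMonoidHom.add_apply, hx, hy]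
  d_d hij hjl x := by
    induction x using ten_induction with
    | h l b =>
      have e : R.d hjl (R.d hij b) = 0 := by ext; simp [R.diff_diff]
      simp [e]
    | h0 => simp
    | hadd x y hx hy => simp only [map_add, hx, hy, add_zero]
  d_act {i _ _ _ _ _} h hm hi hj hl hr x a := by
    induction x using ten_induction with
    | h l b =>
      have e : R.d hm (R.mul h b a) =
          R.mul hl (R.d hi b) a + i.negOnePow • R.mul hr b (R.d hj a) :=
        (free R).d_act h hm hi hj hl hr b a
      simp [e, Units.smul_def]
    | h0 => simp
    | hadd x y hx hy =>
      simp only [map_add, AddMonoidHom.add_apply, hx, hy, smul_add]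
      abel

end Hat

variable (R) in
/-- The perfect dg modules: the objects of the smallest full triangulated subcategory of `dgHot`
that contains the free module `A` and is closed under direct summands (it is closed under all
shifts, under mapping cones of morphisms between its objects, and under retracts; in
particular it is closed under isomorphisms in `dgHot`, and contains zero and finite
direct sums). -/
inductive IsPerfect : ObjectProperty (Hot R)
  | free : IsPerfect ((toHot R).obj (free R))
  | shift (n : ℤ) (M : DGMod R) : IsPerfect ((toHot R).obj M) →
      IsPerfect ((toHot R).obj (M.shift n))
  | cone {M N : DGMod R} (f : M ⟶ N) : IsPerfect ((toHot R).obj M) →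
      IsPerfect ((toHot R).obj N) → IsPerfect ((toHot R).obj (DGMod.cone f))
  | summand {X Y : Hot R} (r : Retract X Y) : IsPerfect Y → IsPerfect X

variable (R) in
/-- The objects of the heart: the perfect dg modules `M` such that `H^i(M̄) = 0` for `i ≠ 0`. -/
def isHeart [R.Admissible] : ObjectProperty (Hot R) := fun M =>
  IsPerfect R M ∧ ∀ i : ℤ, i ≠ 0 → Subsingleton (M.as.bar.cohomology i)

variable (R) in
/-- The heart, a full subcategory of `dgHot`. -/
abbrev Heart [R.Admissible] := (isHeart R).FullSubcategory

section Hat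

variable [R.Admissible] (L : Type u) [AddCommGroup L] [Module (R.gr 0)ᵐᵒᵖ L]

/-- For `L` a simple right `A^0`-module, the dg module `L̂` is a direct summand of `A`. -/
lemma exists_retract_hat [IsSimpleModule (R.gr 0)ᵐᵒᵖ L] :
    Nonempty (Retract (hat R L) (free R)) := by
  have : IsSemisimpleRing (R.gr 0) := DGAlgebra.Admissible.semisimple
  have : Nontrivial L := IsSimpleModule.nontrivial (R.gr 0)ᵐᵒᵖ L
  have : Module.Projective (R.gr 0)ᵐᵒᵖ L := Module.projective_of_isSemisimpleRing _ _
  obtain ⟨l₀, hl₀⟩ := exists_ne (0 : L)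
  obtain ⟨s, hs⟩ := Module.projective_lifting_property
    (LinearMap.toSpanSingleton (R.gr 0)ᵐᵒᵖ L l₀) LinearMap.id
    (IsSimpleModule.toSpanSingleton_surjective _ hl₀)
  have hs' : ∀ l, s l • l₀ = l := fun l => LinearMap.congr_fun hs l
  let φ (i : ℤ) : Ten R L i →+ R.gr i := tenLift
    (AddMonoidHom.mk' (fun l => R.mul (zero_add i) (s l).unop) (fun l l' => by
      ext; simp)) (fun l a b => by ext; simp [mul_assoc])
  have hφ : ∀ i l b, φ i (ten i l b) = R.mul (zero_add i) (s l).unop b := fun _ _ _ => rfl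
  refine ⟨⟨⟨φ, ?_, ?_⟩, ⟨fun i => ten i l₀, fun _ _ _ => rfl, fun _ _ => rfl⟩, ?_⟩⟩
  · intro i j n h x a
    refine ten_hom_ext (f := (φ n).comp (((hat R L).act h).flip a))
      (g := ((R.mul h).flip a).comp (φ i)) (fun l b => ?_) x
    refine (hφ n l (R.mul h b a)).trans (Eq.trans ?_ (congrArg (fun y => R.mul h y a)
      (hφ i l b)).symm)
    ext
    simp [mul_assoc]
  · intro i j h x
    refine ten_hom_ext (f := (φ j).comp ((hat R L).d h)) (g := (R.d h).comp (φ i))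
      (fun l b => ?_) x
    refine (hφ j l (R.d h b)).trans (Eq.trans ?_ (congrArg (R.d h) (hφ i l b)).symm)
    rw [d_mul_zero]
  · ext i x
    refine ten_hom_ext (f := (ten i l₀).comp (φ i)) (g := AddMonoidHom.id _) (fun l b => ?_) x
    refine (congrArg (ten i l₀) (hφ i l b)).trans ?_
    rw [← ten_smul, MulOpposite.op_unop, hs']
    rfl

lemma isHeart_hat [IsSimpleModule (R.gr 0)ᵐᵒᵖ L] : isHeart R ((toHot R).obj (hat R L)) := by
  obtain ⟨r⟩ := exists_retract_hat (R := R) L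
  refine ⟨.summand (r.map (toHot R)) .free, fun i hi => ?_⟩
  have h : ∀ x : (hat R L).bar.X i, x = 0 := by
    intro x
    induction x using QuotientAddGroup.induction_on with
    | H x =>
      refine (QuotientAddGroup.eq_zero_iff x).2 ?_
      induction x using ten_induction with
      | h l b =>
        rcases lt_or_gt_of_ne hi with hi | hi
        · have : b = 0 := Subtype.ext ((Submodule.mem_bot k).1
            (DGAlgebra.Admissible.positive (R := R) i hi ▸ b.2))
          rw [this, map_zero]
          exact zero_mem _
        · refine AddSubgroup.subset_closure ⟨0, i, zero_add i, hi, ten 0 l 1, b, ?_⟩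
          have e : R.mul (zero_add i) (1 : R.gr 0) b = b := by ext; simp
          exact (congrArg (ten i l) e).symm
      | h0 => exact zero_mem _
      | hadd x y hx hy => exact add_mem hx hy
  refine ⟨fun a b => ?_⟩
  induction a using QuotientAddGroup.induction_on with
  | H a =>
    induction b using QuotientAddGroup.induction_on with
    | H b => exact congrArg _ (Subtype.ext ((h _).trans (h _).symm))

variable (R) in
/-- The object `L̂` of the heart, for a simple right `A^0`-module `L`. -/
def heartHat [IsSimpleModule (R.gr 0)ᵐᵒᵖ L] : Heart R :=
  ⟨(toHot R).obj (hat R L), isHeart_hat L⟩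

end Hat

end DGMod

end

noncomputable section

/-! ### Graded maps between dg modules, sub- and quotient objects, kernels and cokernels. -/

namespace DGMod

variable {k : Type w} [CommRing k] {R : DGAlgebra.{w, u} k}

/-! The heart is a category of honest dg modules. A perfect dg module is a homotopy retract of one
that is finitely generated projective as a graded module. Splitting the differential of `M̄` over
the semisimple ring `A^0` and lifting idempotents modulo nilpotents replaces it by a minimal one,
with `d M ⊆ MA^+` (`IsPerfect.exists_minimal`). The quotient `M̄` of a minimal module is its own
cohomology, so for an object of the heart it sits in degree zero, and the module is pure: `M = M^0
⊗_{A^0} A` as a graded module, with `M^0` finitely generated (`exists_isPure`). Pure modules vanish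
in negative degrees, so homotopies between them are zero and homotopy classes are morphisms
(`IsPure.eq_of_toHot_map_eq`). A pure module is perfect exactly when the filtration `soc` exhausts
`M^0` (`IsPure.isUnipotent`, `IsPure.isPerfect`). Hence the heart is equivalent to the pure
unipotent dg modules, and semisimplicity of `A^0` makes kernels and cokernels of dg modules stay in
that class.

The rest is the theory of an injective cogenerator in a category of objects of finite length. Let
`J` be a pure representative of `I`. The obstruction to extending a morphism to `J` along `f : M ⟶
N` is a cocycle of degree one from the cokernel of `f` to `J`; since `H^1(J) = 0`, it is a
coboundary, by induction along `soc` (`IsPure.exists_bd`, `IsPure.exists_factorization`). The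
nonzero morphisms `L̂ ⟶ J` then make `J` a cogenerator, because a nonzero common kernel of all
morphisms `M ⟶ J` would contain a simple module `L` of cocycles (`IsPure.exists_apply_ne_zero`).

By finite length, every `M` embeds in some `J^n`, and a submodule `N` of `(End J)^n` has the same
common kernel in `J^n` as finitely many of its elements. The first fact makes `Hom(?, J)` fully
faithful with finitely generated values; the second realizes `(End J)^n / N` as `Hom(K, J)`, where
`K` is that common kernel (`IsPure.isDualizedBy`). `IsDualizedBy.exists_isEquivalence` turns this
into the equivalence. -/

/-- The identification of two components of a dg module whose indices agree. -/
def cast (M : DGMod R) {i j : ℤ} (h : i = j) : M.X i →+ M.X j := h ▸ AddMonoidHom.id _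

@[simp] lemma cast_rfl (M : DGMod R) {i : ℤ} (h : i = i) (x : M.X i) : M.cast h x = x := rfl

lemma act_cast (M : DGMod R) {i i' j n : ℤ} (e : i = i') (h : i' + j = n) (x : M.X i)
    (a : R.gr j) : M.act h (M.cast e x) a = M.act (e ▸ h) x a := by
  subst e; rfl

lemma cast_act (M : DGMod R) {i j n n' : ℤ} (e : n = n') (h : i + j = n) (x : M.X i)
    (a : R.gr j) : M.cast e (M.act h x a) = M.act (e ▸ h) x a := by
  subst e; rfl

lemma d_cast (M : DGMod R) {i i' j : ℤ} (e : i = i') (h : i' + 1 = j) (x : M.X i) :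
    M.d h (M.cast e x) = M.d (e ▸ h) x := by
  subst e; rfl

lemma cast_d (M : DGMod R) {i j j' : ℤ} (e : j = j') (h : i + 1 = j) (x : M.X i) :
    M.cast e (M.d h x) = M.d (e ▸ h) x := by
  subst e; rfl

/-- The graded pieces of a dg module are right modules over the degree zero part of the algebra. -/
instance instModule (M : DGMod R) (i : ℤ) : Module (R.gr 0)ᵐᵒᵖ (M.X i) where
  smul a x := M.act (add_zero i) x a.unop
  one_smul x := M.act_one x
  mul_smul a b x := by
    refine Eq.trans ?_ (M.act_act (add_zero i) (add_zero i) (add_zero 0) (add_zero i) x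
      b.unop a.unop).symm
    congr 1
  smul_zero a := by
    change M.act (add_zero i) 0 a.unop = 0
    simp
  smul_add a x y := by
    change M.act (add_zero i) (x + y) a.unop = M.act _ x _ + M.act _ y _
    simp
  add_smul a b x := by
    change M.act (add_zero i) x (a.unop + b.unop) = M.act _ x _ + M.act _ x _
    simp
  zero_smul x := by
    change M.act (add_zero i) x 0 = 0
    simp

lemma smul_eq_act (M : DGMod R) {i : ℤ} (a : (R.gr 0)ᵐᵒᵖ) (x : M.X i) :
    a • x = M.act (add_zero i) x a.unop := rfl

lemma act_zero_eq_smul (M : DGMod R) {i : ℤ} (h : i + 0 = i) (a : R.gr 0) (x : M.X i) :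
    M.act h x a = MulOpposite.op a • x := rfl

/-- `A`-linear maps of degree `p` between the graded modules underlying dg modules, with no
condition on the differentials. -/
@[ext]
structure GMap (M N : DGMod R) (p : ℤ) where
  f : ∀ {i j : ℤ} (_ : i + p = j), M.X i →+ N.X j
  map_act : ∀ {i j n i' n' : ℤ} (h : i + j = n) (hi : i + p = i') (hn : n + p = n')
    (h' : i' + j = n') (x : M.X i) (a : R.gr j), f hn (M.act h x a) = N.act h' (f hi x) a

namespace GMap

variable {M N P : DGMod R} {p q r : ℤ}

lemma f_cast (g : GMap M N p) {i i' j : ℤ} (e : i = i') (h : i' + p = j) (x : M.X i) :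
    g.f h (M.cast e x) = g.f (e ▸ h) x := by
  subst e; rfl

/-- Composition of graded maps, in diagrammatic order. -/
def comp (f : GMap M N p) (g : GMap N P q) (h : p + q = r) : GMap M P r where
  f {i j} e := (g.f (show i + p + q = j by omega)).comp (f.f rfl)
  map_act {i j n i' n'} h₁ hi hn h' x a := by
    simp only [AddMonoidHom.comp_apply]
    rw [f.map_act h₁ rfl rfl (by omega), g.map_act _ (by omega : i + p + q = i') _ (by omega)]

lemma comp_f (f : GMap M N p) (g : GMap N P q) (h : p + q = r) {i j l : ℤ} (e : i + r = l)
    (e₁ : i + p = j) (e₂ : j + q = l) (x : M.X i) :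
    (f.comp g h).f e x = g.f e₂ (f.f e₁ x) := by
  subst e₁; rfl

/-- The graded map underlying a morphism of dg modules. -/
def ofHom (f : M ⟶ N) : GMap M N 0 where
  f {i j} h := (N.cast (by omega : i = j)).comp (f.f i)
  map_act {i j n i' n'} h hi hn h' x a := by
    obtain rfl : i = i' := by omega
    obtain rfl : n = n' := by omega
    exact f.map_act h x a

@[simp] lemma ofHom_f (f : M ⟶ N) {i : ℤ} (h : i + 0 = i) (x : M.X i) :
    (ofHom f).f h x = f.f i x := rfl

/-- A graded map of degree zero which commutes with the differentials is a morphism. -/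
def toHom (g : GMap M N 0) (h : ∀ {i j : ℤ} (e : i + 1 = j) (x : M.X i),
    g.f (add_zero j) (M.d e x) = N.d e (g.f (add_zero i) x)) : M ⟶ N where
  f i := g.f (add_zero i)
  map_act h x a := g.map_act h _ _ _ x a
  map_d e x := h e x

@[simp] lemma toHom_f (g : GMap M N 0) (h : ∀ {i j : ℤ} (e : i + 1 = j) (x : M.X i),
    g.f (add_zero j) (M.d e x) = N.d e (g.f (add_zero i) x)) (i : ℤ) (x : M.X i) :
    (g.toHom h).f i x = g.f (add_zero i) x := rfl

instance : Zero (GMap M N p) := ⟨⟨fun _ => 0, by simp⟩⟩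

instance : Add (GMap M N p) := ⟨fun f g => ⟨fun e => f.f e + g.f e, fun h hi hn h' x a => by
  simp [f.map_act h hi hn h', g.map_act h hi hn h']⟩⟩

instance : SMul ℤ (GMap M N p) := ⟨fun z f => ⟨fun e => z • f.f e, fun h hi hn h' x a => by
  simp [f.map_act h hi hn h']⟩⟩

@[simp] lemma zero_f {i j : ℤ} (h : i + p = j) (x : M.X i) : (0 : GMap M N p).f h x = 0 := rfl

@[simp] lemma add_f (f g : GMap M N p) {i j : ℤ} (h : i + p = j) (x : M.X i) :
    (f + g).f h x = f.f h x + g.f h x := rfl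

@[simp] lemma smul_f (z : ℤ) (f : GMap M N p) {i j : ℤ} (h : i + p = j) (x : M.X i) :
    (z • f).f h x = z • f.f h x := rfl

instance : Sub (GMap M N p) := ⟨fun f g => f + (-1 : ℤ) • g⟩

@[simp] lemma sub_f (f g : GMap M N p) {i j : ℤ} (h : i + p = j) (x : M.X i) :
    (f - g).f h x = f.f h x - g.f h x := by
  change f.f h x + (-1 : ℤ) • g.f h x = _
  simp [sub_eq_add_neg]

lemma map_smul (g : GMap M N p) {i j : ℤ} (h : i + p = j) (a : (R.gr 0)ᵐᵒᵖ) (x : M.X i) :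
    g.f h (a • x) = a • g.f h x :=
  g.map_act _ h h _ x a.unop

/-- A component of a graded map as a linear map over the degree zero part of the algebra. -/
def lin (g : GMap M N p) {i j : ℤ} (h : i + p = j) : M.X i →ₗ[(R.gr 0)ᵐᵒᵖ] N.X j where
  toFun := g.f h
  map_add' := map_add _
  map_smul' := g.map_smul h

/-- The commutator `d u - u d` of a graded map of degree zero with the differential. -/
def bd (u : GMap M N 0) : GMap M N 1 where
  f {i j} h := (N.d h).comp (u.f (add_zero i)) - (u.f (add_zero j)).comp (M.d h)
  map_act {i j n i' n'} h hi hn h' x a := by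
    simp only [AddMonoidHom.sub_apply, AddMonoidHom.comp_apply]
    rw [u.map_act h (add_zero i) _ h, N.d_act h hn hi rfl h' (by omega),
      M.d_act h hn hi rfl h' (by omega), map_add, u.map_act h' (add_zero i') _ h', Units.smul_def,
      Units.smul_def, map_zsmul, u.map_act _ (add_zero i) _ (by omega)]
    simp

@[simp] lemma bd_f (u : GMap M N 0) {i j : ℤ} (h : i + 1 = j) (x : M.X i) :
    u.bd.f h x = N.d h (u.f (add_zero i) x) - u.f (add_zero j) (M.d h x) := rfl

lemma d_bd (u : GMap M N 0) {i j l : ℤ} (h : i + 1 = j) (h' : j + 1 = l) (x : M.X i) :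
    N.d h' (u.bd.f h x) = - u.bd.f h' (M.d h x) := by
  simp [N.d_d, M.d_d]

end GMap

/-- The linear map given by a component of a morphism. -/
def Hom.lin {M N : DGMod R} (f : M ⟶ N) (i : ℤ) : M.X i →ₗ[(R.gr 0)ᵐᵒᵖ] N.X i where
  toFun := f.f i
  map_add' := map_add _
  map_smul' a x := f.map_act _ x a.unop

lemma isIso_of_bijective {M N : DGMod R} (f : M ⟶ N) (h : ∀ i, Function.Bijective (f.f i)) :
    IsIso f := by
  let e (i : ℤ) : M.X i ≃+ N.X i := AddEquiv.ofBijective (f.f i) (h i)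
  have he : ∀ i x, (e i).symm (f.f i x) = x := fun i x => (e i).symm_apply_apply x
  have he' : ∀ i x, f.f i ((e i).symm x) = x := fun i x => (e i).apply_symm_apply x
  refine ⟨⟨⟨fun i => (e i).symm.toAddMonoidHom, fun {i j n} h' x a => ?_, fun {i j} h' x => ?_⟩,
    ?_, ?_⟩⟩
  · apply (h n).1
    simp [he', f.map_act]
  · apply (h j).1
    simp [he', f.map_d]
  · ext i x; exact he i x
  · ext i x; exact he' i x

section SubQuot

variable (M : DGMod R) (P : ∀ i, AddSubgroup (M.X i))
  (hact : ∀ {i j n : ℤ} (h : i + j = n) (x : M.X i) (_ : x ∈ P i) (a : R.gr j),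
    M.act h x a ∈ P n)
  (hd : ∀ {i j : ℤ} (h : i + 1 = j) (x : M.X i) (_ : x ∈ P i), M.d h x ∈ P j)

/-- A family of subgroups stable under the action and the differential, as a dg module. -/
def sub : DGMod R where
  X i := P i
  act h := AddMonoidHom.mk' (fun x => AddMonoidHom.mk' (fun a => ⟨M.act h x a, hact h x x.2 a⟩)
    (fun a b => by ext; simp)) (fun x y => by ext; simp)
  d h := AddMonoidHom.mk' (fun x => ⟨M.d h x, hd h x x.2⟩) (fun x y => by ext; simp)
  act_one x := Subtype.ext (M.act_one x.1)
  act_act hij hpl hjl hiq x a b := Subtype.ext (M.act_act hij hpl hjl hiq x.1 a b)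
  d_d hij hjl x := Subtype.ext (M.d_d hij hjl x.1)
  d_act {i _ _ _ _ _} h hn hi hj hl hr x a := Subtype.ext (by
    have := M.d_act h hn hi hj hl hr x.1 a
    simpa [Units.smul_def] using this)

/-- The inclusion of a sub dg module. -/
def subι : M.sub P hact hd ⟶ M where
  f i := (P i).subtype
  map_act _ _ _ := rfl
  map_d _ _ := rfl

variable {M} in
/-- The factorization of a morphism through a sub dg module. -/
def subLift {N : DGMod R} (f : N ⟶ M) (hf : ∀ i x, f.f i x ∈ P i) : N ⟶ M.sub P hact hd where
  f i := (f.f i).codRestrict (P i) (hf i)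
  map_act h x a := Subtype.ext (f.map_act h x a)
  map_d h x := Subtype.ext (f.map_d h x)

/-- The quotient of a dg module by a stable family of subgroups. -/
def quot : DGMod R where
  X i := M.X i ⧸ P i
  act {i j n} h := QuotientAddGroup.lift (P i)
    (AddMonoidHom.mk' (fun x => (QuotientAddGroup.mk' (P n)).comp (M.act h x))
      (fun x x' => by ext; simp))
    (fun x hx => by
      ext a
      simpa using hact h x hx a)
  d {i j} h := QuotientAddGroup.map _ _ (M.d h) (fun x hx => hd h x hx)
  act_one x := by
    induction x using QuotientAddGroup.induction_on with
    | H x => exact congrArg (QuotientAddGroup.mk' (P _)) (M.act_one x)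
  act_act hij hpl hjl hiq x a b := by
    induction x using QuotientAddGroup.induction_on with
    | H x => exact congrArg (QuotientAddGroup.mk' (P _)) (M.act_act hij hpl hjl hiq x a b)
  d_d hij hjl x := by
    induction x using QuotientAddGroup.induction_on with
    | H x => exact congrArg (QuotientAddGroup.mk' (P _)) (M.d_d hij hjl x)
  d_act h hm hi hj hl hr x a := by
    induction x using QuotientAddGroup.induction_on with
    | H x => exact congrArg (QuotientAddGroup.mk' (P _)) (M.d_act h hm hi hj hl hr x a)

/-- The projection to a quotient dg module. -/
def quotπ : M ⟶ M.quot P hact hd where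
  f i := QuotientAddGroup.mk' (P i)
  map_act _ _ _ := rfl
  map_d _ _ := rfl

lemma quotπ_surjective (i : ℤ) : Function.Surjective ((M.quotπ P hact hd).f i) :=
  QuotientAddGroup.mk'_surjective _

@[simp] lemma quotπ_eq_zero {i : ℤ} (x : M.X i) : (M.quotπ P hact hd).f i x = 0 ↔ x ∈ P i :=
  QuotientAddGroup.eq_zero_iff x

/-- The graded map out of a quotient induced by a graded map vanishing on the subgroups. -/
def quotLift {N : DGMod R} {p : ℤ} (g : GMap M N p)
    (hg : ∀ {i j : ℤ} (h : i + p = j) (x) (_ : x ∈ P i), g.f h x = 0) :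
    GMap (M.quot P hact hd) N p where
  f {i j} h := QuotientAddGroup.lift (P i) (g.f h) (hg h)
  map_act h hi hn h' x a := by
    induction x using QuotientAddGroup.induction_on with
    | H x => exact g.map_act h hi hn h' x a

end SubQuot

section KernelCokernel

variable {M N : DGMod R} (f : M ⟶ N)

lemma act_mem_ker {i j n : ℤ} (h : i + j = n) (x : M.X i) (hx : x ∈ (f.f i).ker) (a : R.gr j) :
    M.act h x a ∈ (f.f n).ker := by
  rw [AddMonoidHom.mem_ker] at hx ⊢
  rw [f.map_act, hx]; simp

lemma d_mem_ker {i j : ℤ} (h : i + 1 = j) (x : M.X i) (hx : x ∈ (f.f i).ker) :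
    M.d h x ∈ (f.f j).ker := by
  rw [AddMonoidHom.mem_ker] at hx ⊢
  rw [f.map_d, hx]; simp

lemma act_mem_range {i j n : ℤ} (h : i + j = n) (x : N.X i) (hx : x ∈ (f.f i).range)
    (a : R.gr j) : N.act h x a ∈ (f.f n).range := by
  obtain ⟨x, rfl⟩ := hx
  exact ⟨M.act h x a, f.map_act h x a⟩

lemma d_mem_range {i j : ℤ} (h : i + 1 = j) (x : N.X i) (hx : x ∈ (f.f i).range) :
    N.d h x ∈ (f.f j).range := by
  obtain ⟨x, rfl⟩ := hx
  exact ⟨M.d h x, f.map_d h x⟩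

/-- The kernel of a morphism of dg modules. -/
def ker : DGMod R := M.sub (fun i => (f.f i).ker) (act_mem_ker f) (d_mem_ker f)

/-- The inclusion of the kernel. -/
def kerι : ker f ⟶ M := M.subι (fun i => (f.f i).ker) (act_mem_ker f) (d_mem_ker f)

lemma kerι_injective (i : ℤ) : Function.Injective ((kerι f).f i) := Subtype.val_injective

lemma f_kerι {i : ℤ} (x : (ker f).X i) : f.f i ((kerι f).f i x) = 0 := x.2

/-- An element of the kernel. -/
def kerMk {i : ℤ} (x : M.X i) (hx : f.f i x = 0) : (ker f).X i := ⟨x, hx⟩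

@[simp] lemma kerι_mk {i : ℤ} (x : M.X i) (hx : f.f i x = 0) :
    (kerι f).f i (kerMk f x hx) = x := rfl

/-- The factorization of a morphism through the kernel. -/
def kerLift {P : DGMod R} (g : P ⟶ M) (hg : ∀ i x, f.f i (g.f i x) = 0) : P ⟶ ker f :=
  subLift (fun i => (f.f i).ker) (act_mem_ker f) (d_mem_ker f) g hg

/-- The factorization of a graded map through the kernel. -/
def kerGLift {P : DGMod R} {p : ℤ} (g : GMap P M p)
    (hg : ∀ {i j : ℤ} (h : i + p = j) (x), f.f j (g.f h x) = 0) : GMap P (ker f) p where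
  f h := (g.f h).codRestrict (f.f _).ker (hg h)
  map_act h hi hn h' x a := Subtype.ext (g.map_act h hi hn h' x a)

@[simp] lemma kerι_kerGLift {P : DGMod R} {p : ℤ} (g : GMap P M p)
    (hg : ∀ {i j : ℤ} (h : i + p = j) (x), f.f j (g.f h x) = 0) {i j : ℤ} (h : i + p = j)
    (x : P.X i) : (kerι f).f j ((kerGLift f g hg).f h x) = g.f h x := rfl

/-- The cokernel of a morphism of dg modules. -/
def coker : DGMod R := N.quot (fun i => (f.f i).range) (act_mem_range f) (d_mem_range f)

/-- The projection to the cokernel. -/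
def cokerπ : N ⟶ coker f :=
  N.quotπ (fun i => (f.f i).range) (act_mem_range f) (d_mem_range f)

lemma cokerπ_surjective (i : ℤ) : Function.Surjective ((cokerπ f).f i) :=
  N.quotπ_surjective (fun i => (f.f i).range) (act_mem_range f) (d_mem_range f) i

lemma cokerπ_eq_zero {i : ℤ} (y : N.X i) : (cokerπ f).f i y = 0 ↔ ∃ x, f.f i x = y :=
  N.quotπ_eq_zero (fun i => (f.f i).range) (act_mem_range f) (d_mem_range f) y

/-- The graded map out of the cokernel induced by a graded map vanishing on the image. -/
def cokerLift {P : DGMod R} {p : ℤ} (g : GMap N P p)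
    (hg : ∀ {i j : ℤ} (h : i + p = j) (x : M.X i), g.f h (f.f i x) = 0) :
    GMap (coker f) P p :=
  N.quotLift (fun i => (f.f i).range) (act_mem_range f) (d_mem_range f) g (by
    rintro i j h _ ⟨x, rfl⟩
    exact hg h x)

lemma cokerLift_f {P : DGMod R} {p : ℤ} (g : GMap N P p)
    (hg : ∀ {i j : ℤ} (h : i + p = j) (x : M.X i), g.f h (f.f i x) = 0) {i j : ℤ}
    (h : i + p = j) (x : N.X i) : (cokerLift f g hg).f h ((cokerπ f).f i x) = g.f h x := rfl

end KernelCokernel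

end DGMod

/-! ### Finitely generated graded projective modules and homotopical projectivity. -/

namespace DGMod

variable {k : Type w} [CommRing k] {R : DGAlgebra.{w, u} k}

/-- The values of a graded map to the free module, as elements of the algebra. -/
def GMap.val {N : DGMod R} {p : ℤ} (φ : GMap N (free R) p) {i j : ℤ} (h : i + p = j) :
    N.X i →+ R.gr j := φ.f h

lemma GMap.val_act {N : DGMod R} {p : ℤ} (φ : GMap N (free R) p) {i j n i' n' : ℤ}
    (h : i + j = n) (hi : i + p = i') (hn : n + p = n') (h' : i' + j = n') (x : N.X i)
    (a : R.gr j) : φ.val hn (N.act h x a) = R.mul h' (φ.val hi x) a := φ.map_act h hi hn h' x a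

/-- A dual basis of the graded module underlying a dg module: homogeneous elements `m i` and
`A`-linear functionals `φ i` with `x = ∑ m i (φ i x)`. -/
structure DualBasis (N : DGMod R) (ι : Type) [Fintype ι] where
  n : ι → ℤ
  m : ∀ i, N.X (n i)
  φ : ∀ i, GMap N (free R) (-n i)
  sum_eq : ∀ {j : ℤ} (x : N.X j),
    ∑ i, N.act (by omega : n i + (j + -n i) = j) (m i) ((φ i).val rfl x) = x

/-- The dg module is finitely generated projective as a graded module. -/
def IsFinProj (N : DGMod R) : Prop :=
  ∃ (ι : Type) (_ : Fintype ι), Nonempty (DualBasis N ι)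

lemma act_val_congr {N P : DGMod R} {p n j l l' t : ℤ} (φ : GMap P (free R) p) (m : N.X n)
    (x : P.X j) (h : j + p = l) (h' : j + p = l') (e : n + l = t) (e' : n + l' = t) :
    N.act e m (φ.val h x) = N.act e' m (φ.val h' x) := by
  obtain rfl : l = l' := h.symm.trans h'
  rfl

namespace DualBasis

variable {N P : DGMod R} {ι : Type} [Fintype ι] (b : DualBasis N ι)

lemma sum_eq' {j : ℤ} (x : N.X j) (l : ι → ℤ) (h : ∀ i, j + -b.n i = l i)
    (e : ∀ i, b.n i + l i = j) : ∑ i, N.act (e i) (b.m i) ((b.φ i).val (h i) x) = x := by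
  refine Eq.trans (Finset.sum_congr rfl fun i _ => ?_) (b.sum_eq x)
  exact act_val_congr _ _ _ _ _ _ _

/-- The graded map with prescribed values on the elements of a dual basis (this prescribes its
values only when the elements form a basis). -/
def lift {p : ℤ} (c : ∀ i, P.X (b.n i + p)) : GMap N P p where
  f {j l} h := ∑ i, ((P.act (by omega : b.n i + p + (j + -b.n i) = l)) (c i)).comp
    ((b.φ i).val rfl)
  map_act {i j n i' n'} h hi hn h' x a := by
    simp only [AddMonoidHom.finsetSum_apply, AddMonoidHom.comp_apply, map_sum]
    refine Finset.sum_congr rfl fun t _ => ?_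
    rw [(b.φ t).val_act h rfl rfl (by omega)]
    exact (P.act_act _ _ _ _ _ _ _).symm

lemma lift_f {p : ℤ} (c : ∀ i, P.X (b.n i + p)) {j l : ℤ} (h : j + p = l) (x : N.X j) :
    (b.lift c).f h x = ∑ i, P.act (by omega : b.n i + p + (j + -b.n i) = l) (c i)
      ((b.φ i).val rfl x) := by
  simp [lift]

end DualBasis

/-- The unit of the algebra as an element of the free module. -/
def one : (free R).X 0 := (1 : R.gr 0)

lemma free_act_one {j : ℤ} (h : 0 + j = j) (a : R.gr j) : (free R).act h one a = a := by
  refine Subtype.ext ?_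
  change ((1 : R.gr 0) : R.carrier) * a = a
  simp

lemma isFinProj_free : IsFinProj (free R) := by
  refine ⟨Unit, inferInstance, ⟨⟨fun _ => 0, fun _ => one, fun _ => ?_, fun {j} x => ?_⟩⟩⟩
  · exact ⟨fun {i j} h => (free R).cast (by omega), fun {i j n i' n'} h hi hn h' x a => by
      obtain rfl : i = i' := by omega
      obtain rfl : n = n' := by omega
      rfl⟩
  · have key : ∀ (l : ℤ) (h : j = l) (h' : 0 + l = j),
        (free R).act h' one ((free R).cast h x) = x := by
      rintro l rfl h'
      exact free_act_one _ _
    simp only [Finset.univ_unique, Finset.sum_singleton]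
    exact key (j + -0) (by omega) (by omega)

lemma IsFinProj.shift {N : DGMod R} (hN : IsFinProj N) (s : ℤ) : IsFinProj (N.shift s) := by
  obtain ⟨ι, _, ⟨b⟩⟩ := hN
  refine ⟨ι, inferInstance, ⟨⟨fun i => b.n i - s,
    fun i => N.cast (by omega : b.n i = b.n i - s + s) (b.m i),
    fun i => ⟨fun {j l} h => (b.φ i).f (by omega : j + s + -b.n i = l), ?_⟩, fun {j} x => ?_⟩⟩⟩
  · intro i' j n i'' n' h hi hn h' x a
    exact (b.φ i).map_act (by omega : i' + s + j = n + s) _ _ _ x a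
  · refine Eq.trans (Finset.sum_congr rfl fun i _ => ?_) (b.sum_eq' (j := j + s) x
      (fun i => j + -(b.n i - s)) (fun i => by omega) (fun i => by omega))
    exact N.act_cast _ _ _ _

section Cone

variable {M N : DGMod R} (f : M ⟶ N)

/-- The inclusion of the target in the cone. -/
def coneInl (i : ℤ) : N.X i →+ (cone f).X i := AddMonoidHom.inl (N.X i) (M.X (i + 1))

/-- The inclusion of the shifted source in the cone. -/
def coneInr (i : ℤ) : M.X (i + 1) →+ (cone f).X i := AddMonoidHom.inr (N.X i) (M.X (i + 1))

/-- The projection of the cone to the target. -/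
def coneFst (i : ℤ) : (cone f).X i →+ N.X i := AddMonoidHom.fst (N.X i) (M.X (i + 1))

/-- The projection of the cone to the shifted source. -/
def coneSnd (i : ℤ) : (cone f).X i →+ M.X (i + 1) := AddMonoidHom.snd (N.X i) (M.X (i + 1))

@[simp] lemma coneFst_inl {i : ℤ} (y : N.X i) : coneFst f i (coneInl f i y) = y := rfl
@[simp] lemma coneFst_inr {i : ℤ} (x : M.X (i + 1)) : coneFst f i (coneInr f i x) = 0 := rfl
@[simp] lemma coneSnd_inl {i : ℤ} (y : N.X i) : coneSnd f i (coneInl f i y) = 0 := rfl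
@[simp] lemma coneSnd_inr {i : ℤ} (x : M.X (i + 1)) : coneSnd f i (coneInr f i x) = x := rfl

variable {f} in
lemma cone_ext {i : ℤ} {z z' : (cone f).X i} (h : coneFst f i z = coneFst f i z')
    (h' : coneSnd f i z = coneSnd f i z') : z = z' := Prod.ext h h'

lemma cone_eq {i : ℤ} (z : (cone f).X i) :
    z = coneInl f i (coneFst f i z) + coneInr f i (coneSnd f i z) :=
  cone_ext (by simp) (by simp)

lemma coneFst_act {i j n : ℤ} (h : i + j = n) (z : (cone f).X i) (a : R.gr j) :
    coneFst f n ((cone f).act h z a) = N.act h (coneFst f i z) a := rfl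

lemma coneSnd_act {i j n : ℤ} (h : i + j = n) (z : (cone f).X i) (a : R.gr j) :
    coneSnd f n ((cone f).act h z a) = M.act (by omega : i + 1 + j = n + 1) (coneSnd f i z) a :=
  rfl

lemma coneFst_d {i j : ℤ} (h : i + 1 = j) (z : (cone f).X i) :
    coneFst f j ((cone f).d h z) =
      N.d h (coneFst f i z) + f.f j (M.cast h (coneSnd f i z)) := by
  subst h; rfl

lemma coneSnd_d {i j : ℤ} (h : i + 1 = j) (z : (cone f).X i) :
    coneSnd f j ((cone f).d h z) = -M.d (by omega : i + 1 + 1 = j + 1) (coneSnd f i z) := rfl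

lemma cone_act_inl {i j n : ℤ} (h : i + j = n) (y : N.X i) (a : R.gr j) :
    (cone f).act h (coneInl f i y) a = coneInl f n (N.act h y a) :=
  cone_ext (by simp [coneFst_act]) (by simp [coneSnd_act])

lemma cone_act_inr {i j n : ℤ} (h : i + j = n) (h' : i + 1 + j = n + 1) (x : M.X (i + 1))
    (a : R.gr j) : (cone f).act h (coneInr f i x) a = coneInr f n (M.act h' x a) :=
  cone_ext (by simp [coneFst_act]) (by simp [coneSnd_act])

lemma cone_d_inl {i j : ℤ} (h : i + 1 = j) (y : N.X i) :
    (cone f).d h (coneInl f i y) = coneInl f j (N.d h y) :=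
  cone_ext (by simp [coneFst_d]) (by simp [coneSnd_d])

lemma cone_d_inr {i j : ℤ} (h : i + 1 = j) (h' : i + 1 + 1 = j + 1) (x : M.X (i + 1)) :
    (cone f).d h (coneInr f i x) =
      coneInl f j (f.f j (M.cast h x)) + coneInr f j (-M.d h' x) :=
  cone_ext (by simp [coneFst_d]) (by simp [coneSnd_d])

lemma IsFinProj.cone (hM : IsFinProj M) (hN : IsFinProj N) : IsFinProj (DGMod.cone f) := by
  obtain ⟨ι, _, ⟨b⟩⟩ := hM
  obtain ⟨κ, _, ⟨c⟩⟩ := hN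
  refine ⟨κ ⊕ ι, inferInstance, ⟨⟨Sum.elim c.n (fun i => b.n i - 1),
    fun i => match i with
      | .inl i => coneInl f _ (c.m i)
      | .inr i => coneInr f (b.n i - 1) (M.cast (by simp : b.n i = b.n i - 1 + 1) (b.m i)),
    fun i => match i with
      | .inl i => ⟨fun {j l} h => ((c.φ i).f h).comp (coneFst f j), ?_⟩
      | .inr i => ⟨fun {j l} h => ((b.φ i).f (by simp at h; omega : j + 1 + -b.n i = l)).comp
          (coneSnd f j), ?_⟩, fun {j} z => ?_⟩⟩⟩
  · intro i' j n i'' n' h hi hn h' x a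
    exact (c.φ i).map_act h _ _ _ (coneFst f _ x) a
  · intro i' j n i'' n' h hi hn h' x a
    exact (b.φ i).map_act (by omega : i' + 1 + j = n + 1) _ _ _ (coneSnd f _ x) a
  · rw [Fintype.sum_sum_type]
    refine Eq.trans (congrArg₂ (fun a b => a + b) (?_ : _ = coneInl f j (coneFst f j z))
      (?_ : _ = coneInr f j (coneSnd f j z))) (cone_eq f z).symm
    · conv_rhs => rw [← c.sum_eq (coneFst f j z), map_sum]
      exact Finset.sum_congr rfl fun i _ => cone_act_inl f _ _ _
    · conv_rhs => rw [← b.sum_eq' (coneSnd f j z) (fun i => j + -(b.n i - 1))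
        (fun i => by omega) (fun i => by omega), map_sum]
      refine Finset.sum_congr rfl fun i _ => ?_
      refine (cone_act_inr f _ (by omega) _ _).trans ?_
      exact congrArg (coneInr f j) (M.act_cast _ _ _ _)

end Cone

/-- A dg module without cohomology. -/
def IsAcyclic (C : DGMod R) : Prop :=
  ∀ {i j l : ℤ} (h : i + 1 = j) (h' : j + 1 = l) (x : C.X j), C.d h' x = 0 → ∃ y, C.d h y = x

/-- A dg module is homotopically projective if every cocycle of graded maps, of any degree, to an
acyclic dg module is a coboundary. -/
def IsHProj (N : DGMod R) : Prop :=
  ∀ (C : DGMod R) (_ : IsAcyclic C) {p q : ℤ} (_ : q + 1 = p) (c : GMap N C p)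
    (_ : ∀ {i i' j j' : ℤ} (hi : i + 1 = i') (hj : j + 1 = j') (h : i + p = j) (h' : i' + p = j')
      (x : N.X i), C.d hj (c.f h x) = (p.negOnePow : ℤ) • c.f h' (N.d hi x)),
    ∃ s : GMap N C q, ∀ {i i' a b : ℤ} (h : i + p = a) (hb : b + 1 = a) (h₁ : i + q = b)
      (hi : i + 1 = i') (h₂ : i' + q = a) (x : N.X i),
      c.f h x = C.d hb (s.f h₁ x) + (p.negOnePow : ℤ) • s.f h₂ (N.d hi x)

lemma negOnePow_pred {p q : ℤ} (h : q + 1 = p) :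
    (p.negOnePow : ℤ) = -(q.negOnePow : ℤ) := by
  subst h
  simp [Int.negOnePow_succ]

lemma negOnePow_mul_self (p : ℤ) : (p.negOnePow : ℤ) * (p.negOnePow : ℤ) = 1 := by
  rcases Int.units_eq_one_or p.negOnePow with h | h <;> simp [h]

/-- The graded map `a ↦ x a` from the free module. -/
def freeMap {M : DGMod R} {p : ℤ} (x : M.X p) : GMap (free R) M p where
  f {i j} h := M.act (by omega : p + i = j) x
  map_act h hi hn h' a b := (M.act_act _ h' h _ x a b).symm

/-- A graded map out of `A` is determined by its value at `1`. For a cocycle this value is a cycle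
of the acyclic module, and a primitive `y` of it gives the homotopy `a ↦ y a`. -/
lemma isHProj_free : IsHProj (free R) := by
  intro C hC p q hq c hc
  have hone : ∀ {i j : ℤ} (h : i + p = j) (h' : p + i = j) (a : (free R).X i),
      c.f h a = C.act h' (c.f (zero_add p) one) a := by
    intro i j h h' a
    conv_lhs => rw [← free_act_one (zero_add i) a]
    exact c.map_act _ _ _ _ _ _
  -- The Leibniz rule for `1 * 1` reads `d 1 = d 1 + d 1`.
  have hd1 : (free R).d (zero_add 1) (one : (free R).X 0) = 0 := by
    refine Subtype.ext ?_
    change R.diff ((1 : R.gr 0) : R.carrier) = 0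
    have h := R.leibniz 0 1 1 (SetLike.GradedOne.one_mem)
    simpa using h
  obtain ⟨y, hy⟩ := hC hq rfl (c.f (zero_add p) one) (by
    rw [hc (zero_add 1) rfl (zero_add p) (by omega), hd1]; simp)
  refine ⟨freeMap y, ?_⟩
  intro i i' a b h hb h₁ hi h₂ x
  have key := C.d_act (by omega : q + i = b) hb hq hi (by omega) (by omega) y x
  rw [hone h (by omega), ← hy]
  change _ = C.d hb (C.act _ y x) + (_ : ℤ) • (C.act _ y (R.d hi x) : C.X a)
  rw [key, negOnePow_pred hq, Units.smul_def]
  simp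

/-- A cocycle of degree `p` on the shift by `s` is, after reindexing, one of degree `p - s` on `N`:
the sign `(-1)^s` in the shifted differential makes up for the change from `(-1)^p` to `(-1)^(p -
s)`. This is one reason why the definition admits all degrees. -/
lemma IsHProj.shift {N : DGMod R} (hN : IsHProj N) (s : ℤ) : IsHProj (N.shift s) := by
  intro C hC p q hq c hc
  let c' : GMap N C (p - s) := ⟨fun {i j} h => (c.f (by omega : i - s + p = j)).comp
    (N.cast (by omega : i = i - s + s)), fun {i j n i' n'} h hi hn h' x a => by
      refine Eq.trans (congrArg (c.f _) ?_) (c.map_act (by omega : i - s + j = n - s) _ _ h'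
        (N.cast (by omega : i = i - s + s) x) a)
      exact (N.cast_act _ _ _ _).trans (N.act_cast _ _ _ _).symm⟩
  have sgn : ((p - s).negOnePow : ℤ) * (s.negOnePow : ℤ) = (p.negOnePow : ℤ) := by
    rw [← Units.val_mul, ← Int.negOnePow_add, sub_add_cancel]
  obtain ⟨t, ht⟩ := hN C hC (p := p - s) (q := q - s) (by omega) c' (by
    intro i i' j j' hi hj h h' x
    refine (hc (by omega : i - s + 1 = i' - s) hj (by omega) (by omega)
      (N.cast (by omega : i = i - s + s) x)).trans ?_
    have e : (N.shift s).d (by omega : i - s + 1 = i' - s) (N.cast (by omega : i = i - s + s) x) =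
        (s.negOnePow : ℤ) • N.cast (by omega : i' = i' - s + s) (N.d hi x) := by
      change s.negOnePow • N.d _ _ = _
      rw [N.d_cast, N.cast_d, Units.smul_def]
    refine (congrArg (fun z => (p.negOnePow : ℤ) • c.f _ z) e).trans ?_
    refine (congrArg (fun z => (p.negOnePow : ℤ) • z) (map_zsmul (c.f _) _ _)).trans ?_
    rw [smul_smul, ← sgn, mul_assoc, negOnePow_mul_self, mul_one]
    rfl)
  refine ⟨⟨fun {i j} h => t.f (by omega : i + s + (q - s) = j), fun h hi hn h' x a =>
    t.map_act (by omega) _ _ _ _ _⟩, ?_⟩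
  intro i i' a b h hb h₁ hi h₂ x
  have := ht (by omega : i + s + (p - s) = a) hb (by omega) (by omega : i + s + 1 = i' + s)
    (by omega) x
  have e : c'.f (by omega : i + s + (p - s) = a) x = c.f h x := by
    have key : ∀ (l : ℤ) (e : i = l) (e' : i + s = l + s) (h' : l + p = a),
        c.f h' (N.cast e' x : N.X (l + s)) = c.f h x := by
      rintro l rfl _ _; rfl
    exact key (i + s - s) (by omega) (by omega) (by omega)
  rw [← e, this]
  congr 1
  change _ = _ • t.f _ (s.negOnePow • N.d _ x)
  rw [Units.smul_def, map_zsmul, smul_smul, ← sgn, mul_assoc, negOnePow_mul_self, mul_one]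

/-- Contract the restriction `c₁` to `N` first, by `s₁`. The restriction `c₂` to `M` has degree `p -
1` and fails to be a cocycle only by a multiple of `c₁ f`. Subtracting the multiple `(-1)^p s₁ f`
repairs this, so a contraction `s₂` exists on `M`, and `s₁` and `s₂` together contract `c`. -/
lemma IsHProj.cone {M N : DGMod R} (f : M ⟶ N) (hM : IsHProj M) (hN : IsHProj N) :
    IsHProj (DGMod.cone f) := by
  intro C hC p q hq c hc
  let c₁ : GMap N C p := ⟨fun {i j} h => (c.f h).comp (coneInl f i),
    fun {i j n i' n'} h hi hn h' x a => by
      simp only [AddMonoidHom.comp_apply]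
      rw [← cone_act_inl f h, c.map_act h hi hn h']⟩
  have hc₁ : ∀ {i j : ℤ} (h : i + p = j) (y : N.X i), c₁.f h y = c.f h (coneInl f i y) :=
    fun _ _ => rfl
  obtain ⟨s₁, hs₁⟩ := hN C hC hq c₁ (by
    intro i i' j j' hi hj h h' x
    rw [hc₁, hc hi hj h h', cone_d_inl, hc₁])
  let c₂ : GMap M C q := ⟨fun {i j} h => (c.f (by omega : i - 1 + p = j)).comp
    ((coneInr f (i - 1)).comp (M.cast (by omega))),
    fun {i j n i' n'} h hi hn h' x a => by
      simp only [AddMonoidHom.comp_apply]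
      rw [← c.map_act (by omega : i - 1 + j = n - 1) _ (by omega) h',
        cone_act_inr f _ (by omega), M.cast_act, M.act_cast]⟩
  have hc₂ : ∀ {i j : ℤ} (h : i + p = j) (h' : i + 1 + q = j) (x : M.X (i + 1)),
      c₂.f h' x = c.f h (coneInr f i x) := by
    intro i j h h' x
    have key : ∀ (l : ℤ) (e : i = l) (e' : i + 1 = l + 1) (e'' : l + p = j),
        c.f e'' (coneInr f l (M.cast e' x)) = c.f h (coneInr f i x) := by
      rintro l rfl _ _; rfl
    exact key (i + 1 - 1) (by omega) (by omega) (by omega)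
  have hd₂ : ∀ {i i' j j' : ℤ} (hi : i + 1 = i') (hj : j + 1 = j') (h : i + q = j)
      (h' : i' + q = j') (h'' : i + p = j') (x : M.X i), C.d hj (c₂.f h x) =
        (p.negOnePow : ℤ) • (c₁.f h'' (f.f i x) - c₂.f h' (M.d hi x)) := by
    intro i i' j j' hi hj h h' h'' x
    obtain ⟨l, rfl⟩ : ∃ l, i = l + 1 := ⟨i - 1, by omega⟩
    obtain rfl : l + 1 + 1 = i' := by omega
    rw [hc₂ (by omega) h, hc rfl hj _ h'', cone_d_inr f rfl rfl, map_add, ← hc₁,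
      ← hc₂ _ h', map_neg, sub_eq_add_neg, cast_rfl]
  let σ : GMap M C q := ⟨fun {i j} h => (s₁.f h).comp (f.f i),
    fun {i j n i' n'} h hi hn h' x a => by
      simp only [AddMonoidHom.comp_apply, f.map_act]
      exact s₁.map_act _ _ _ _ _ _⟩
  have hσ : ∀ {i j : ℤ} (h : i + q = j) (x : M.X i), σ.f h x = s₁.f h (f.f i x) := fun _ _ => rfl
  obtain ⟨s₂, hs₂⟩ := hM C hC (p := q) (q := q - 1) (by omega) (c₂ - (p.negOnePow : ℤ) • σ) (by
    intro i i' j j' hi hj h h' x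
    rw [GMap.sub_f, GMap.sub_f, map_sub, hd₂ hi hj h h' (by omega), GMap.smul_f, GMap.smul_f, hσ,
      hσ, map_zsmul, f.map_d, hs₁ (by omega) hj h hi h', negOnePow_pred hq]
    rcases Int.units_eq_one_or q.negOnePow with e | e <;> simp only [e] <;> simp <;> abel)
  let s : GMap (DGMod.cone f) C q := ⟨fun {i j} h => (s₁.f h).comp (coneFst f i) +
    (s₂.f (by omega : i + 1 + (q - 1) = j)).comp (coneSnd f i),
    fun {i j n i' n'} h hi hn h' x a => by
      simp only [AddMonoidHom.add_apply, AddMonoidHom.comp_apply]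
      rw [coneFst_act, coneSnd_act, s₁.map_act h hi hn h',
        s₂.map_act (by omega : i + 1 + j = n + 1) (by omega : _ = i') _ h', map_add]
      rfl⟩
  have hs : ∀ {i j : ℤ} (h : i + q = j) (h' : i + 1 + (q - 1) = j) (z : (DGMod.cone f).X i),
      s.f h z = s₁.f h (coneFst f i z) + s₂.f h' (coneSnd f i z) := fun _ _ _ => rfl
  refine ⟨s, ?_⟩
  rintro i i' a b h hb h₁ rfl h₂ z
  have e := hs₂ h₂ hb (by omega) rfl (by omega) (coneSnd f i z)
  rw [GMap.sub_f, GMap.smul_f, hσ, sub_eq_iff_eq_add] at e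
  conv_lhs => rw [cone_eq f z]
  rw [map_add, ← hc₁, ← hc₂ h h₂, hs₁ h hb h₁ rfl h₂, e, hs h₁ (by omega), hs h₂ (by omega),
    coneFst_d, coneSnd_d, map_add, map_add, map_neg, cast_rfl, negOnePow_pred hq]
  rcases Int.units_eq_one_or q.negOnePow with e' | e' <;> simp only [e'] <;> simp <;> abel

end DGMod

/-! ### Homotopy retracts and perfect dg modules. -/

namespace DGMod

variable {k : Type w} [CommRing k] {R : DGAlgebra.{w, u} k}

/-- The graded map of degree `-1` underlying a homotopy. -/
def Homotopy.toGMap {M N : DGMod R} {f g : M ⟶ N} (s : Homotopy f g) : GMap M N (-1) where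
  f h := s.s (by omega)
  map_act h hi hn h' x a := s.s_act h _ _ h' x a

lemma Homotopy.eq_add {M N : DGMod R} {f g : M ⟶ N} (s : Homotopy f g) {h i j : ℤ}
    (hi : h + 1 = i) (hj : i + 1 = j) (x : M.X i) :
    f.f i x = g.f i x +
      (N.d hi (s.toGMap.f (by omega) x) + s.toGMap.f (by omega) (M.d hj x)) :=
  s.comm hi hj x

/-- A homotopy given by a graded map of degree `-1`. -/
def Homotopy.ofGMap {M N : DGMod R} {f g : M ⟶ N} (s : GMap M N (-1))
    (hs : ∀ {h i j : ℤ} (hi : h + 1 = i) (hj : i + 1 = j) (x : M.X i),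
      f.f i x = g.f i x + (N.d hi (s.f (by omega) x) + s.f (by omega) (M.d hj x))) :
    Homotopy f g where
  s h := s.f (by omega)
  s_act h _ _ h' x a := s.map_act h _ _ h' x a
  comm hi hj x := hs hi hj x

lemma toHot_map_eq_iff {M N : DGMod R} (f g : M ⟶ N) :
    (toHot R).map f = (toHot R).map g ↔ Nonempty (Homotopy f g) :=
  CategoryTheory.Quotient.functor_map_eq_iff (homotopic R) f g

lemma nonempty_retract_iff (M N : DGMod R) :
    Nonempty (Retract ((toHot R).obj M) ((toHot R).obj N)) ↔
      ∃ (i : M ⟶ N) (p : N ⟶ M), Nonempty (Homotopy (i ≫ p) (𝟙 M)) := by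
  constructor
  · rintro ⟨r⟩
    obtain ⟨i, hi⟩ := (toHot R).map_surjective r.i
    obtain ⟨p, hp⟩ := (toHot R).map_surjective r.r
    refine ⟨i, p, (toHot_map_eq_iff _ _).1 ?_⟩
    rw [Functor.map_comp, hi, hp, r.retract, CategoryTheory.Functor.map_id]
  · rintro ⟨i, p, h⟩
    refine ⟨⟨(toHot R).map i, (toHot R).map p, ?_⟩⟩
    rw [← Functor.map_comp, (toHot_map_eq_iff _ _).2 h, CategoryTheory.Functor.map_id]

/-- The shift of a morphism. -/
def shiftMap {M N : DGMod R} (f : M ⟶ N) (n : ℤ) : M.shift n ⟶ N.shift n where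
  f i := f.f (i + n)
  map_act _ x a := f.map_act _ x a
  map_d {i j} h (x : M.X (i + n)) := by
    change f.f (j + n) (n.negOnePow • M.d _ x) = n.negOnePow • N.d _ (f.f (i + n) x)
    rw [Units.smul_def, Units.smul_def, map_zsmul, f.map_d]

/-- The shift of a homotopy. -/
def Homotopy.shift {M N : DGMod R} {f g : M ⟶ N} (s : Homotopy f g) (n : ℤ) :
    Homotopy (shiftMap f n) (shiftMap g n) where
  s {i j} h := (n.negOnePow : ℤ) • s.s (by omega : j + n + 1 = i + n)
  s_act {i j m i' m'} h hi hn h' x a := by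
    have e := s.s_act (by omega : i + n + j = m + n) (by omega : i' + n + 1 = i + n)
      (by omega : m' + n + 1 = m + n) (by omega) x a
    change (n.negOnePow : ℤ) • s.s _ (M.act _ x a) = N.act _ ((n.negOnePow : ℤ) • s.s _ x) a
    rw [e]
    simp
  comm {h i j} hi hj (x : M.X (i + n)) := by
    have e := s.comm (by omega : h + n + 1 = i + n) (by omega : i + n + 1 = j + n) x
    change (f.f (i + n) x : N.X (i + n)) = g.f (i + n) x +
      ((n.negOnePow • N.d _ ((n.negOnePow : ℤ) • s.s _ x) : N.X (i + n)) +
        ((n.negOnePow : ℤ) • s.s _ (n.negOnePow • M.d _ x) : N.X (i + n)))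
    rw [e]
    simp only [Units.smul_def, map_zsmul, smul_smul, negOnePow_mul_self, one_smul]

section ConeMap

variable {M N M' N' : DGMod R} (f : M ⟶ N) (f' : M' ⟶ N') (α : M ⟶ M') (β : N ⟶ N')
  (θ : GMap M N' (-1))

/-- The map of cones `(y, x) ↦ (β y + θ x, α x)` attached to a square commuting up to the
homotopy `θ`. -/
def coneMap
    (hθ : ∀ {i j l : ℤ} (h : i + 1 = j) (h' : j + 1 = l) (x : M.X j),
      N'.d h (θ.f (by omega) x) + θ.f (by omega) (M.d h' x) = β.f j (f.f j x) - f'.f j (α.f j x)) :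
    cone f ⟶ cone f' where
  f i := (coneInl f' i).comp ((β.f i).comp (coneFst f i) +
      (θ.f (by omega : i + 1 + -1 = i)).comp (coneSnd f i)) +
    (coneInr f' i).comp ((α.f (i + 1)).comp (coneSnd f i))
  map_act {i j n} h z a := by
    refine cone_ext ?_ ?_
    · simp [coneFst_act, coneSnd_act, β.map_act,
        θ.map_act (by omega : i + 1 + j = n + 1) (by omega : i + 1 + -1 = i) (by omega) h]
    · simp [coneSnd_act, α.map_act]
  map_d {i j} h z := by
    refine cone_ext ?_ ?_
    · subst h
      have e := hθ rfl rfl (coneSnd f i z)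
      simp only [coneFst_d, coneSnd_d, AddMonoidHom.add_apply, AddMonoidHom.comp_apply, map_add,
        coneFst_inl, coneFst_inr, coneSnd_inl, coneSnd_inr, β.map_d, cast_rfl, map_neg, add_zero,
        zero_add, map_zero]
      rw [eq_sub_iff_add_eq] at e
      rw [← e]
      abel
    · simp [coneSnd_d, α.map_d]

@[simp] lemma coneFst_coneMap
    (hθ : ∀ {i j l : ℤ} (h : i + 1 = j) (h' : j + 1 = l) (x : M.X j),
      N'.d h (θ.f (by omega) x) + θ.f (by omega) (M.d h' x) = β.f j (f.f j x) - f'.f j (α.f j x))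
    {i : ℤ} (z : (cone f).X i) :
    coneFst f' i ((coneMap f f' α β θ hθ).f i z) =
      β.f i (coneFst f i z) + θ.f (by omega : i + 1 + -1 = i) (coneSnd f i z) := by
  simp [coneMap]

@[simp] lemma coneSnd_coneMap
    (hθ : ∀ {i j l : ℤ} (h : i + 1 = j) (h' : j + 1 = l) (x : M.X j),
      N'.d h (θ.f (by omega) x) + θ.f (by omega) (M.d h' x) = β.f j (f.f j x) - f'.f j (α.f j x))
    {i : ℤ} (z : (cone f).X i) :
    coneSnd f' i ((coneMap f f' α β θ hθ).f i z) = α.f (i + 1) (coneSnd f i z) := by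
  simp [coneMap]

end ConeMap

/-- Composition of a graded map with a morphism on the right. -/
def GMap.compHom {M N P : DGMod R} {p : ℤ} (g : GMap M N p) (f : N ⟶ P) : GMap M P p where
  f {_ j} h := (f.f j).comp (g.f h)
  map_act h hi hn h' x a := by simp [g.map_act h hi hn h', f.map_act]

@[simp] lemma GMap.compHom_f {M N P : DGMod R} {p : ℤ} (g : GMap M N p) (f : N ⟶ P) {i j : ℤ}
    (h : i + p = j) (x : M.X i) : (g.compHom f).f h x = f.f j (g.f h x) := rfl

/-- Composition of a graded map with a morphism on the left. -/
def GMap.precompHom {M N P : DGMod R} {p : ℤ} (f : M ⟶ N) (g : GMap N P p) : GMap M P p where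
  f {i _} h := (g.f h).comp (f.f i)
  map_act h hi hn h' x a := by simp [g.map_act h hi hn h', f.map_act]

@[simp] lemma GMap.precompHom_f {M N P : DGMod R} {p : ℤ} (f : M ⟶ N) (g : GMap N P p) {i j : ℤ}
    (h : i + p = j) (x : M.X i) : (g.precompHom f).f h x = g.f h (f.f i x) := rfl

/-- The cone of a morphism between homotopy retracts is a homotopy retract of a cone. -/
lemma exists_retract_cone {X Y M N : DGMod R} (f : X ⟶ Y) (i : X ⟶ M) (p : M ⟶ X)
    (a : Homotopy (i ≫ p) (𝟙 X)) (j : Y ⟶ N) (q : N ⟶ Y) (b : Homotopy (j ≫ q) (𝟙 Y)) :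
    ∃ (Φ : cone f ⟶ cone (p ≫ f ≫ j)) (Ψ : cone (p ≫ f ≫ j) ⟶ cone f),
      Nonempty (Homotopy (Φ ≫ Ψ) (𝟙 _)) := by
  have ha : ∀ {l m n : ℤ} (h : l + 1 = m) (h' : m + 1 = n) (x : X.X m), p.f m (i.f m x) =
      x + (X.d h (a.toGMap.f (by omega) x) + a.toGMap.f (by omega) (X.d h' x)) :=
    fun h h' x => a.eq_add h h' x
  have hb : ∀ {l m n : ℤ} (h : l + 1 = m) (h' : m + 1 = n) (x : Y.X m), q.f m (j.f m x) =
      x + (Y.d h (b.toGMap.f (by omega) x) + b.toGMap.f (by omega) (Y.d h' x)) :=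
    fun h h' x => b.eq_add h h' x
  -- The two squares commute only up to homotopy: `j f - j f p i = -j f (d a + a d)` and `q j f p -
  -- f p = (d b + b d) f p`. This dictates `θ = -j f a` and `η = b f p`.
  let θ : GMap X N (-1) := (-1 : ℤ) • a.toGMap.compHom (f ≫ j)
  let η : GMap M Y (-1) := b.toGMap.precompHom (p ≫ f)
  -- The diagonal part of the homotopy is `b` on the target and `-a` on the shifted source. The
  -- mixed term `-b f a` accounts for the difference between `q θ + η i` and `b f - f a`.
  refine ⟨coneMap f _ i j θ ?_, coneMap _ f p q η ?_, ⟨Homotopy.ofGMap ⟨fun {l m} h =>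
    (coneInl f m).comp ((b.toGMap.f h).comp (coneFst f l)) -
    (coneInl f m).comp ((b.toGMap.f h).comp ((f.f l).comp
      ((a.toGMap.f (by omega : l + 1 + -1 = l)).comp (coneSnd f l)))) -
    (coneInr f m).comp ((a.toGMap.f (by omega : l + 1 + -1 = m + 1)).comp (coneSnd f l)), ?_⟩ ?_⟩⟩
  · intro l m n h h' x
    simp only [θ, GMap.smul_f, GMap.compHom_f, comp_f, ha h h', map_add, f.map_d, j.map_d]
    simp
    abel
  · intro l m n h h' x
    simp only [η, GMap.precompHom_f, comp_f, hb h h', f.map_d, p.map_d]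
    simp
  · intro l m n l' n' h hi hn h' x c
    refine cone_ext ?_ ?_
    · simp [coneFst_act, coneSnd_act, b.toGMap.map_act h hi hn h',
        a.toGMap.map_act (by omega : l + 1 + m = n + 1) (by omega : l + 1 + -1 = l)
          (by omega : n + 1 + -1 = n) h, f.map_act]
    · simp [coneSnd_act, a.toGMap.map_act (by omega : l + 1 + m = n + 1)
        (by omega : l + 1 + -1 = l' + 1) (by omega : n + 1 + -1 = n' + 1) (by omega)]
  · intro l m n hl hm z
    subst hl hm
    have e := ha rfl rfl (coneSnd f (l + 1) z)
    have e' := hb rfl rfl (coneFst f (l + 1) z)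
    refine cone_ext ?_ ?_
    · simp [η, θ, coneFst_d, coneSnd_d, e, e', hb rfl rfl, f.map_d]
      abel
    · simp [coneFst_d, coneSnd_d, e]

/-- Every perfect dg module is, in the homotopy category, a direct summand of a homotopically
projective dg module whose underlying graded module is finitely generated projective. -/
lemma IsPerfect.exists_retract {X : Hot R} (hX : IsPerfect R X) :
    ∃ N : DGMod R, IsFinProj N ∧ IsHProj N ∧ Nonempty (Retract X ((toHot R).obj N)) := by
  induction hX with
  | free => exact ⟨DGMod.free R, DGMod.isFinProj_free, DGMod.isHProj_free, ⟨Retract.refl _⟩⟩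
  | shift n M _ ih =>
    obtain ⟨N, h₁, h₂, h₃⟩ := ih
    obtain ⟨i, p, ⟨a⟩⟩ := (nonempty_retract_iff M N).1 h₃
    exact ⟨DGMod.shift n N, h₁.shift n, h₂.shift n, (nonempty_retract_iff _ _).2
      ⟨shiftMap i n, shiftMap p n, ⟨a.shift n⟩⟩⟩
  | @cone M N f _ _ ihM ihN =>
    obtain ⟨M', h₁, h₂, h₃⟩ := ihM
    obtain ⟨N', h₁', h₂', h₃'⟩ := ihN
    obtain ⟨i, p, ⟨a⟩⟩ := (nonempty_retract_iff M M').1 h₃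
    obtain ⟨j, q, ⟨b⟩⟩ := (nonempty_retract_iff N N').1 h₃'
    exact ⟨_, h₁.cone (p ≫ f ≫ j) h₁', h₂.cone (p ≫ f ≫ j) h₂', (nonempty_retract_iff _ _).2
      (exists_retract_cone f i p a j q b)⟩
  | summand r _ ih =>
    obtain ⟨N, h₁, h₂, ⟨h₃⟩⟩ := ih
    exact ⟨N, h₁, h₂, ⟨r.trans h₃⟩⟩

end DGMod

/-! ### Minimal models: splitting over `A^0` and lifting idempotents. -/

/-- The image is projective and a direct summand, so `f` has a section over its image, which extends
by zero on a complement. Semisimplicity of `A^0` enters largely through these generalized inverses.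
-/
lemma LinearMap.exists_comp_comp_eq_self {S V W : Type*} [Ring S] [IsSemisimpleRing S]
    [AddCommGroup V] [Module S V] [AddCommGroup W] [Module S W] (f : V →ₗ[S] W) :
    ∃ g : W →ₗ[S] V, ∀ v, f (g (f v)) = f v := by
  obtain ⟨C, hC⟩ := exists_isCompl (LinearMap.range f)
  have : Module.Projective S (LinearMap.range f) := Module.projective_of_isSemisimpleRing _ _
  obtain ⟨s, hs⟩ := Module.projective_lifting_property f.rangeRestrict LinearMap.id
    f.surjective_rangeRestrict
  refine ⟨s ∘ₗ (LinearMap.range f).projectionOnto C hC, fun v => ?_⟩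
  have h₁ : (LinearMap.range f).projectionOnto C hC (f v) = ⟨f v, v, rfl⟩ :=
    Submodule.projectionOnto_apply_left hC (⟨f v, v, rfl⟩ : LinearMap.range f)
  have h₂ := congrArg Subtype.val (LinearMap.congr_fun hs ⟨f v, v, rfl⟩)
  simpa [h₁] using h₂

namespace DGMod

variable {k : Type w} [CommRing k] {R : DGAlgebra.{w, u} k}

lemma sub_f {M N : DGMod R} (f g : M ⟶ N) (i : ℤ) (x : M.X i) :
    (f - g).f i x = f.f i x - g.f i x := by
  rw [sub_eq_add_neg, add_f, neg_f, sub_eq_add_neg]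

lemma end_mul_f {N : DGMod R} (f g : End N) (i : ℤ) (x : N.X i) :
    (f * g : N ⟶ N).f i x = f.f i (g.f i x) := rfl

lemma GMap.mem_plus {M N : DGMod R} {p : ℤ} (g : GMap M N p) {i j : ℤ} (h : i + p = j)
    {x : M.X i} (hx : x ∈ M.plus i) : g.f h x ∈ N.plus j := by
  induction hx using AddSubgroup.closure_induction with
  | mem y hy =>
    obtain ⟨a, b, e, hb, x, c, rfl⟩ := hy
    rw [g.map_act e rfl h (by omega)]
    exact AddSubgroup.subset_closure ⟨_, _, _, hb, _, _, rfl⟩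
  | zero => simp
  | add y z _ _ hy hz => simpa using add_mem hy hz
  | neg y _ hy => simpa using hy

lemma hom_mem_plus {M N : DGMod R} (g : M ⟶ N) {i : ℤ} {x : M.X i} (hx : x ∈ M.plus i) :
    g.f i x ∈ N.plus i :=
  (GMap.ofHom g).mem_plus (add_zero i) hx

lemma gr_eq_zero [R.Admissible] {i : ℤ} (hi : i < 0) (a : R.gr i) : a = 0 :=
  Subtype.ext ((Submodule.mem_bot k).1 (DGAlgebra.Admissible.positive (R := R) i hi ▸ a.2))

lemma exists_bound {ι : Type} [Fintype ι] (n : ι → ℤ) : ∃ B : ℤ, ∀ i, -B ≤ n i ∧ n i ≤ B := by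
  refine ⟨∑ i, |n i|, fun i => abs_le.1 ?_⟩
  exact Finset.single_le_sum (f := fun i => |n i|) (fun i _ => abs_nonneg _) (Finset.mem_univ i)

lemma DualBasis.eq_zero_of_lt [R.Admissible] {N : DGMod R} {ι : Type} [Fintype ι]
    (b : DualBasis N ι) {B : ℤ} (hB : ∀ i, B ≤ b.n i) {j : ℤ} (hj : j < B) (x : N.X j) :
    x = 0 := by
  rw [← b.sum_eq x]
  refine Finset.sum_eq_zero fun i _ => ?_
  have := hB i
  rw [gr_eq_zero (by omega) ((b.φ i).val rfl x), map_zero]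

/-- An endomorphism of a finitely generated graded projective dg module which vanishes on the
quotient `M̄` is nilpotent. -/
lemma IsFinProj.isNilpotent [R.Admissible] {N : DGMod R} (hN : IsFinProj N) (φ : End N)
    (hφ : ∀ i x, φ.f i x ∈ N.plus i) : IsNilpotent φ := by
  obtain ⟨ι, _, ⟨b⟩⟩ := hN
  obtain ⟨B, hB⟩ := exists_bound b.n
  -- `F p` is the graded submodule generated by the elements of degree at most `p`. As the values of
  -- `φ` lie in `NA^+`, `φ` sends `F p` to `F (p - 1)`; all of `N` is `F B`, and `F p = 0` for `p <
  -- -B`.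
  let F (p i : ℤ) : AddSubgroup (N.X i) := AddSubgroup.closure
    {y | ∃ (q j : ℤ) (h : q + j = i) (_ : q ≤ p) (x : N.X q) (a : R.gr j), y = N.act h x a}
  have hF : ∀ (p i : ℤ) (x : N.X i), x ∈ F p i → φ.f i x ∈ F (p - 1) i := by
    intro p i x hx
    induction hx using AddSubgroup.closure_induction with
    | mem y hy =>
      obtain ⟨q, j, h, hq, x, a, rfl⟩ := hy
      rw [φ.map_act]
      have hx : φ.f q x ∈ N.plus q := hφ q x
      generalize φ.f q x = z at hx
      induction hx using AddSubgroup.closure_induction with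
      | mem y hy =>
        obtain ⟨s, t, e, ht, x', c, rfl⟩ := hy
        rw [N.act_act e h (rfl : t + j = t + j) (by omega)]
        exact AddSubgroup.subset_closure ⟨s, _, _, by omega, _, _, rfl⟩
      | zero => simp
      | add y z _ _ hy hz => simpa using add_mem hy hz
      | neg y _ hy => simpa using hy
    | zero => simp
    | add y z _ _ hy hz => simpa using add_mem hy hz
    | neg y _ hy => simpa using hy
  have key : ∀ (n : ℕ) (i : ℤ) (x : N.X i), (φ ^ n : End N).f i x ∈ F (B - n) i := by
    intro n
    induction n with
    | zero =>
      intro i x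
      change x ∈ _
      rw [← b.sum_eq x]
      refine sum_mem fun t _ => AddSubgroup.subset_closure ⟨_, _, _, ?_, _, _, rfl⟩
      simpa using (hB t).2
    | succ n ih =>
      intro i x
      have := hF _ _ _ (ih i x)
      rw [pow_succ']
      rw [end_mul_f]
      convert this using 2
      push_cast
      ring
  -- This many steps lead from `F B` to `F (-B - 1)`, which is zero.
  refine ⟨(2 * B + 1).toNat, ?_⟩
  refine hom_ext fun i x => ?_
  have h := key (2 * B + 1).toNat i x
  have hle : B - ((2 * B + 1).toNat : ℤ) ≤ -B - 1 := by omega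
  generalize B - ((2 * B + 1).toNat : ℤ) = p at h hle
  change (φ ^ (2 * B + 1).toNat : End N).f i x = 0
  generalize (φ ^ (2 * B + 1).toNat : End N).f i x = y at h
  induction h using AddSubgroup.closure_induction with
  | mem y hy =>
    obtain ⟨q, j, h, hq, x, a, rfl⟩ := hy
    rw [b.eq_zero_of_lt (B := -B) (fun i => (hB i).1) (by omega) x]
    simp
  | zero => rfl
  | add y z _ _ hy hz => rw [hy, hz, add_zero]
  | neg y _ hy => rw [hy, neg_zero]

/-- A dg module is minimal if its differential has image in `MA^+`. -/
def IsMinimal (N : DGMod R) : Prop :=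
  ∀ {i j : ℤ} (h : i + 1 = j) (x : N.X i), N.d h x ∈ N.plus j

lemma IsFinProj.of_retract {M N : DGMod R} (hN : IsFinProj N) (i : M ⟶ N) (p : N ⟶ M)
    (h : i ≫ p = 𝟙 M) : IsFinProj M := by
  obtain ⟨ι, _, ⟨b⟩⟩ := hN
  refine ⟨ι, inferInstance, ⟨⟨b.n, fun t => p.f _ (b.m t), fun t => (b.φ t).precompHom i,
    fun {j} x => ?_⟩⟩⟩
  have e : p.f j (i.f j x) = x := congrArg (fun g : M ⟶ M => g.f j x) h
  conv_rhs => rw [← e, ← b.sum_eq (i.f j x), map_sum]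
  exact Finset.sum_congr rfl fun t _ => (p.map_act _ _ _).symm

/-- The morphism `d s + s d` attached to a graded map of degree `-1`. -/
def nullHom {M N : DGMod R} (s : GMap M N (-1)) : M ⟶ N where
  f i := (N.d (by omega : i - 1 + 1 = i)).comp (s.f (by omega)) +
    (s.f (by omega : i + 1 + -1 = i)).comp (M.d rfl)
  map_act {i j n} h x a := by
    simp only [AddMonoidHom.add_apply, AddMonoidHom.comp_apply]
    rw [s.map_act h (by omega : i + -1 = i - 1) _ (by omega),
      N.d_act _ _ (by omega : i - 1 + 1 = i) rfl h (by omega),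
      M.d_act h rfl rfl rfl (by omega) (by omega), map_add,
      s.map_act _ (by omega : i + 1 + -1 = i) _ h, Units.smul_def, Units.smul_def, map_zsmul,
      s.map_act _ (by omega : i + -1 = i - 1) _ (by omega), map_add, AddMonoidHom.add_apply,
      negOnePow_pred (by omega : i - 1 + 1 = i)]
    simp
    abel
  map_d {i j} h x := by
    subst h
    have e : ∀ (l : ℤ) (h : l = i + 1 - 1) (h' : l + 1 = i + 1) (h'' : i + 1 + -1 = l),
      N.d h' (s.f h'' (M.d rfl x)) = N.d (by omega : i + 1 - 1 + 1 = i + 1)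
        (s.f (by omega : i + 1 + -1 = i + 1 - 1) (M.d rfl x)) := by
      rintro l rfl _ _; rfl
    simp [N.d_d, M.d_d, e i (by omega) rfl (by omega)]

lemma nullHom_f {M N : DGMod R} (s : GMap M N (-1)) {h i j : ℤ} (hi : h + 1 = i) (hj : i + 1 = j)
    (x : M.X i) : (nullHom s).f i x = N.d hi (s.f (by omega) x) + s.f (by omega) (M.d hj x) := by
  obtain rfl : h = i - 1 := by omega
  subst hj
  rfl

lemma toHot_map_nullHom {M N : DGMod R} (s : GMap M N (-1)) :
    (toHot R).map (nullHom s) = (toHot R).map 0 :=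
  (toHot_map_eq_iff _ _).2 ⟨Homotopy.ofGMap s fun hi hj x => by
    rw [nullHom_f s hi hj]; simp⟩

instance : (toHot R).Additive :=
  CategoryTheory.Quotient.functor_additive _ fun _ _ f g f' g' h h' => homotopic_add f g f' g' h h'

/-- The ring homomorphism from endomorphisms to homotopy classes of endomorphisms. -/
def hotEnd (N : DGMod R) : End N →+* End ((toHot R).obj N) where
  toFun f := (toHot R).map f
  map_one' := (toHot R).map_id N
  map_mul' f g := (toHot R).map_comp g f
  map_zero' := (toHot R).map_zero _ _
  map_add' _ _ := (toHot R).map_add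

section Idempotent

variable {N : DGMod R} (e : End N) (he : IsIdempotentElem e)

include he in
-- Idempotents split already in `dgMod`: the image of `e` is the kernel of `1 - e`.
lemma exists_image : ∃ (M : DGMod R) (i : M ⟶ N) (p : N ⟶ M), i ≫ p = 𝟙 M ∧ p ≫ i = e := by
  have h : ∀ i x, (𝟙 N - (show N ⟶ N from e) : N ⟶ N).f i (e.f i x) = 0 := by
    intro i x
    rw [sub_f, id_f, ← end_mul_f, he.eq, sub_self]
  refine ⟨ker (𝟙 N - (show N ⟶ N from e)), kerι _, kerLift _ e h, ?_, rfl⟩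
  refine hom_ext fun i x => kerι_injective _ i ?_
  have := f_kerι (𝟙 N - (show N ⟶ N from e)) x
  rw [sub_f, id_f, sub_eq_zero] at this
  exact this.symm

end Idempotent

lemma mem_plus_of_retract {M N : DGMod R} (i : M ⟶ N) (p : N ⟶ M) (h : i ≫ p = 𝟙 M) {j : ℤ}
    {x : M.X j} (hx : i.f j x ∈ N.plus j) : x ∈ M.plus j := by
  have e : p.f j (i.f j x) = x := congrArg (fun g : M ⟶ M => g.f j x) h
  rw [← e]
  exact hom_mem_plus p hx

section Bar

variable [R.Admissible] (N : DGMod R)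

/-- The class in `M̄` of an element. -/
def toBar (i : ℤ) : N.X i →ₗ[(R.gr 0)ᵐᵒᵖ] N.bar.X i where
  toFun := QuotientAddGroup.mk' (N.plus i)
  map_add' := map_add _
  map_smul' _ _ := rfl

lemma toBar_eq_zero {i : ℤ} {x : N.X i} : N.toBar i x = 0 ↔ x ∈ N.plus i :=
  QuotientAddGroup.eq_zero_iff x

lemma toBar_surjective (i : ℤ) : Function.Surjective (N.toBar i) :=
  QuotientAddGroup.mk'_surjective _

/-- The Leibniz rule has only one term here because `d (A^0) = 0`. Linearity over `A^0` is what
makes the differential accessible to semisimplicity. -/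
lemma dlin_smul {i j : ℤ} (h : i + 1 = j) (a : (R.gr 0)ᵐᵒᵖ) (x : N.X i) :
    N.d h (a • x) = a • N.d h x := by
  have e : R.d (zero_add 1) a.unop = 0 :=
    Subtype.ext (DGAlgebra.Admissible.diff_zero (R := R) a.unop.1 a.unop.2)
  rw [smul_eq_act, N.d_act _ h h (zero_add 1) (add_zero j) h, e]
  simp [smul_eq_act]

/-- The differential as a linear map over the degree zero part of the algebra. -/
def dlin {i j : ℤ} (h : i + 1 = j) : N.X i →ₗ[(R.gr 0)ᵐᵒᵖ] N.X j where
  toFun := N.d h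
  map_add' := map_add _
  map_smul' := N.dlin_smul h

@[simp] lemma dlin_apply {i j : ℤ} (h : i + 1 = j) (x : N.X i) : N.dlin h x = N.d h x := rfl

lemma toBar_d {i j : ℤ} (h : i + 1 = j) (x : N.X i) :
    N.toBar j (N.d h x) = N.bar.d h (N.toBar i x) := rfl

lemma isSemisimpleRing_op : IsSemisimpleRing (R.gr 0)ᵐᵒᵖ := by
  have : IsSemisimpleRing (R.gr 0) := DGAlgebra.Admissible.semisimple
  infer_instance

end Bar

/-- For an element `e` of a ring with `e - e ^ 2` nilpotent, an idempotent which is a polynomial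
in `e`. -/
lemma exists_idempotent_pow {S : Type*} [Ring S] (e : S) (he : IsNilpotent (e - e ^ 2)) :
    ∃ n : ℕ, IsIdempotentElem (1 - (1 - e ^ (n + 1)) ^ (n + 1)) := by
  obtain ⟨n, hn⟩ := he
  exact ⟨n, isIdempotentElem_one_sub_one_sub_pow_pow e (n + 1) (by rw [pow_succ, hn, zero_mul])⟩

/-- A finitely generated graded projective dg module is homotopy equivalent to a minimal one. -/
lemma IsFinProj.exists_minimal [R.Admissible] {N : DGMod R} (hN : IsFinProj N) :
    ∃ M : DGMod R, IsFinProj M ∧ IsMinimal M ∧ Nonempty ((toHot R).obj N ≅ (toHot R).obj M) := by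
  obtain ⟨ι, _, ⟨b⟩⟩ := id hN
  have := isSemisimpleRing_op (R := R)
  -- A generalized inverse `G` of the differential of `N̄`, with `d G d = d`. It would be a
  -- contraction of the part of `N̄` that minimality has to remove.
  have hG : ∀ i : ℤ, ∃ g : N.bar.X (i + 1) →ₗ[(R.gr 0)ᵐᵒᵖ] N.bar.X i,
      ∀ x, N.bar.d rfl (g (N.bar.d rfl x)) = N.bar.d rfl x := fun i =>
    LinearMap.exists_comp_comp_eq_self (N.bar.dlin (rfl : i + 1 = i + 1))
  choose G₀ hG₀ using hG
  let G : ∀ {i j : ℤ} (_ : i + 1 = j), N.bar.X j →ₗ[(R.gr 0)ᵐᵒᵖ] N.bar.X i := fun h => h ▸ G₀ _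
  have hG : ∀ {i j : ℤ} (h : i + 1 = j) (x : N.bar.X i),
      N.bar.d h (G h (N.bar.d h x)) = N.bar.d h x := by
    rintro i _ rfl x
    exact hG₀ i x
  -- Lifting the values of `G` on generators yields an `A`-linear map `s` of degree `-1` on `N`. It
  -- induces `G` on `N̄`: an element of `A` of positive degree acts by zero there, one of degree
  -- zero commutes with `G`, and negative degrees are absent.
  have hc : ∀ i, ∃ c : N.X (b.n i + -1),
      N.toBar _ c = G (by omega) (N.toBar _ (b.m i)) := fun i => N.toBar_surjective _ _
  choose c hc using hc
  let s : GMap N N (-1) := b.lift c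
  have act_eq : ∀ {n n' t j l : ℤ} (h : n' + 1 = n) (h₁ : n + t = j) (h₂ : n' + t = l)
      (h₃ : l + 1 = j) (x : N.X n) (y : N.X n') (_ : N.toBar _ y = G h (N.toBar _ x))
      (a : R.gr t), N.toBar _ (N.act h₂ y a) = G h₃ (N.toBar _ (N.act h₁ x a)) := by
    intro n n' t j l h h₁ h₂ h₃ x y hxy a
    rcases lt_trichotomy t 0 with ht | rfl | ht
    · simp [gr_eq_zero ht a]
    · obtain rfl : n = j := by omega
      obtain rfl : n' = l := by omega
      rw [act_zero_eq_smul, act_zero_eq_smul, map_smul, hxy, map_smul, map_smul]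
    · rw [N.toBar_eq_zero.2 (AddSubgroup.subset_closure ⟨_, _, _, ht, _, _, rfl⟩),
        N.toBar_eq_zero.2 (AddSubgroup.subset_closure ⟨_, _, _, ht, _, _, rfl⟩), map_zero]
  have hs : ∀ {i j : ℤ} (h : j + 1 = i) (h' : i + -1 = j) (x : N.X i),
      N.toBar _ (s.f h' x) = G h (N.toBar _ x) := by
    intro i j h h' x
    conv_rhs => rw [← b.sum_eq x, map_sum, map_sum]
    rw [b.lift_f, map_sum]
    exact Finset.sum_congr rfl fun t _ => act_eq _ _ _ _ _ _ (hc t) _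
  let e : End N := nullHom s
  have he : ∀ {h i j : ℤ} (hi : h + 1 = i) (hj : i + 1 = j) (x : N.X i),
      N.toBar i (e.f i x) = N.bar.d hi (G hi (N.toBar i x)) + G hj (N.bar.d hj (N.toBar i x)) := by
    intro h i j hi hj x
    rw [nullHom_f s hi hj, map_add, toBar_d, hs hi, hs hj, toBar_d]
  have hde : ∀ {i j : ℤ} (h : i + 1 = j) (x : N.X i),
      N.toBar j (N.d h x) = N.toBar j (N.d h (e.f i x)) := by
    intro i j h x
    rw [toBar_d, toBar_d, he (sub_add_cancel i 1) h, map_add, N.bar.d_d, zero_add, hG]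
  -- On `N̄` the map `e` is `d G + G d`, and `d G d = d` gives `e - e^2 = -d G G d`. Since `G G`
  -- need not vanish, only the square of this difference is zero on `N̄`, which still suffices for
  -- nilpotency.
  have hdif : ∀ {h i j : ℤ} (hi : h + 1 = i) (hj : i + 1 = j) (x : N.X i),
      N.toBar i ((e - e ^ 2 : End N).f i x) =
        -N.bar.d hi (G hi (G hj (N.bar.d hj (N.toBar i x)))) := by
    intro h i j hi hj x
    have h1 : (e - e ^ 2 : End N).f i x = e.f i x - e.f i (e.f i x) := by
      rw [pow_two]; exact sub_f _ _ _ _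
    rw [h1, map_sub, he hi hj (e.f i x), he hi hj, map_add, map_add, map_add, map_add, hG hi,
      hG hj, N.bar.d_d]
    have h2 : N.bar.d hi (G hi (N.bar.d hi (G hi (N.toBar i x)))) =
      N.bar.d hi (G hi (N.toBar i x)) := hG hi _
    rw [map_zero]
    abel
  have hnil : IsNilpotent (e - e ^ 2) := by
    have : IsNilpotent ((e - e ^ 2) ^ 2) := hN.isNilpotent _ fun i x => by
      rw [← N.toBar_eq_zero, pow_two, end_mul_f, hdif (sub_add_cancel i 1) rfl,
        hdif (sub_add_cancel i 1) rfl, map_neg, N.bar.d_d]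
      simp
    obtain ⟨n, hn⟩ := this
    exact ⟨2 * n, by rw [pow_mul, hn]⟩
  obtain ⟨n, hn⟩ := exists_idempotent_pow e hnil
  -- The complementary idempotent cuts out the minimal part. It is divisible by `1 - e`, and `d (1 -
  -- e)` vanishes on `N̄`, so the differential of its image lands in `MA^+`.
  have hq : IsIdempotentElem ((1 - e ^ (n + 1)) ^ (n + 1)) := by
    have := hn.one_sub
    rwa [sub_sub_cancel] at this
  obtain ⟨M, i, p, hip, hpi⟩ := exists_image _ hq
  have hfac : ∃ r : End N, (1 - e ^ (n + 1)) ^ (n + 1) = (1 - e) * r :=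
    ⟨_, by rw [pow_succ', ← mul_neg_geom_sum, mul_assoc]⟩
  obtain ⟨r, hr⟩ := hfac
  refine ⟨M, hN.of_retract i p hip, ?_, ⟨⟨(toHot R).map p, (toHot R).map i, ?_, ?_⟩⟩⟩
  · intro a a' h x
    refine mem_plus_of_retract i p hip ?_
    have h1 : i.f a x = (1 - e : End N).f a (r.f a (i.f a x)) := by
      rw [← end_mul_f, ← hr, ← hpi]
      exact congrArg (i.f a) (congrArg (fun g : M ⟶ M => g.f a x) hip).symm
    have h2 : ∀ y : N.X a, (1 - e : End N).f a y = y - e.f a y := fun y => sub_f _ _ _ _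
    rw [i.map_d, h1, h2, ← toBar_eq_zero, map_sub, map_sub, ← hde, sub_self]
  -- As `e = d s + s d` is null-homotopic, the idempotent becomes `1` in the homotopy category, so
  -- nothing is lost by passing to its image.
  · rw [← Functor.map_comp, hpi]
    have h1 : hotEnd N e = 0 := (toHot_map_nullHom s).trans ((toHot R).map_zero _ _)
    have h2 : hotEnd N ((1 - e ^ (n + 1)) ^ (n + 1)) = 1 := by
      rw [(hotEnd N).map_pow, (hotEnd N).map_sub, (hotEnd N).map_pow, (hotEnd N).map_one, h1,
        zero_pow n.succ_ne_zero, sub_zero, one_pow]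
    exact h2
  · rw [← Functor.map_comp, hip, CategoryTheory.Functor.map_id]

/-- Homotopy retracts of minimal finitely generated graded projective dg modules are again
homotopy equivalent to such. -/
lemma exists_minimal_of_retract [R.Admissible] {N : DGMod R} (hN : IsFinProj N)
    (hN' : IsMinimal N) {X : Hot R} (r : Retract X ((toHot R).obj N)) :
    ∃ M : DGMod R, IsFinProj M ∧ IsMinimal M ∧ Nonempty (X ≅ (toHot R).obj M) := by
  obtain ⟨e, he⟩ : ∃ e : End N, hotEnd N e = r.r ≫ r.i := (toHot R).map_surjective _
  have hE : IsIdempotentElem (hotEnd N e) := by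
    rw [he]
    change (r.r ≫ r.i) ≫ (r.r ≫ r.i) = _
    simp
  -- A homotopy writes `e - e^2` as `d s + s d`, up to the choice of `s`. Minimality puts the values
  -- of this map in `NA^+`, so it is nilpotent and the homotopy idempotent lifts to a strict one.
  have hnil : IsNilpotent (e - e ^ 2) := by
    have h : hotEnd N e = hotEnd N (e * e) := by rw [map_mul, hE.eq]
    obtain ⟨s⟩ := (toHot_map_eq_iff _ _).1 h
    refine hN.isNilpotent _ fun i x => ?_
    have h1 : (e - e ^ 2 : End N).f i x = e.f i x - (e * e : End N).f i x := by
      rw [pow_two]; exact sub_f _ _ _ _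
    rw [h1, s.eq_add (sub_add_cancel i 1) rfl, add_sub_cancel_left]
    exact add_mem (hN' _ _) (s.toGMap.mem_plus _ (hN' _ _))
  obtain ⟨n, hn⟩ := exists_idempotent_pow e hnil
  obtain ⟨M, i, p, hip, hpi⟩ := exists_image _ hn
  -- The lifted idempotent is a polynomial in `e` that fixes every idempotent, so its class is still
  -- that of `e`.
  have hpi' : (toHot R).map p ≫ (toHot R).map i = r.r ≫ r.i := by
    rw [← Functor.map_comp, hpi, ← he]
    change hotEnd N _ = _
    have h1 : hotEnd N (1 - (1 - e ^ (n + 1)) ^ (n + 1)) =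
        1 - (1 - hotEnd N e ^ (n + 1)) ^ (n + 1) := by
      rw [(hotEnd N).map_sub, (hotEnd N).map_pow, (hotEnd N).map_sub, (hotEnd N).map_pow,
        (hotEnd N).map_one]
    rw [h1, hE.pow_succ_eq, hE.one_sub.pow_succ_eq, sub_sub_cancel]
  refine ⟨M, hN.of_retract i p hip, fun h x => mem_plus_of_retract i p hip ?_,
    ⟨⟨r.i ≫ (toHot R).map p, (toHot R).map i ≫ r.r, ?_, ?_⟩⟩⟩
  · rw [i.map_d]
    exact hN' _ _
  · rw [Category.assoc, reassoc_of% hpi']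
    simp
  · have : (toHot R).map i ≫ (toHot R).map p = 𝟙 _ := by
      rw [← Functor.map_comp, hip, CategoryTheory.Functor.map_id]
    rw [Category.assoc, ← Category.assoc r.r, ← hpi', Category.assoc, this, Category.comp_id, this]

lemma IsPerfect.exists_minimal [R.Admissible] {X : Hot R} (hX : IsPerfect R X) :
    ∃ M : DGMod R, IsFinProj M ∧ IsMinimal M ∧ Nonempty (X ≅ (toHot R).obj M) := by
  obtain ⟨N, hN, -, ⟨r⟩⟩ := hX.exists_retract
  obtain ⟨N', hN', hN'', ⟨e⟩⟩ := hN.exists_minimal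
  exact exists_minimal_of_retract hN' hN'' (r.trans e.retract)

end DGMod

/-! ### Pure dg modules and their appearance in the heart. -/

namespace DGMod

variable {k : Type w} [CommRing k] {R : DGAlgebra.{w, u} k}

/-- A dual basis, in degree zero, of the graded module underlying a dg module. -/
structure PureBasis (M : DGMod R) (ι : Type) [Fintype ι] where
  m : ι → M.X 0
  φ : ι → GMap M (free R) 0
  sum_eq : ∀ {j : ℤ} (x : M.X j),
    ∑ i, M.act (zero_add j) (m i) ((φ i).val (add_zero j) x) = x

/-- A dg module is pure if its underlying graded module is finitely generated projective, with
generators in degree zero. -/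
def IsPure (M : DGMod R) : Prop := ∃ (ι : Type) (_ : Fintype ι), Nonempty (PureBasis M ι)

/-- The degree `i` component of the graded submodule generated by a subgroup of the degree zero
component. -/
def gen (M : DGMod R) (U : AddSubgroup (M.X 0)) (i : ℤ) : AddSubgroup (M.X i) :=
  AddSubgroup.closure {y | ∃ u ∈ U, ∃ a : R.gr i, y = M.act (zero_add i) u a}

lemma act_mem_gen (M : DGMod R) {U : AddSubgroup (M.X 0)} {i j n : ℤ} (h : i + j = n) {x : M.X i}
    (hx : x ∈ M.gen U i) (a : R.gr j) : M.act h x a ∈ M.gen U n := by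
  induction hx using AddSubgroup.closure_induction with
  | mem y hy =>
    obtain ⟨u, hu, b, rfl⟩ := hy
    rw [M.act_act (zero_add i) h h (zero_add n)]
    exact AddSubgroup.subset_closure ⟨u, hu, _, rfl⟩
  | zero => simp
  | add y z _ _ hy hz => simpa using add_mem hy hz
  | neg y _ hy => simpa using hy

lemma act_gen_mem (M : DGMod R) {U : AddSubgroup (M.X 0)} {i : ℤ} {u : M.X 0} (hu : u ∈ U)
    (a : R.gr i) : M.act (zero_add i) u a ∈ M.gen U i :=
  AddSubgroup.subset_closure ⟨u, hu, a, rfl⟩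

lemma gen_mono (M : DGMod R) {U V : AddSubgroup (M.X 0)} (h : U ≤ V) (i : ℤ) :
    M.gen U i ≤ M.gen V i :=
  AddSubgroup.closure_mono fun _ ⟨u, hu, a, e⟩ => ⟨u, h hu, a, e⟩

lemma mem_gen_zero (M : DGMod R) {U : AddSubgroup (M.X 0)} {u : M.X 0} (hu : u ∈ U) :
    u ∈ M.gen U 0 := by
  have := M.act_gen_mem hu (1 : R.gr 0)
  rwa [M.act_one u] at this

lemma GMap.mem_gen {M N : DGMod R} (g : GMap M N 0) {U : AddSubgroup (M.X 0)}
    {V : AddSubgroup (N.X 0)} (hg : ∀ u ∈ U, g.f (add_zero 0) u ∈ V) {i : ℤ} {x : M.X i}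
    (hx : x ∈ M.gen U i) : g.f (add_zero i) x ∈ N.gen V i := by
  induction hx using AddSubgroup.closure_induction with
  | mem y hy =>
    obtain ⟨u, hu, b, rfl⟩ := hy
    rw [g.map_act _ (add_zero 0) _ (zero_add i)]
    exact N.act_gen_mem (hg u hu) b
  | zero => simp
  | add y z _ _ hy hz => simpa using add_mem hy hz
  | neg y _ hy => simpa using hy

lemma GMap.eq_zero_of_gen {M N : DGMod R} {p : ℤ} (g : GMap M N p) {U : AddSubgroup (M.X 0)}
    (hg : ∀ u ∈ U, g.f (zero_add p) u = 0) {i j : ℤ} (h : i + p = j) {x : M.X i}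
    (hx : x ∈ M.gen U i) : g.f h x = 0 := by
  induction hx using AddSubgroup.closure_induction with
  | mem y hy =>
    obtain ⟨u, hu, b, rfl⟩ := hy
    rw [g.map_act _ (zero_add p) _ (by omega), hg u hu]
    simp
  | zero => simp
  | add y z _ _ hy hz => rw [map_add, hy, hz, add_zero]
  | neg y _ hy => rw [map_neg, hy, neg_zero]

lemma exists_sum_of_mem_gen (M : DGMod R) {i : ℤ} {x : M.X i} (hx : x ∈ M.gen ⊤ i) :
    ∃ (κ : Type) (_ : Fintype κ) (g : κ → M.X 0) (a : κ → R.gr i),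
      x = ∑ l, M.act (zero_add i) (g l) (a l) := by
  induction hx using AddSubgroup.closure_induction with
  | mem y hy =>
    obtain ⟨u, -, b, rfl⟩ := hy
    exact ⟨Unit, inferInstance, fun _ => u, fun _ => b, by simp⟩
  | zero => exact ⟨Empty, inferInstance, Empty.elim, Empty.elim, by simp⟩
  | add y z _ _ hy hz =>
    obtain ⟨κ, _, g, a, rfl⟩ := hy
    obtain ⟨κ', _, g', a', rfl⟩ := hz
    exact ⟨κ ⊕ κ', inferInstance, Sum.elim g g', Sum.elim a a', by simp⟩
  | neg y _ hy =>
    obtain ⟨κ, _, g, a, rfl⟩ := hy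
    exact ⟨κ, inferInstance, g, -a, by simp⟩

/-- Write each generator `m i` as a sum of products `g a` with `g` of degree zero. The elements `g`,
with the functionals `x ↦ a φ_i(x)`, form a dual basis in degree zero. -/
lemma IsFinProj.isPure {N : DGMod R} (hN : IsFinProj N)
    (h : ∀ (i : ℤ) (x : N.X i), x ∈ N.gen ⊤ i) : IsPure N := by
  obtain ⟨ι, _, ⟨b⟩⟩ := hN
  choose κ hκ g a hg using fun i => N.exists_sum_of_mem_gen (h _ (b.m i))
  refine ⟨Σ i, κ i, inferInstance, ⟨⟨fun t => g t.1 t.2, fun t => (b.φ t.1).comp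
    (freeMap (M := free R) (a t.1 t.2)) (neg_add_cancel _), fun {j} x => ?_⟩⟩⟩
  rw [Fintype.sum_sigma]
  conv_rhs => rw [← b.sum_eq x]
  refine Finset.sum_congr rfl fun i _ => ?_
  conv_rhs => rw [hg i]
  rw [map_sum, AddMonoidHom.finsetSum_apply]
  exact Finset.sum_congr rfl fun l _ =>
    (N.act_act _ _ (by omega : b.n i + (j + -b.n i) = j) _ _ _ _).symm

section Basic

variable {M N : DGMod R}

lemma IsPure.mem_gen (hM : IsPure M) {i : ℤ} (x : M.X i) : x ∈ M.gen ⊤ i := by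
  obtain ⟨ι, _, ⟨b⟩⟩ := hM
  rw [← b.sum_eq x]
  exact sum_mem fun t _ => M.act_gen_mem (AddSubgroup.mem_top _) _

lemma IsPure.ext (hM : IsPure M) {p : ℤ} {g g' : GMap M N p}
    (h : ∀ x, g.f (zero_add p) x = g'.f (zero_add p) x) {i j : ℤ} (e : i + p = j) (x : M.X i) :
    g.f e x = g'.f e x := by
  rw [← sub_eq_zero, ← GMap.sub_f]
  exact GMap.eq_zero_of_gen _ (U := ⊤) (fun u _ => by rw [GMap.sub_f, h, sub_self]) e (hM.mem_gen x)

lemma IsPure.hom_ext (hM : IsPure M) {g g' : M ⟶ N} (h : ∀ x, g.f 0 x = g'.f 0 x) : g = g' :=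
  DGMod.hom_ext fun i x => hM.ext (g := GMap.ofHom g) (g' := GMap.ofHom g') h (add_zero i) x

/-- The extension is `x ↦ ∑ g(m_i) φ_i(x)`. With the uniqueness in `IsPure.ext`, this gives a pure
module the universal property of `M^0 ⊗_{A^0} A`. -/
lemma IsPure.exists_extension (hM : IsPure M) {p : ℤ} (g : M.X 0 →ₗ[(R.gr 0)ᵐᵒᵖ] N.X p) :
    ∃ G : GMap M N p, ∀ x, G.f (zero_add p) x = g x := by
  obtain ⟨ι, _, ⟨b⟩⟩ := hM
  refine ⟨⟨fun {j l} h => ∑ i, ((N.act (by omega : p + j = l)) (g (b.m i))).comp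
    ((b.φ i).val (add_zero j)), ?_⟩, fun x => ?_⟩
  · intro i j n i' n' h hi hn h' x a
    simp only [AddMonoidHom.finsetSum_apply, AddMonoidHom.comp_apply, map_sum]
    refine Finset.sum_congr rfl fun t _ => ?_
    rw [(b.φ t).val_act h (add_zero i) _ h]
    exact (N.act_act _ _ _ _ _ _ _).symm
  · conv_rhs => rw [← b.sum_eq x, map_sum]
    simp only [AddMonoidHom.finsetSum_apply, AddMonoidHom.comp_apply]
    exact Finset.sum_congr rfl fun t _ => (g.map_smul (MulOpposite.op _) (b.m t)).symm

lemma IsPure.finite (hM : IsPure M) : Module.Finite (R.gr 0)ᵐᵒᵖ (M.X 0) := by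
  classical
  obtain ⟨ι, _, ⟨b⟩⟩ := hM
  refine ⟨⟨Finset.univ.image b.m, ?_⟩⟩
  rw [eq_top_iff]
  intro x _
  rw [← b.sum_eq x]
  exact sum_mem fun t _ => Submodule.smul_mem _ (MulOpposite.op _)
    (Submodule.subset_span (by simp))

lemma IsPure.of_retract (hN : IsPure N) (i : GMap M N 0) (p : GMap N M 0)
    (h : ∀ {j : ℤ} (x : M.X j), p.f (add_zero j) (i.f (add_zero j) x) = x) : IsPure M := by
  obtain ⟨ι, _, ⟨b⟩⟩ := hN
  refine ⟨ι, inferInstance, ⟨⟨fun t => p.f (add_zero 0) (b.m t),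
    fun t => i.comp (b.φ t) (add_zero 0), fun {j} x => ?_⟩⟩⟩
  conv_rhs => rw [← h x, ← b.sum_eq (i.f (add_zero j) x), map_sum]
  refine Finset.sum_congr rfl fun t _ => ?_
  rw [p.map_act _ (add_zero 0) _ (zero_add j)]
  exact congrArg (M.act _ _) (i.comp_f (b.φ t) (add_zero 0) _ _ _ x)

/-- The identity as a graded map. -/
def GMap.id (M : DGMod R) : GMap M M 0 := GMap.ofHom (𝟙 M)

@[simp] lemma GMap.id_f {i : ℤ} (h : i + 0 = i) (x : M.X i) : (GMap.id M).f h x = x := rfl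

end Basic

variable [R.Admissible]

lemma IsPure.eq_zero_of_neg {M : DGMod R} (hM : IsPure M) {i : ℤ} (hi : i < 0) (x : M.X i) :
    x = 0 := by
  obtain ⟨ι, _, ⟨b⟩⟩ := hM
  rw [← b.sum_eq x]
  exact Finset.sum_eq_zero fun t _ => by rw [gr_eq_zero hi ((b.φ t).val _ x), map_zero]

/-- A generalized inverse in degree zero extends to all degrees by purity. It need not commute with
the differentials; its commutator is the source of the later obstructions. -/
lemma IsPure.exists_quasi_inverse {M N : DGMod R} (hM : IsPure M) (hN : IsPure N) (f : M ⟶ N) :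
    ∃ s : GMap N M 0, ∀ {i : ℤ} (x : M.X i), f.f i (s.f (add_zero i) (f.f i x)) = f.f i x := by
  have := isSemisimpleRing_op (R := R)
  obtain ⟨g, hg⟩ := LinearMap.exists_comp_comp_eq_self (Hom.lin f 0)
  obtain ⟨s, hs⟩ := hN.exists_extension (p := 0) g
  refine ⟨s, fun {i} x => ?_⟩
  refine hM.ext (g := (s.precompHom f).compHom f) (g' := GMap.ofHom f) (fun x => ?_) (add_zero i) x
  simp only [GMap.compHom_f, GMap.precompHom_f]
  rw [hs]
  exact hg x

/-- The graded map `1 - s f` retracts `M` onto the kernel, where `f s f = f`. Dually, `1 - f s`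
induces a graded section of the projection to the cokernel. -/
lemma IsPure.ker {M N : DGMod R} (hM : IsPure M) (hN : IsPure N) (f : M ⟶ N) :
    IsPure (ker f) := by
  obtain ⟨s, hs⟩ := hM.exists_quasi_inverse hN f
  refine hM.of_retract (GMap.ofHom (kerι f)) (kerGLift f (GMap.id M - s.precompHom f) ?_) ?_
  · intro i j h x
    obtain rfl : i = j := by omega
    simp [hs]
  · intro j x
    apply kerι_injective
    simp [f_kerι]

lemma IsPure.coker {M N : DGMod R} (hM : IsPure M) (hN : IsPure N) (f : M ⟶ N) :
    IsPure (coker f) := by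
  obtain ⟨s, hs⟩ := hM.exists_quasi_inverse hN f
  refine hN.of_retract (cokerLift f (GMap.id N - s.compHom f) ?_) (GMap.ofHom (cokerπ f)) ?_
  · intro i j h x
    obtain rfl : i = j := by omega
    simp [hs]
  · intro j x
    obtain ⟨x, rfl⟩ := cokerπ_surjective f j x
    rw [cokerLift_f]
    simp only [GMap.sub_f, GMap.id_f, GMap.compHom_f, GMap.ofHom_f, map_sub]
    rw [(cokerπ_eq_zero f _).2 ⟨_, rfl⟩, sub_zero]

omit [R.Admissible] in
lemma exists_d_eq_of_subsingleton {M : DGMod R} {n : ℤ} (h : Subsingleton (M.cohomology n))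
    {i j : ℤ} (hi : i + 1 = n) (hj : n + 1 = j) (x : M.X n) (hx : M.d hj x = 0) :
    ∃ y : M.X i, M.d hi y = x := by
  subst hj
  obtain rfl : i = n - 1 := by omega
  have e := Subsingleton.elim (QuotientAddGroup.mk ⟨x, hx⟩ : M.cohomology n) 0
  rw [QuotientAddGroup.eq_zero_iff, AddSubgroup.mem_addSubgroupOf] at e
  exact e

/-- A minimal dg module in the heart is generated in degree zero. -/
lemma IsMinimal.mem_gen {N : DGMod R} (hN : IsFinProj N) (hN' : IsMinimal N) {X : Hot R}
    (hX : ∀ i : ℤ, i ≠ 0 → Subsingleton (X.as.bar.cohomology i)) (e : X ≅ (toHot R).obj N) (i : ℤ)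
    (x : N.X i) : x ∈ N.gen ⊤ i := by
  obtain ⟨f, hf⟩ := (toHot R).map_surjective (X := X.as) e.hom
  obtain ⟨g, hg⟩ := (toHot R).map_surjective (Y := X.as) e.inv
  obtain ⟨s⟩ := (toHot_map_eq_iff (g ≫ f) (𝟙 N)).1 (by
    rw [Functor.map_comp, hf, hg, CategoryTheory.Functor.map_id]
    exact e.inv_hom_id)
  -- Minimality makes every element of `N` a cycle modulo `NA^+`. Transported to `X̄`, it is a
  -- boundary by the heart condition; transported back, it lies in `NA^+`, because boundaries and
  -- the terms of the homotopy do.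
  have hplus : ∀ i : ℤ, i ≠ 0 → ∀ x : N.X i, x ∈ N.plus i := by
    intro i hi x
    have h1 : X.as.bar.d (rfl : i + 1 = i + 1) (X.as.toBar i (g.f i x)) = 0 := by
      rw [← toBar_d, ← g.map_d, toBar_eq_zero]
      exact hom_mem_plus g (hN' _ _)
    obtain ⟨z, hz⟩ := exists_d_eq_of_subsingleton (hX i hi) (sub_add_cancel i 1) rfl _ h1
    obtain ⟨z, rfl⟩ := toBar_surjective _ _ z
    rw [← toBar_d, ← sub_eq_zero, ← map_sub, toBar_eq_zero] at hz
    have h2 := hom_mem_plus f hz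
    rw [map_sub, f.map_d] at h2
    have h3 : f.f i (g.f i x) ∈ N.plus i := by
      have := sub_mem (hN' (sub_add_cancel i 1) (f.f _ z)) h2
      rwa [sub_sub_cancel] at this
    have h4 := s.eq_add (sub_add_cancel i 1) rfl x
    rw [comp_f, id_f] at h4
    rw [h4] at h3
    exact (add_mem_cancel_right (add_mem (hN' _ _) (s.toGMap.mem_plus _ (hN' _ _)))).1 h3
  obtain ⟨ι, _, ⟨b⟩⟩ := hN
  obtain ⟨B, hB⟩ := exists_bound b.n
  -- For `q < 0` every element is a sum of products of elements of degree below `q` with elements of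
  -- `A^+`. Induction starts below `-B`, where `N` vanishes. The same induction upward from degree
  -- zero then gives generation by `N^0`.
  have hneg : ∀ (n : ℕ) (q : ℤ) (x : N.X q), q < -B + n → q < 0 → x = 0 := by
    intro n
    induction n with
    | zero => exact fun q x hq _ => b.eq_zero_of_lt (fun i => (hB i).1) (by simpa using hq) x
    | succ n ih =>
      intro q x hq hq'
      have hx := hplus q hq'.ne x
      induction hx using AddSubgroup.closure_induction with
      | mem y hy =>
        obtain ⟨s, t, e, ht, x', c, rfl⟩ := hy
        rw [ih s x' (by push_cast at hq; omega) (by omega)]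
        simp
      | zero => rfl
      | add y z _ _ hy hz => rw [hy, hz, add_zero]
      | neg y _ hy => rw [hy, neg_zero]
  have hneg' : ∀ (q : ℤ) (x : N.X q), q < 0 → x = 0 := fun q x hq =>
    hneg (B + q + 1).toNat q x (by omega) hq
  have hpos : ∀ (n : ℕ) (q : ℤ) (x : N.X q), q ≤ n → x ∈ N.gen ⊤ q := by
    intro n
    induction n with
    | zero =>
      intro q x hq
      rcases hq.lt_or_eq with hq | hq
      · rw [hneg' q x (by simpa using hq)]
        exact zero_mem _
      · obtain rfl : q = 0 := by simpa using hq
        exact N.mem_gen_zero (AddSubgroup.mem_top _)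
    | succ n ih =>
      intro q x hq
      rcases eq_or_ne q 0 with rfl | hq0
      · exact N.mem_gen_zero (AddSubgroup.mem_top _)
      · have hx := hplus q hq0 x
        induction hx using AddSubgroup.closure_induction with
        | mem y hy =>
          obtain ⟨s, t, e, ht, x', c, rfl⟩ := hy
          exact N.act_mem_gen e (ih s x' (by push_cast at hq; omega)) c
        | zero => exact zero_mem _
        | add y z _ _ hy hz => exact add_mem hy hz
        | neg y _ hy => exact neg_mem hy
  exact hpos i.toNat i x (by omega)

/-- Every object of the heart is isomorphic, in the homotopy category, to a pure dg module. -/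
lemma exists_isPure {X : Hot R} (hX : isHeart R X) :
    ∃ M : DGMod R, IsPure M ∧ Nonempty (X ≅ (toHot R).obj M) := by
  obtain ⟨M, hM, hM', ⟨e⟩⟩ := hX.1.exists_minimal
  exact ⟨M, hM.isPure fun i x => hM'.mem_gen hM hX.2 e i x, ⟨e⟩⟩

omit [R.Admissible] in
-- The morphism factors up to homotopy through a homotopically projective module, from which a
-- morphism to `C` is a cocycle of degree zero and hence null-homotopic.
lemma IsPerfect.toHot_map_eq_zero {M C : DGMod R} (hM : IsPerfect R ((toHot R).obj M))
    (hC : IsAcyclic C) (f : M ⟶ C) : (toHot R).map f = 0 := by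
  obtain ⟨N, -, hN, h⟩ := hM.exists_retract
  obtain ⟨i, p, ⟨a⟩⟩ := (nonempty_retract_iff M N).1 h
  obtain ⟨s, hs⟩ := hN C hC (p := 0) (q := -1) (by omega) (GMap.ofHom (p ≫ f)) (by
    intro i i' j j' hi hj h h' x
    obtain rfl : i = j := by omega
    obtain rfl : i' = j' := by omega
    simp [p.map_d, f.map_d])
  have h1 : (toHot R).map (p ≫ f) = 0 := by
    rw [← (toHot R).map_zero]
    refine (toHot_map_eq_iff _ _).2 ⟨Homotopy.ofGMap s fun hi hj x => ?_⟩
    have := hs (add_zero _) hi (by omega) hj (by omega) x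
    simpa using this
  have h2 := (toHot_map_eq_iff _ _).2 ⟨a⟩
  calc (toHot R).map f = (toHot R).map (i ≫ p) ≫ (toHot R).map f := by rw [h2]; simp
    _ = (toHot R).map i ≫ (toHot R).map (p ≫ f) := by simp
    _ = 0 := by rw [h1, Limits.comp_zero]

end DGMod

/-! ### Unipotent filtrations, and perfect pure modules are unipotent. -/

/-- For submodules `K` and `V` of a semisimple module, a projection to `K` preserving `V`. -/
lemma Submodule.exists_projection_preserving {S V : Type*} [Ring S] [IsSemisimpleRing S]
    [AddCommGroup V] [Module S V] (K U : Submodule S V) :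
    ∃ q : V →ₗ[S] V, (∀ v, q v ∈ K) ∧ (∀ v ∈ K, q v = v) ∧ ∀ v ∈ U, q v ∈ U := by
  -- One has `U = (K ⊓ U) ⊕ (D ⊓ U)`. The second summand is disjoint from `K`, hence contained in a
  -- complement `E` of `K`; projecting along `E` preserves `U`.
  obtain ⟨D, hD⟩ := ComplementedLattice.exists_isCompl (K ⊓ U)
  have hdis : Disjoint K (D ⊓ U) := by
    rw [disjoint_iff, inf_comm D, ← inf_assoc]
    exact hD.inf_eq_bot
  obtain ⟨E, hE, hKE⟩ := hdis.symm.exists_isCompl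
  refine ⟨K.subtype ∘ₗ K.projectionOnto E hKE.symm, fun v => (K.projectionOnto E _ v).2,
    fun v hv => ?_, fun v hv => ?_⟩
  · exact congrArg Subtype.val (Submodule.projectionOnto_apply_left hKE.symm ⟨v, hv⟩)
  · obtain ⟨b, hb, c, hc, rfl⟩ := Submodule.mem_sup.1
      (hD.sup_eq_top ▸ Submodule.mem_top : v ∈ (K ⊓ U) ⊔ D)
    have hcU : c ∈ U := by
      have := U.sub_mem hv hb.2
      rwa [add_sub_cancel_left] at this
    have h1 : K.projectionOnto E hKE.symm b = ⟨b, hb.1⟩ :=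
      Submodule.projectionOnto_apply_left hKE.symm ⟨b, hb.1⟩
    have h2 : K.projectionOnto E hKE.symm c = 0 :=
      (Submodule.projectionOnto_apply_eq_zero_iff hKE.symm).2 (hE ⟨hc, hcU⟩)
    simpa [h1, h2] using hb.2

namespace DGMod

variable {k : Type w} [CommRing k] {R : DGAlgebra.{w, u} k} [R.Admissible]

/-- The ascending filtration of the degree zero component of a dg module, whose first step
consists of the cocycles and whose next steps are the elements with differential in the graded
submodule generated by the previous step. -/
def soc (M : DGMod R) : ℕ → Submodule (R.gr 0)ᵐᵒᵖ (M.X 0)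
  | 0 => ⊥
  | n + 1 =>
    { carrier := {v | M.d (zero_add 1) v ∈ M.gen (soc M n).toAddSubgroup 1}
      add_mem' := fun {v v'} hv hv' => by
        simp only [Set.mem_ofPred_eq, map_add] at *
        exact add_mem hv hv'
      zero_mem' := by simp
      smul_mem' := fun a v hv => by
        simp only [Set.mem_ofPred_eq] at *
        rw [M.dlin_smul]
        exact M.act_mem_gen _ hv _ }

lemma mem_soc_succ {M : DGMod R} {n : ℕ} {v : M.X 0} :
    v ∈ M.soc (n + 1) ↔ M.d (zero_add 1) v ∈ M.gen (M.soc n).toAddSubgroup 1 := Iff.rfl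

lemma mem_soc_one {M : DGMod R} {v : M.X 0} : v ∈ M.soc 1 ↔ M.d (zero_add 1) v = 0 := by
  rw [mem_soc_succ]
  constructor
  · intro h
    exact GMap.eq_zero_of_gen (GMap.id M) (U := (M.soc 0).toAddSubgroup)
      (fun u hu => (Submodule.mem_bot (R.gr 0)ᵐᵒᵖ).1 hu) (add_zero 1) h
  · intro h
    rw [h]
    exact zero_mem _

lemma soc_mono (M : DGMod R) : Monotone M.soc := by
  refine monotone_nat_of_le_succ fun n => ?_
  induction n with
  | zero => exact bot_le
  | succ n ih => exact fun v hv => M.gen_mono ih 1 hv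

lemma hom_mem_soc {M N : DGMod R} (f : M ⟶ N) {n : ℕ} {v : M.X 0} (hv : v ∈ M.soc n) :
    f.f 0 v ∈ N.soc n := by
  induction n generalizing v with
  | zero =>
    rw [(Submodule.mem_bot _).1 hv, map_zero]
    exact zero_mem _
  | succ n ih =>
    rw [mem_soc_succ, ← f.map_d]
    exact (GMap.ofHom f).mem_gen (fun u hu => ih hu) hv

/-- A dg module is unipotent if the filtration `soc` is exhaustive. -/
def IsUnipotent (M : DGMod R) : Prop := ∃ n, M.soc n = ⊤

lemma IsUnipotent.of_surjective {M N : DGMod R} (hM : IsUnipotent M) (f : M ⟶ N)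
    (hf : Function.Surjective (f.f 0)) : IsUnipotent N := by
  obtain ⟨n, hn⟩ := hM
  refine ⟨n, eq_top_iff.2 fun v _ => ?_⟩
  obtain ⟨v, rfl⟩ := hf v
  exact hom_mem_soc f (hn ▸ Submodule.mem_top)

lemma IsUnipotent.coker {M N : DGMod R} (hN : IsUnipotent N) (f : M ⟶ N) :
    IsUnipotent (coker f) :=
  hN.of_surjective (cokerπ f) (cokerπ_surjective f 0)

/-- For `v` in the kernel, `d v` lies in the submodule generated by a step of `M`, but must be
generated by the corresponding step of the kernel. A projection of `M^0` to the kernel that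
preserves this step extends to a graded retraction, which fixes `d v` and moves the generators into
the kernel. -/
lemma IsUnipotent.ker {M N : DGMod R} (hM : IsPure M) (hN : IsPure N) (hM' : IsUnipotent M)
    (f : M ⟶ N) : IsUnipotent (ker f) := by
  have := isSemisimpleRing_op (R := R)
  have key : ∀ (n : ℕ) (v : (DGMod.ker f).X 0), (kerι f).f 0 v ∈ M.soc n →
      v ∈ (DGMod.ker f).soc n := by
    intro n
    induction n with
    | zero =>
      intro v hv
      refine (Submodule.mem_bot _).2 (kerι_injective f 0 ?_)
      rw [(Submodule.mem_bot _).1 hv, map_zero]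
    | succ n ih =>
      intro v hv
      obtain ⟨q, hq, hq', hq''⟩ :=
        Submodule.exists_projection_preserving (LinearMap.ker (Hom.lin f 0)) (M.soc n)
      obtain ⟨G, hG⟩ := hM.exists_extension (p := 0) q
      have hfG : ∀ {i j : ℤ} (h : i + 0 = j) (x : M.X i), f.f j (G.f h x) = 0 := by
        intro i j h x
        have hq0 : ∀ v, f.f 0 (q v) = 0 := hq
        refine hM.ext (g := G.compHom f) (g' := 0) (fun x => ?_) h x
        simp only [GMap.compHom_f, GMap.zero_f]
        rw [hG, hq0]
      let G' : GMap M (DGMod.ker f) 0 := kerGLift f G hfG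
      have hG' : ∀ {i : ℤ} (x : (DGMod.ker f).X i), G'.f (add_zero i) ((kerι f).f i x) = x := by
        intro i x
        refine (hM.ker hN f).ext (g := G'.precompHom (kerι f)) (g' := GMap.id _) (fun x => ?_)
          (add_zero i) x
        refine kerι_injective f 0 ?_
        simp only [GMap.precompHom_f, GMap.id_f, G', kerι_kerGLift]
        rw [hG]
        exact hq' _ (f_kerι f x)
      rw [mem_soc_succ, ← hG' ((DGMod.ker f).d _ v), (kerι f).map_d]
      refine G'.mem_gen (fun u hu => ih _ ?_) hv
      simp only [G', kerι_kerGLift]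
      rw [hG]
      exact hq'' u hu
  obtain ⟨n, hn⟩ := hM'
  exact ⟨n, eq_top_iff.2 fun v _ => key n v (hn ▸ Submodule.mem_top)⟩

lemma IsPure.isNoetherian {M : DGMod R} (hM : IsPure M) : IsNoetherian (R.gr 0)ᵐᵒᵖ (M.X 0) := by
  have := isSemisimpleRing_op (R := R)
  have := hM.finite
  infer_instance

lemma IsPure.isArtinian {M : DGMod R} (hM : IsPure M) : IsArtinian (R.gr 0)ᵐᵒᵖ (M.X 0) := by
  have := isSemisimpleRing_op (R := R)
  have := hM.finite
  infer_instance

/-- A pure dg module without nonzero homotopy classes of morphisms to acyclic dg modules is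
unipotent. -/
lemma IsPure.isUnipotent {M : DGMod R} (hM : IsPure M)
    (h : ∀ (C : DGMod R) (_ : IsAcyclic C) (f : M ⟶ C), (toHot R).map f = 0) :
    IsUnipotent M := by
  have := isSemisimpleRing_op (R := R)
  have := hM.isNoetherian
  obtain ⟨n, hn⟩ := monotone_stabilizes_iff_noetherian.2 this ⟨M.soc, M.soc_mono⟩
  have hn' : M.soc (n + 1) = M.soc n := (hn (n + 1) n.le_succ).symm
  let U := M.soc n
  let G : Submodule (R.gr 0)ᵐᵒᵖ (M.X 1) :=
    { (M.gen U.toAddSubgroup 1) with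
      smul_mem' := fun a x hx => M.act_mem_gen (add_zero 1) hx a.unop }
  -- `U` is the stable step and `G = U A^1`. The choice of `W` makes `M^0 / U → M^1 / W` bijective:
  -- surjective because the image of `d` and `W` span `M^1`, injective because `d v ∈ W` forces `d v
  -- ∈ G`, so that `v` lies in the next step, which equals `U`.
  obtain ⟨W₀, hW₀⟩ := exists_isCompl (LinearMap.range (M.dlin (zero_add 1)) ⊔ G)
  let W := W₀ ⊔ G
  have hGW : G ≤ W := le_sup_right
  have hdW : ∀ v : M.X 0, M.d (zero_add 1) v ∈ W → v ∈ U := by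
    intro v hv
    obtain ⟨w, hw, g, hg, e⟩ := Submodule.mem_sup.1 hv
    have hw0 : w = 0 := by
      have : w ∈ (LinearMap.range (M.dlin (zero_add 1)) ⊔ G) ⊓ W₀ := by
        refine ⟨?_, hw⟩
        rw [← eq_sub_iff_add_eq] at e
        rw [e]
        exact sub_mem (le_sup_left (a := LinearMap.range (M.dlin (zero_add 1))) ⟨v, rfl⟩)
          (le_sup_right (b := G) hg)
      rwa [hW₀.inf_eq_bot, Submodule.mem_bot] at this
    rw [hw0, zero_add] at e
    change v ∈ M.soc n
    rw [← hn', mem_soc_succ, ← e]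
    exact hg
  have hWd : ∀ x : M.X 1, ∃ v : M.X 0, x - M.d (zero_add 1) v ∈ W := by
    intro x
    obtain ⟨e, he, w, hw, rfl⟩ := Submodule.mem_sup.1
      (hW₀.sup_eq_top ▸ Submodule.mem_top :
        x ∈ (LinearMap.range (M.dlin (zero_add 1)) ⊔ G) ⊔ W₀)
    obtain ⟨_, ⟨v, rfl⟩, g, hg, rfl⟩ := Submodule.mem_sup.1 he
    refine ⟨v, ?_⟩
    rw [dlin_apply, add_assoc, add_sub_cancel_left, add_comm]
    exact add_mem (le_sup_left (a := W₀) hw) (hGW hg)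
  -- The conditions range over proofs of `i = 0` and `i = 1`, so all other components are taken
  -- whole. The quotient by `P` is the acyclic two-term complex `M^0 / U → M^1 / W`.
  let P : ∀ i, AddSubgroup (M.X i) := fun i =>
    (⨅ h : i = 0, U.toAddSubgroup.comap (M.cast h)) ⊓
      (⨅ h : i = 1, W.toAddSubgroup.comap (M.cast h))
  have hP : ∀ {i : ℤ} {x : M.X i}, x ∈ P i ↔
      (∀ h : i = 0, M.cast h x ∈ U) ∧ ∀ h : i = 1, M.cast h x ∈ W := by
    intro i x
    simp [P, AddSubgroup.mem_inf, AddSubgroup.mem_iInf]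
  have hP0 : ∀ {x : M.X 0}, x ∈ P 0 ↔ x ∈ U := by
    intro x; simp [hP]
  have hP1 : ∀ {x : M.X 1}, x ∈ P 1 ↔ x ∈ W := by
    intro x; simp [hP]
  have hP' : ∀ {i : ℤ} (_ : i ≠ 0) (_ : i ≠ 1) (x : M.X i), x ∈ P i := fun h h' x =>
    hP.2 ⟨fun e => absurd e h, fun e => absurd e h'⟩
  have hact : ∀ {i j n : ℤ} (h : i + j = n) (x : M.X i) (_ : x ∈ P i) (a : R.gr j),
      M.act h x a ∈ P n := by
    intro i j n h x hx a
    rcases lt_or_ge j 0 with hj | hj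
    · rw [gr_eq_zero hj a, map_zero]
      exact zero_mem _
    rcases lt_or_ge i 0 with hi | hi
    · rw [hM.eq_zero_of_neg hi x, map_zero]
      exact zero_mem _
    refine hP.2 ⟨?_, ?_⟩
    · rintro rfl
      obtain rfl : i = 0 := by omega
      obtain rfl : j = 0 := by omega
      exact U.smul_mem (MulOpposite.op a) (hP0.1 hx)
    · rintro rfl
      rcases eq_or_ne i 0 with rfl | hi'
      · obtain rfl : j = 1 := by omega
        exact hGW (M.act_gen_mem (hP0.1 hx) a)
      · obtain rfl : i = 1 := by omega
        obtain rfl : j = 0 := by omega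
        exact W.smul_mem (MulOpposite.op a) (hP1.1 hx)
  have hd : ∀ {i j : ℤ} (h : i + 1 = j) (x : M.X i) (_ : x ∈ P i), M.d h x ∈ P j := by
    intro i j h x hx
    refine hP.2 ⟨?_, ?_⟩
    · rintro rfl
      rw [hM.eq_zero_of_neg (by omega) x, map_zero, map_zero]
      exact zero_mem _
    · rintro rfl
      obtain rfl : i = 0 := by omega
      refine hGW ?_
      have := hP0.1 hx
      change x ∈ M.soc n at this
      rw [← hn', mem_soc_succ] at this
      exact this
  have hC : IsAcyclic (M.quot P hact hd) := by
    intro i j l h h' y hy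
    obtain ⟨x, rfl⟩ := M.quotπ_surjective P hact hd j y
    rw [← (M.quotπ P hact hd).map_d, quotπ_eq_zero] at hy
    rcases eq_or_ne j 0 with rfl | h0
    · obtain rfl : l = 1 := by omega
      refine ⟨0, ?_⟩
      rw [map_zero, eq_comm, quotπ_eq_zero, hP0]
      exact hdW x (hP1.1 hy)
    rcases eq_or_ne j 1 with rfl | h1
    · obtain rfl : i = 0 := by omega
      obtain ⟨v, hv⟩ := hWd x
      refine ⟨(M.quotπ P hact hd).f 0 v, ?_⟩
      rw [← (M.quotπ P hact hd).map_d, eq_comm, ← sub_eq_zero, ← map_sub, quotπ_eq_zero, hP1]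
      exact hv
    · refine ⟨0, ?_⟩
      rw [map_zero, eq_comm, quotπ_eq_zero]
      exact hP' h0 h1 x
  obtain ⟨s⟩ := (toHot_map_eq_iff (M.quotπ P hact hd) 0).1
    ((h _ hC _).trans ((toHot R).map_zero _ _).symm)
  -- The homotopy is determined by its values on `M^0`, which lie in the zero component of degree
  -- `-1`. So the projection itself is zero, and `U` is all of `M^0`.
  have hs : ∀ {i j : ℤ} (e : i + -1 = j) (x : M.X i), s.toGMap.f e x = 0 := fun e x =>
    hM.ext (g := s.toGMap) (g' := 0) (fun x => by
      obtain ⟨y, hy⟩ := M.quotπ_surjective P hact hd (-1) (s.toGMap.f (zero_add (-1)) x)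
      rw [← hy, hM.eq_zero_of_neg (by omega) y, map_zero, GMap.zero_f]) e x
  refine ⟨n, eq_top_iff.2 fun v _ => ?_⟩
  have h1 := s.eq_add (neg_add_cancel 1) (zero_add 1) v
  rw [hs, hs, map_zero, add_zero, add_zero, zero_f, quotπ_eq_zero, hP0] at h1
  exact h1

end DGMod

/-! ### Extensions, powers, and perfection of pure unipotent modules. -/

namespace DGMod

variable {k : Type w} [CommRing k] {R : DGAlgebra.{w, u} k}

lemma IsPerfect.of_retract {M N : DGMod R} (hN : IsPerfect R ((toHot R).obj N)) (i : M ⟶ N)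
    (p : N ⟶ M) (h : i ≫ p = 𝟙 M) : IsPerfect R ((toHot R).obj M) :=
  .summand ((Retract.mk i p h).map (toHot R)) hN

lemma IsPerfect.of_isIso {M N : DGMod R} (hN : IsPerfect R ((toHot R).obj N)) (f : N ⟶ M)
    [IsIso f] : IsPerfect R ((toHot R).obj M) :=
  hN.of_retract (inv f) f (by simp)

/-- The identification of the components of a shift. -/
def unshift (M : DGMod R) (n i : ℤ) : (M.shift n).X i →+ M.X (i + n) := AddMonoidHom.id _

/-- The identification of the components of a shift. -/
def toShift (M : DGMod R) (n i : ℤ) : M.X (i + n) →+ (M.shift n).X i := AddMonoidHom.id _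

@[simp] lemma unshift_toShift (M : DGMod R) (n i : ℤ) (x : M.X (i + n)) :
    M.unshift n i (M.toShift n i x) = x := rfl

lemma unshift_injective (M : DGMod R) (n i : ℤ) : Function.Injective (M.unshift n i) :=
  fun _ _ h => h

lemma unshift_act (M : DGMod R) (n : ℤ) {i j l : ℤ} (h : i + j = l) (x : (M.shift n).X i)
    (a : R.gr j) : M.unshift n l ((M.shift n).act h x a) =
      M.act (by omega : i + n + j = l + n) (M.unshift n i x) a := rfl

lemma unshift_d (M : DGMod R) (n : ℤ) {i j : ℤ} (h : i + 1 = j) (x : (M.shift n).X i) :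
    M.unshift n j ((M.shift n).d h x) =
      (n.negOnePow : ℤ) • M.d (by omega : i + n + 1 = j + n) (M.unshift n i x) := by
  rw [← Units.smul_def]
  rfl

/-- If `π : M ⟶ Q` is a surjection of dg modules which splits as a map of graded modules, and both
`Q` and the kernel of `π` are perfect, then `M` is perfect. -/
lemma IsPerfect.of_extension {M Q : DGMod R} (π : M ⟶ Q) (σ : GMap Q M 0)
    (hσ : ∀ {i : ℤ} (x : Q.X i), π.f i (σ.f (add_zero i) x) = x)
    (hQ : IsPerfect R ((toHot R).obj Q)) (hK : IsPerfect R ((toHot R).obj (ker π))) :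
    IsPerfect R ((toHot R).obj M) := by
  -- The failure `d σ - σ d` of the section to be a morphism has values in the kernel. It is the
  -- connecting morphism `D` out of `{-1}Q`, and the cone of `D` is `M` through `(z, x) ↦ z + σ x`.
  let δ : GMap Q (ker π) 1 := kerGLift π σ.bd (by
    intro i j h x
    rw [GMap.bd_f, map_sub, π.map_d, hσ, hσ, sub_self])
  have hδ : ∀ {i j : ℤ} (h : i + 1 = j) (x : Q.X i), (kerι π).f j (δ.f h x) =
      M.d h (σ.f (add_zero i) x) - σ.f (add_zero j) (Q.d h x) := fun h x => rfl
  let D : Q.shift (-1) ⟶ ker π := ⟨fun i =>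
    (δ.f (by omega : i + -1 + 1 = i)).comp (Q.unshift (-1) i), fun {i j n} h x a => by
      simp only [AddMonoidHom.comp_apply, unshift_act]
      exact δ.map_act _ _ _ _ _ _, fun {i j} h x => by
      refine kerι_injective π j ?_
      simp only [AddMonoidHom.comp_apply, unshift_d, map_zsmul, (kerι π).map_d, hδ, map_sub, M.d_d,
        Q.d_d, map_zero]
      subst h
      have key : ∀ (l : ℤ) (e : i = l) (h : i + -1 + 1 = i) (h' : i + -1 + 1 = l)
        (h₂ : i + 1 = i + 1) (h₂' : l + 1 = i + 1), M.d h₂' (σ.f (add_zero _)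
          (Q.d h' (Q.unshift (-1) i x))) =
          M.d h₂ (σ.f (add_zero _) (Q.d h (Q.unshift (-1) i x))) := by
        rintro l rfl _ _ _ _; rfl
      have := key (i + 1 + -1) (by omega) (by omega) (by omega) (by omega) (by omega)
      rw [this]
      simp⟩
  have hD : ∀ {i : ℤ} (x : (Q.shift (-1)).X i), (kerι π).f i (D.f i x) =
      M.d (by omega : i + -1 + 1 = i) (σ.f (add_zero (i + -1)) (Q.unshift (-1) i x)) -
        σ.f (add_zero i) (Q.d (by omega : i + -1 + 1 = i) (Q.unshift (-1) i x)) := fun x => rfl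
  let F : DGMod.cone D ⟶ M := ⟨fun i => ((kerι π).f i).comp (coneFst D i) +
    (σ.f (by omega : i + 1 + -1 + 0 = i)).comp ((Q.unshift (-1) (i + 1)).comp (coneSnd D i)),
    fun {i j n} h z a => by
      simp only [AddMonoidHom.add_apply, AddMonoidHom.comp_apply, coneFst_act, coneSnd_act,
        unshift_act, (kerι π).map_act, map_add]
      rw [σ.map_act (by omega : i + 1 + -1 + j = n + 1 + -1) (by omega : i + 1 + -1 + 0 = i) _ h],
    fun {i j} h z => by
      subst h
      simp only [AddMonoidHom.add_apply, AddMonoidHom.comp_apply, coneFst_d, coneSnd_d, map_neg,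
        unshift_d, map_zsmul, (kerι π).map_d, map_add, hD, cast_rfl]
      have key : ∀ (l : ℤ) (e : l = i) (y : Q.X l) (h₁ : l + 1 = i + 1) (h₂ : l + 0 = i),
          M.d h₁ (σ.f (add_zero l) y) = M.d rfl (σ.f h₂ y) := by
        rintro l rfl y _ _; rfl
      have key' : ∀ (l l' : ℤ) (e : l + 1 = l') (y : Q.X l) (e' : i + 1 = l') (h₁ : l + 1 = i + 1)
          (h₂ : l' + 0 = i + 1), σ.f (add_zero (i + 1)) (Q.d h₁ y) = σ.f h₂ (Q.d e y) := by
        rintro l l' e y rfl _ _; rfl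
      rw [key (i + 1 + -1) (by omega) _ _ (by omega),
        key' (i + 1 + -1) (i + 1 + 1 + -1) (by omega) _ (by omega) _ (by omega)]
      simp
      abel⟩
  have hF : ∀ {i : ℤ} (z : (DGMod.cone D).X i), F.f i z = (kerι π).f i (coneFst D i z) +
      σ.f (by omega : i + 1 + -1 + 0 = i) (Q.unshift (-1) (i + 1) (coneSnd D i z)) :=
    fun _ => rfl
  have hσ' : ∀ {i j : ℤ} (h : i + 0 = j) (x : Q.X i), π.f j (σ.f h x) = Q.cast (by omega) x := by
    intro i j h x
    obtain rfl : i = j := by omega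
    exact hσ x
  have hcast : ∀ {i j : ℤ} (h : i = j), Function.Injective (Q.cast h) := by
    rintro i _ rfl x y h
    exact h
  have : IsIso F := by
    refine isIso_of_bijective F fun i => ⟨(injective_iff_map_eq_zero _).2 fun z hz => ?_,
      fun m => ?_⟩
    · rw [hF] at hz
      have h1 := congrArg (π.f i) hz
      rw [map_add, f_kerι, zero_add, hσ', map_zero] at h1
      have h2 : Q.unshift (-1) (i + 1) (coneSnd D i z) = 0 :=
        hcast _ (h1.trans (map_zero _).symm)
      rw [h2, map_zero, add_zero] at hz
      refine cone_ext ?_ ?_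
      · exact (kerι_injective π i (hz.trans (map_zero _).symm)).trans (map_zero _).symm
      · refine (Q.unshift_injective (-1) (i + 1) (h2.trans (map_zero _).symm)).trans
          (map_zero _).symm
    · refine ⟨coneInl D i (kerMk π (m - σ.f (add_zero i) (π.f i m)) ?_) +
        coneInr D i (Q.toShift (-1) (i + 1) (Q.cast (by omega) (π.f i m))), ?_⟩
      · rw [map_sub, hσ, sub_self]
      · rw [hF]
        simp [GMap.f_cast]
  exact (IsPerfect.cone D (.shift (-1) Q hQ) hK).of_isIso F

section Pow

variable (M : DGMod R) (n : ℕ)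

/-- The direct sum of `n` copies of a dg module. -/
def pow : DGMod R where
  X i := Fin n → M.X i
  act h := AddMonoidHom.mk' (fun x => AddMonoidHom.mk' (fun a t => M.act h (x t) a)
    (fun a a' => by ext; simp)) (fun x x' => by ext; simp)
  d h := AddMonoidHom.mk' (fun x t => M.d h (x t)) (fun x x' => by ext; simp)
  act_one x := funext fun t => M.act_one (x t)
  act_act hij hpl hjl hiq x a b := funext fun t => M.act_act hij hpl hjl hiq (x t) a b
  d_d hij hjl x := funext fun t => M.d_d hij hjl (x t)
  d_act h hn hi hj hl hr x a := funext fun t => M.d_act h hn hi hj hl hr (x t) a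

variable {M n}

/-- The morphism to a power with given components. -/
def powLift {N : DGMod R} (f : Fin n → (N ⟶ M)) : N ⟶ M.pow n where
  f i := AddMonoidHom.mk' (fun x t => (f t).f i x) (fun x x' => funext fun _ => map_add _ x x')
  map_act h x a := funext fun t => (f t).map_act h x a
  map_d h x := funext fun t => (f t).map_d h x

/-- The projections of a power. -/
def powπ (t : Fin n) : M.pow n ⟶ M where
  f _ := Pi.evalAddMonoidHom _ t
  map_act _ _ _ := rfl
  map_d _ _ := rfl

lemma pow_ext {i : ℤ} {x y : (M.pow n).X i} (h : ∀ t, (powπ t).f i x = (powπ t).f i y) : x = y :=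
  funext h

@[simp] lemma powπ_powLift {N : DGMod R} (f : Fin n → (N ⟶ M)) (t : Fin n) {i : ℤ} (x : N.X i) :
    (powπ t).f i ((powLift f).f i x) = (f t).f i x := rfl

/-- The inclusions into a power. -/
def powι (t : Fin n) : M ⟶ M.pow n := powLift fun s => if s = t then 𝟙 M else 0

lemma sum_f {N : DGMod R} {ι : Type*} (s : Finset ι) (f : ι → (M ⟶ N)) (i : ℤ) (x : M.X i) :
    (∑ t ∈ s, f t).f i x = ∑ t ∈ s, (f t).f i x := by
  classical
  induction s using Finset.induction_on with
  | empty => rfl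
  | insert a s ha ih => rw [Finset.sum_insert ha, Finset.sum_insert ha, add_f, ih]

lemma powπ_powι (s t : Fin n) {i : ℤ} (x : M.X i) :
    (powπ s).f i ((powι t).f i x) = if s = t then x else 0 := by
  rw [powι, powπ_powLift]
  split_ifs <;> rfl

lemma pow_sum_eq {i : ℤ} (x : (M.pow n).X i) :
    ∑ t, (powι t).f i ((powπ t).f i x) = x := by
  refine pow_ext fun s => ?_
  rw [map_sum]
  simp [powπ_powι]

lemma IsPure.pow (hM : IsPure M) (n : ℕ) : IsPure (M.pow n) := by
  obtain ⟨ι, _, ⟨b⟩⟩ := hM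
  refine ⟨Fin n × ι, inferInstance, ⟨⟨fun t => (powι t.1).f 0 (b.m t.2),
    fun t => (b.φ t.2).precompHom (powπ t.1), fun {j} x => ?_⟩⟩⟩
  rw [Fintype.sum_prod_type]
  conv_rhs => rw [← pow_sum_eq x]
  refine Finset.sum_congr rfl fun t _ => ?_
  conv_rhs => rw [← b.sum_eq ((powπ t).f j x), map_sum]
  exact Finset.sum_congr rfl fun l _ => ((powι t).map_act _ _ _).symm

/-- Split off one factor at a time as a graded split extension. The empty power is a zero object,
hence a retract of `M`. -/
lemma IsPerfect.pow (hM : IsPerfect R ((toHot R).obj M)) (n : ℕ) :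
    IsPerfect R ((toHot R).obj (M.pow n)) := by
  induction n with
  | zero =>
    refine hM.of_retract (N := M) 0 0 (hom_ext fun i x => ?_)
    exact pow_ext fun t => t.elim0
  | succ n ih =>
    refine IsPerfect.of_extension (powπ (0 : Fin (n + 1))) (GMap.ofHom (powι 0))
      (fun x => by simp [powπ_powι]) hM ?_
    refine ih.of_retract (powLift fun t => kerι (powπ (0 : Fin (n + 1))) ≫ powπ t.succ)
      (kerLift (powπ (0 : Fin (n + 1)))
        (powLift (Fin.cons 0 fun t => (powπ t : M.pow n ⟶ M))) fun i x => rfl) ?_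
    refine hom_ext fun i x => kerι_injective _ i (pow_ext fun t => ?_)
    refine Fin.cases ?_ (fun t => ?_) t
    · exact (f_kerι (powπ (0 : Fin (n + 1))) x).symm
    · rfl

end Pow

/-- The morphism from a power of the free module given by a family of cocycles of degree zero. -/
lemma exists_hom_of_cocycles {M : DGMod R} {n : ℕ} (m : Fin n → M.X 0)
    (hm : ∀ t, M.d (zero_add 1) (m t) = 0) : ∃ f : (free R).pow n ⟶ M,
      ∀ {i : ℤ} (x : ((free R).pow n).X i), f.f i x =
        ∑ t, (freeMap (m t)).f (add_zero i) ((powπ t).f i x) := by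
  have hd : ∀ {i j : ℤ} (h : i + 1 = j) (t : Fin n) (x : (free R).X i),
      (freeMap (m t)).f (add_zero j) ((free R).d h x) =
        M.d h ((freeMap (m t)).f (add_zero i) x) := by
    intro i j h t x
    have := M.d_act (zero_add i) h (zero_add 1) h (by omega) (zero_add j) (m t) x
    rw [hm] at this
    change M.act (zero_add j) (m t) (R.d h x) = M.d h (M.act (zero_add i) (m t) x)
    rw [this, map_zero]
    change _ = (0 : M.X j) + _
    simp
  exact ⟨∑ t, powπ t ≫ (freeMap (m t)).toHom fun h x => hd h t x, fun x => by
    rw [sum_f]; rfl⟩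

lemma freeMap_val {M N : DGMod R} (m : M.X 0) (φ : GMap N (free R) 0) {i : ℤ} (x : N.X i) :
    (freeMap m).f (add_zero i) (φ.f (add_zero i) x) =
      M.act (zero_add i) m (φ.val (add_zero i) x) := rfl

lemma isPure_free : IsPure (free R) := by
  refine ⟨Unit, inferInstance, ⟨⟨fun _ => one, fun _ => GMap.id _, fun {j} x => ?_⟩⟩⟩
  simp only [Finset.univ_unique, Finset.sum_singleton]
  exact free_act_one _ _

variable [R.Admissible]

/-- A pure dg module generated by cocycles is perfect. -/
lemma IsPure.isPerfect_of_d_eq_zero {M : DGMod R} (hM : IsPure M)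
    (h : ∀ x : M.X 0, M.d (zero_add 1) x = 0) : IsPerfect R ((toHot R).obj M) := by
  have hM' := hM
  obtain ⟨ι, _, ⟨b⟩⟩ := hM
  let e := Fintype.equivFin ι
  obtain ⟨f, hf⟩ := exists_hom_of_cocycles (fun t => b.m (e.symm t)) (fun t => h _)
  -- The functionals of the dual basis commute with the differentials: it is enough to check this on
  -- `M^0`, where `d` vanishes on both sides. So the dual basis exhibits `M` as a direct summand of
  -- `A^r` in `dgMod`.
  let g : M ⟶ (free R).pow (Fintype.card ι) := powLift fun t => (b.φ (e.symm t)).toHom (by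
    intro i j h' x
    rw [eq_comm, ← sub_eq_zero]
    refine hM'.ext (g := (b.φ (e.symm t)).bd) (g' := 0) (fun x => ?_) h' x
    rw [GMap.bd_f, h, map_zero, sub_zero, GMap.zero_f]
    exact Subtype.ext (DGAlgebra.Admissible.diff_zero (R := R) _ (Subtype.property _)))
  refine (IsPerfect.free.pow _).of_retract g f (DGMod.hom_ext fun i x => ?_)
  rw [comp_f, hf, id_f]
  conv_rhs => rw [← b.sum_eq x]
  refine Fintype.sum_equiv e.symm _ _ fun t => ?_
  rw [powπ_powLift, GMap.toHom_f, freeMap_val]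

/-- Pure unipotent dg modules are perfect. -/
lemma IsPure.isPerfect {M : DGMod R} (hM : IsPure M) (hM' : IsUnipotent M) :
    IsPerfect R ((toHot R).obj M) := by
  obtain ⟨n, hn⟩ := hM'
  induction n generalizing M with
  | zero =>
    refine hM.isPerfect_of_d_eq_zero fun x => ?_
    have hx : x ∈ M.soc 0 := hn ▸ Submodule.mem_top
    rw [(Submodule.mem_bot _).1 hx, map_zero]
  | succ n ih =>
    have := hM.isNoetherian
    -- Generators of `soc 1` define a morphism from `A^r` whose image is the graded submodule
    -- generated by `soc 1`. This image is pure with zero differential on its degree zero part, and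
    -- the filtration of the cokernel is shorter by one step.
    obtain ⟨r, z, hz⟩ := Submodule.fg_iff_exists_fin_generating_family.1
      (IsNoetherian.noetherian (M.soc 1))
    have hz1 : ∀ t, z t ∈ M.soc 1 := fun t => hz ▸ Submodule.subset_span ⟨t, rfl⟩
    obtain ⟨f, hf⟩ := exists_hom_of_cocycles z fun t => mem_soc_one.1 (hz1 t)
    have hf1 : ∀ x, f.f 0 x ∈ M.soc 1 := by
      intro x
      rw [hf]
      exact sum_mem fun t _ => (M.soc 1).smul_mem (MulOpposite.op _) (hz1 t)
    have hf2 : ∀ v ∈ M.soc 1, (cokerπ f).f 0 v = 0 := by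
      intro v hv
      rw [cokerπ_eq_zero]
      rw [← hz] at hv
      obtain ⟨c, rfl⟩ := (Submodule.mem_span_range_iff_exists_fun _).1 hv
      refine ⟨(fun t => (c t).unop : Fin r → R.gr 0), ?_⟩
      exact hf _
    have hQ : IsPure (DGMod.coker f) := ((isPure_free (R := R)).pow r).coker hM f
    obtain ⟨σ, hσ⟩ := hM.exists_quasi_inverse hQ (cokerπ f)
    refine IsPerfect.of_extension (cokerπ f) σ (fun {i} x => ?_) (ih hQ ?_) ?_
    · obtain ⟨x, rfl⟩ := cokerπ_surjective f i x
      exact hσ x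
    · have key : ∀ (m : ℕ) (v : M.X 0), v ∈ M.soc (m + 1) →
          (cokerπ f).f 0 v ∈ (DGMod.coker f).soc m := by
        intro m
        induction m with
        | zero =>
          intro v hv
          rw [hf2 v hv]
          exact zero_mem _
        | succ m ihm =>
          intro v hv
          rw [mem_soc_succ, ← (cokerπ f).map_d]
          exact (GMap.ofHom (cokerπ f)).mem_gen (fun u hu => ihm u hu) hv
      refine eq_top_iff.2 fun v _ => ?_
      obtain ⟨v, rfl⟩ := cokerπ_surjective f 0 v
      exact key n v (hn ▸ Submodule.mem_top)
    · refine (hM.ker hQ _).isPerfect_of_d_eq_zero fun x => ?_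
      refine kerι_injective _ 1 ?_
      rw [(kerι _).map_d, map_zero]
      obtain ⟨y, hy⟩ := (cokerπ_eq_zero f _).1 (f_kerι (cokerπ f) x)
      rw [← hy]
      exact mem_soc_one.1 (hf1 y)

end DGMod

/-! ### Injectivity and cogeneration. -/

/-- Among the finite intersections there is a minimal one, and intersecting with one more member
cannot shrink it. This is what makes all copresentations by powers of `J` finite. -/
lemma Submodule.exists_fin_family_inf {S V α : Type*} [Ring S] [AddCommGroup V] [Module S V]
    [IsArtinian S V] (F : α → Submodule S V) :
    ∃ (n : ℕ) (a : Fin n → α), ∀ v, (∀ i, v ∈ F (a i)) → ∀ x, v ∈ F x := by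
  classical
  obtain ⟨_, ⟨s, rfl⟩, hs⟩ := IsArtinian.set_has_minimal
    (Set.range fun s : Finset α => s.inf F) ⟨_, ∅, rfl⟩
  refine ⟨s.card, fun i => s.equivFin.symm i, fun v hv x => ?_⟩
  have h1 : (insert x s).inf F = s.inf F := by
    refine (Finset.inf_mono (Finset.subset_insert x s)).eq_of_not_lt (hs _ ⟨_, rfl⟩)
  have h2 : v ∈ s.inf F := by
    rw [Submodule.mem_finsetInf]
    intro i hi
    simpa using hv (s.equivFin ⟨i, hi⟩)
  rw [← h1, Submodule.mem_finsetInf] at h2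
  exact h2 x (Finset.mem_insert_self _ _)

namespace DGMod

variable {k : Type w} [CommRing k] {R : DGAlgebra.{w, u} k} [R.Admissible]

/-- Graded maps of degree one, anticommuting with the differentials, from a pure unipotent dg
module to a dg module without first cohomology are coboundaries. -/
lemma IsPure.exists_bd {Q J : DGMod R} (hQ : IsPure Q) (hQ' : IsUnipotent Q)
    (hJ : ∀ x : J.X 1, J.d (rfl : (1 : ℤ) + 1 = 1 + 1) x = 0 → ∃ y, J.d (zero_add 1) y = x)
    (c : GMap Q J 1) (hc : ∀ {i j l : ℤ} (h : i + 1 = j) (h' : j + 1 = l) (x : Q.X i),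
      J.d h' (c.f h x) = -c.f h' (Q.d h x)) :
    ∃ u : GMap Q J 0, ∀ {i j : ℤ} (h : i + 1 = j) (x : Q.X i), c.f h x = u.bd.f h x := by
  have := isSemisimpleRing_op (R := R)
  have key : ∀ n : ℕ, ∃ u : GMap Q J 0, ∀ v ∈ Q.soc n,
      c.f (zero_add 1) v = u.bd.f (zero_add 1) v := by
    intro n
    induction n with
    | zero =>
      refine ⟨0, fun v hv => ?_⟩
      rw [(Submodule.mem_bot _).1 hv, map_zero, map_zero]
    | succ n ih =>
      obtain ⟨u, hu⟩ := ih
      -- The remainder vanishes on the submodule generated by `soc n`, which contains `d v` for `v`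
      -- in `soc (n + 1)`. Hence `c' v` is a cycle of degree one in `J`, and so a boundary.
      let c' := c - u.bd
      have hc'0 : ∀ v ∈ Q.soc n, c'.f (zero_add 1) v = 0 := fun v hv => by
        simp only [c', GMap.sub_f]
        rw [hu v hv, sub_self]
      have hc'1 : ∀ v ∈ Q.soc (n + 1), ∃ y, J.d (zero_add 1) y = c'.f (zero_add 1) v := by
        intro v hv
        refine hJ _ ?_
        have h0 : c'.f rfl (Q.d (zero_add 1) v) = 0 :=
          GMap.eq_zero_of_gen c' (U := (Q.soc n).toAddSubgroup) hc'0 _ hv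
        simp only [c', GMap.sub_f] at h0 ⊢
        rw [map_sub, hc, GMap.d_bd, ← neg_sub', h0, neg_zero]
      obtain ⟨p, hp, hp', -⟩ := Submodule.exists_projection_preserving (Q.soc (n + 1)) ⊤
      obtain ⟨q, hq, hq', -⟩ := Submodule.exists_projection_preserving (Q.soc n) ⊤
      let D := J.dlin (zero_add 1)
      let t : Q.X 0 →ₗ[(R.gr 0)ᵐᵒᵖ] LinearMap.range D :=
        ((c'.lin (zero_add 1)).comp p).codRestrict _ fun v => hc'1 _ (hp v)
      have : Module.Projective (R.gr 0)ᵐᵒᵖ (Q.X 0) := Module.projective_of_isSemisimpleRing _ _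
      obtain ⟨s, hs⟩ := Module.projective_lifting_property D.rangeRestrict t
        D.surjective_rangeRestrict
      have hs' : ∀ v, J.d (zero_add 1) (s v) = c'.f (zero_add 1) (p v) := fun v =>
        congrArg Subtype.val (LinearMap.congr_fun hs v)
      -- Precomposing the chosen primitives with `1 - q` makes the correction vanish on `soc n`, so
      -- `W (d v) = 0` on the next step and the earlier equalities survive.
      obtain ⟨W, hW⟩ := hQ.exists_extension (p := 0) (s.comp (LinearMap.id - q))
      have hW' : ∀ v, W.f (add_zero 0) v = s (v - q v) := hW
      refine ⟨u + W, fun v hv => ?_⟩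
      have h1 : W.f (add_zero 1) (Q.d (zero_add 1) v) = 0 :=
        GMap.eq_zero_of_gen W (U := (Q.soc n).toAddSubgroup) (fun x hx => by
          refine (hW' x).trans ?_
          rw [hq' x hx, sub_self, map_zero]) _ hv
      have h2 : v - q v ∈ Q.soc (n + 1) := sub_mem hv (Q.soc_mono n.le_succ (hq v))
      rw [GMap.bd_f, GMap.add_f, GMap.add_f, map_add, h1, hW', hs', hp' _ h2, map_sub,
        hc'0 _ (hq v)]
      simp [c']
      abel
  obtain ⟨n, hn⟩ := hQ'
  obtain ⟨u, hu⟩ := key n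
  exact ⟨u, fun h x => hQ.ext (fun x => hu x (hn ▸ Submodule.mem_top)) h x⟩

/-- Morphisms to a dg module without first cohomology extend along morphisms of pure dg modules
with unipotent target. -/
lemma IsPure.exists_factorization {M N J : DGMod R} (hM : IsPure M) (hN : IsPure N)
    (hN' : IsUnipotent N)
    (hJ : ∀ x : J.X 1, J.d (rfl : (1 : ℤ) + 1 = 1 + 1) x = 0 → ∃ y, J.d (zero_add 1) y = x)
    (f : M ⟶ N) (g : M ⟶ J) (h : ∀ x : M.X 0, f.f 0 x = 0 → g.f 0 x = 0) :
    ∃ e : N ⟶ J, f ≫ e = g := by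
  obtain ⟨s, hs⟩ := hM.exists_quasi_inverse hN f
  -- A graded extension of `g`: the elements `x - s (f x)` with `x` in degree zero lie in the kernel
  -- of `f`, hence are killed by `g`. Its commutator with `d` vanishes on the image of `f`, and a
  -- primitive `u` on the cokernel corrects it to a morphism without changing it on that image.
  let g' := s.compHom g
  have hg' : ∀ {i : ℤ} (x : M.X i), g'.f (add_zero i) (f.f i x) = g.f i x := by
    intro i x
    refine hM.ext (g := g'.precompHom f) (g' := GMap.ofHom g) (fun x => ?_) (add_zero i) x
    rw [← sub_eq_zero]
    simp only [GMap.precompHom_f, g', GMap.compHom_f, GMap.ofHom_f]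
    rw [← map_sub]
    refine h _ ?_
    rw [map_sub, hs, sub_self]
  let c : GMap (DGMod.coker f) J 1 := cokerLift f g'.bd (by
    intro i j e x
    rw [GMap.bd_f, ← f.map_d, hg', hg', g.map_d, sub_self])
  have hc : ∀ {i j : ℤ} (e : i + 1 = j) (x : N.X i), c.f e ((cokerπ f).f i x) = g'.bd.f e x :=
    fun e x => cokerLift_f _ _ _ e x
  obtain ⟨u, hu⟩ := (hM.coker hN f).exists_bd (hN'.coker f) hJ c (by
    intro i j l e e' x
    obtain ⟨x, rfl⟩ := cokerπ_surjective f i x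
    rw [hc, GMap.d_bd, ← hc, (cokerπ f).map_d])
  refine ⟨(g' - u.precompHom (cokerπ f)).toHom ?_, hom_ext hM fun x => ?_⟩
  · intro i j e x
    have h1 := (hc e x).symm.trans (hu e _)
    rw [GMap.bd_f, GMap.bd_f, ← (cokerπ f).map_d] at h1
    simp only [GMap.sub_f, GMap.precompHom_f, map_sub]
    rw [sub_eq_sub_iff_sub_eq_sub, ← neg_inj, neg_sub, neg_sub]
    exact h1
  · rw [comp_f, GMap.toHom_f, GMap.sub_f, GMap.precompHom_f, hg',
      (cokerπ_eq_zero f _).2 ⟨x, rfl⟩, map_zero, sub_zero]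

section Hat

variable {L : Type u} [AddCommGroup L] [Module (R.gr 0)ᵐᵒᵖ L]

omit [R.Admissible] in
lemma exists_ten_one (t : Ten R L 0) : ∃ l : L, t = ten 0 l (1 : R.gr 0) := by
  induction t using ten_induction with
  | h l b =>
    refine ⟨MulOpposite.op b • l, ?_⟩
    rw [ten_smul]
    congr 1
    ext
    simp
  | h0 => exact ⟨0, by simp⟩
  | hadd x y hx hy =>
    obtain ⟨l, rfl⟩ := hx
    obtain ⟨l', rfl⟩ := hy
    exact ⟨l + l', by simp⟩

/-- The morphism `L̂ ⟶ M` attached to a linear map from `L` to the degree zero cocycles of `M`. -/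
lemma exists_hom_hat {M : DGMod R} (θ : L →ₗ[(R.gr 0)ᵐᵒᵖ] M.X 0)
    (hθ : ∀ l, M.d (zero_add 1) (θ l) = 0) :
    ∃ f : hat R L ⟶ M, ∀ l : L, f.f 0 (ten 0 l (1 : R.gr 0)) = θ l := by
  let φ (i : ℤ) : Ten R L i →+ M.X i := tenLift
    (AddMonoidHom.mk' (fun l => M.act (zero_add i) (θ l)) (fun l l' => by simp))
    (fun l a b => by
      simp only [AddMonoidHom.mk'_apply, map_smul, smul_eq_act]
      exact M.act_act _ _ _ _ _ _ _)
  have hφ : ∀ i l b, φ i (ten i l b) = M.act (zero_add i) (θ l) b := fun _ _ _ => rfl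
  refine ⟨⟨φ, ?_, ?_⟩, fun l => M.act_one _⟩
  · intro i j n h x a
    refine ten_hom_ext (f := (φ n).comp (((hat R L).act h).flip a))
      (g := ((M.act h).flip a).comp (φ i)) (fun l b => ?_) x
    refine (hφ n l (R.mul h b a)).trans (Eq.trans ?_ (congrArg (fun y => M.act h y a)
      (hφ i l b)).symm)
    exact (M.act_act _ _ _ _ _ _ _).symm
  · intro i j h x
    refine ten_hom_ext (f := (φ j).comp ((hat R L).d h)) (g := (M.d h).comp (φ i))
      (fun l b => ?_) x
    refine (hφ j l (R.d h b)).trans (Eq.trans ?_ (congrArg (M.d h) (hφ i l b)).symm)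
    rw [M.d_act _ h (zero_add 1) h (by omega) (zero_add j), hθ, map_zero]
    simp

lemma isPure_hat [IsSimpleModule (R.gr 0)ᵐᵒᵖ L] : IsPure (hat R L) := by
  obtain ⟨r⟩ := exists_retract_hat (R := R) L
  exact isPure_free.of_retract (GMap.ofHom r.i) (GMap.ofHom r.r) fun {j} x =>
    congrArg (fun g : hat R L ⟶ hat R L => g.f j x) r.retract

/-- Multiplication `l ⊗ a ↦ l a` recovers `l` from `l ⊗ 1`. -/
lemma id_hat_ne_zero [IsSimpleModule (R.gr 0)ᵐᵒᵖ L] : 𝟙 (hat R L) ≠ 0 := by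
  intro h
  have : Nontrivial L := IsSimpleModule.nontrivial (R.gr 0)ᵐᵒᵖ L
  obtain ⟨l, hl⟩ := exists_ne (0 : L)
  let φ : Ten R L 0 →+ L := tenLift
    (AddMonoidHom.mk' (fun l => AddMonoidHom.mk' (fun a => MulOpposite.op a • l)
      (fun a b => by simp [add_smul])) (fun l l' => by ext; simp))
    (fun l a b => by
      simp only [AddMonoidHom.mk'_apply, smul_smul]
      congr 1)
  have h1 : φ (ten 0 l (1 : R.gr 0)) = l := one_smul _ l
  have h2 : (ten 0 l (1 : R.gr 0) : Ten R L 0) = 0 :=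
    congrArg (fun g : hat R L ⟶ hat R L => g.f 0 (ten 0 l (1 : R.gr 0))) h
  rw [h2, map_zero] at h1
  exact hl h1.symm

end Hat

/-- A pure dg module without first cohomology which receives nonzero morphisms from all `L̂`, with
`L` simple, cogenerates the pure unipotent dg modules. -/
lemma IsPure.exists_apply_ne_zero {M J : DGMod R} (hM : IsPure M) (hM' : IsUnipotent M)
    (hJ : IsPure J)
    (hJ' : ∀ x : J.X 1, J.d (rfl : (1 : ℤ) + 1 = 1 + 1) x = 0 → ∃ y, J.d (zero_add 1) y = x)
    (hL : ∀ (L : Type u) [AddCommGroup L] [Module (R.gr 0)ᵐᵒᵖ L]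
      [IsSimpleModule (R.gr 0)ᵐᵒᵖ L], ∃ f : hat R L ⟶ J, f ≠ 0)
    (v : M.X 0) (hv : v ≠ 0) : ∃ h : M ⟶ J, h.f 0 v ≠ 0 := by
  by_contra! H
  have := hM.isArtinian
  obtain ⟨n, y, hy⟩ := Submodule.exists_fin_family_inf fun h : M ⟶ J => LinearMap.ker (Hom.lin h 0)
  let Y : M ⟶ J.pow n := powLift y
  have hY : ∀ x : M.X 0, Y.f 0 x = 0 → ∀ h : M ⟶ J, h.f 0 x = 0 := fun x hx h =>
    hy x (fun i => congrArg ((powπ i).f 0) hx) h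
  have hK : IsPure (DGMod.ker Y) := hM.ker (hJ.pow n) Y
  obtain ⟨m, hm⟩ : IsUnipotent (DGMod.ker Y) := hM'.ker hM (hJ.pow n) Y
  -- In degree zero the kernel of `Y` is the common kernel of all morphisms to `J`. It contains `v`,
  -- while a zero first step would make the whole exhaustive filtration zero.
  have hsoc : (DGMod.ker Y).soc 1 ≠ ⊥ := by
    intro h0
    have : ∀ m, (DGMod.ker Y).soc m = ⊥ := by
      intro m
      induction m with
      | zero => rfl
      | succ m ih =>
        rw [eq_bot_iff, ← h0]
        intro x hx
        rw [mem_soc_succ, ih] at hx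
        exact hx
    rw [this m] at hm
    have hv' : Y.f 0 v = 0 := pow_ext fun t => (H _).trans (map_zero _).symm
    have h1 : kerMk Y v hv' = 0 := by
      rw [← Submodule.mem_bot (R.gr 0)ᵐᵒᵖ, hm]
      exact Submodule.mem_top
    exact hv (congrArg ((kerι Y).f 0) h1)
  have := hK.isArtinian
  -- A simple submodule of cocycles gives `L̂ ⟶ M`, injective in degree zero, along which a nonzero
  -- `ψ : L̂ ⟶ J` extends to `M`. The extension must kill the kernel of `Y`, and so `L`, which
  -- contradicts `ψ ≠ 0`.
  obtain ⟨L, hL₁, hL₂⟩ := (eq_bot_or_exists_atom_le ((DGMod.ker Y).soc 1)).resolve_left hsoc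
  have : IsSimpleModule (R.gr 0)ᵐᵒᵖ L := isSimpleModule_iff_isAtom.2 hL₁
  obtain ⟨ψ, hψ⟩ := hL L
  obtain ⟨f, hf⟩ := exists_hom_hat (M := M) (L := L) ((Hom.lin (kerι Y) 0).comp L.subtype) (by
    rintro ⟨l, hl⟩
    change M.d _ ((kerι Y).f 0 l) = 0
    rw [← (kerι Y).map_d, mem_soc_one.1 (hL₂ hl), map_zero])
  have hf' : ∀ l : L, f.f 0 (ten 0 l (1 : R.gr 0)) = (kerι Y).f 0 l := hf
  obtain ⟨h, hh⟩ := isPure_hat.exists_factorization hM hM' hJ' f ψ (by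
    intro t ht
    obtain ⟨l, rfl⟩ := exists_ten_one t
    have hl : l = 0 := by
      rw [hf'] at ht
      exact Subtype.ext (kerι_injective Y 0 (ht.trans (map_zero _).symm))
    have h0 : (ten 0 (0 : L) (1 : R.gr 0) : Ten R L 0) = 0 := by simp
    rw [hl]
    exact (congrArg (ψ.f 0) h0).trans (map_zero _))
  refine hψ (isPure_hat.hom_ext fun t => ?_)
  obtain ⟨l, rfl⟩ := exists_ten_one t
  rw [← hh]
  change h.f 0 (f.f 0 (ten 0 l (1 : R.gr 0))) = 0
  rw [hf']
  exact hY _ (f_kerι Y l) h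

end DGMod

/-! ### A criterion for a contravariant Hom functor to be an equivalence onto finitely generated
modules. -/

namespace CategoryTheory.Functor

universe v v₁ v₂ u₁ u₂ u₃

variable {D : Type u₁} [Category.{v₁} D] {C : Type u₂} [Category.{v} C] [Preadditive C]

/-- A functor `F : D ⥤ C` is dualized by an object `I` of `C` if every object of `D` is finitely
copresented by `I`, and every finitely generated module over the endomorphism ring of `I` arises
from morphisms from an object of `D` to `I`. -/
structure IsDualizedBy (F : D ⥤ C) (I : C) : Prop where
  exists_family (X : D) : ∃ (n : ℕ) (y : Fin n → (F.obj X ⟶ I)),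
    (∀ (Z : D) (f g : Z ⟶ X), (∀ t, F.map f ≫ y t = F.map g ≫ y t) → f = g) ∧
    (∀ g : F.obj X ⟶ I, ∃ q : Fin n → End I, ∑ t, q t • y t = g) ∧
    ∀ (Z : D) (x : Fin n → (F.obj Z ⟶ I)),
      (∀ q : Fin n → End I, ∑ t, q t • y t = 0 → ∑ t, q t • x t = 0) →
        ∃ f : Z ⟶ X, ∀ t, F.map f ≫ y t = x t
  exists_presentation (n : ℕ) (N : Submodule (End I) (Fin n → End I)) :
    ∃ (X : D) (y : Fin n → (F.obj X ⟶ I)),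
      (∀ g : F.obj X ⟶ I, ∃ q : Fin n → End I, ∑ t, q t • y t = g) ∧
      ∀ q : Fin n → End I, ∑ t, q t • y t = 0 ↔ q ∈ N

/-- The family `y` generates `Hom(F X, I)` and is jointly faithful, which gives finite generation
and faithfulness. A linear map preserves the relations among the `y t`, so its values on them come
from a morphism, which gives fullness. Presentations give essential surjectivity. All this is
checked on `D` and descends along the equivalence `F`. -/
lemma IsDualizedBy.exists_isEquivalence {F : D ⥤ C} {I : C} (h : F.IsDualizedBy I)
    [F.IsEquivalence] :
    ∃ hfg : ∀ M : Cᵒᵖ, ModuleCat.isFG (End I) ((preadditiveYonedaObj I).obj M),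
      ((ModuleCat.isFG (End I)).lift (preadditiveYonedaObj I) hfg).rightOp.IsEquivalence := by
  have hfg' (X : D) : Module.Finite (End I) (F.obj X ⟶ I) := by
    obtain ⟨n, y, -, hy, -⟩ := h.exists_family X
    refine Module.Finite.of_surjective (Fintype.linearCombination (End I) y) fun g => ?_
    obtain ⟨q, hq⟩ := hy g
    exact ⟨q, hq⟩
  have hfg (M : Cᵒᵖ) : ModuleCat.isFG (End I) ((preadditiveYonedaObj I).obj M) := by
    rw [ModuleCat.isFG_iff]
    have := hfg' (F.objPreimage M.unop)
    let e := F.objObjPreimageIso M.unop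
    let ρ : (F.obj (F.objPreimage M.unop) ⟶ I) →ₗ[End I] (M.unop ⟶ I) :=
      ((preadditiveYonedaObj I).map e.inv.op).hom
    have hρ (g : F.obj (F.objPreimage M.unop) ⟶ I) : ρ g = e.inv ≫ g := rfl
    have hρ' : Function.Surjective ρ := fun g => ⟨e.hom ≫ g, by rw [hρ, e.inv_hom_id_assoc]⟩
    exact Module.Finite.of_surjective ρ hρ'
  refine ⟨hfg, ?_⟩
  set L := (ModuleCat.isFG (End I)).lift (preadditiveYonedaObj I) hfg
  have hL {X Z : D} (f : Z ⟶ X) (y : F.obj X ⟶ I) :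
    (L.map (F.map f).op).hom.hom y = F.map f ≫ y := rfl
  have h1 : (F.op ⋙ L).Faithful := by
    refine ⟨fun {X Z} f g hfg => Quiver.Hom.unop_inj ?_⟩
    obtain ⟨n, y, hy, -⟩ := h.exists_family X.unop
    refine hy _ _ _ fun t => ?_
    rw [← hL, ← hL]
    exact congrArg (fun φ : (F.op ⋙ L).obj X ⟶ (F.op ⋙ L).obj Z => φ.hom.hom (y t)) hfg
  have h2 : (F.op ⋙ L).Full := by
    refine ⟨fun {X Z} φ => ?_⟩
    obtain ⟨n, y, -, hy, hy'⟩ := h.exists_family X.unop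
    let ψ : (F.obj X.unop ⟶ I) →ₗ[End I] (F.obj Z.unop ⟶ I) := φ.hom.hom
    obtain ⟨f, hf⟩ := hy' Z.unop (fun t => ψ (y t)) fun q hq => by
      simpa using congrArg ψ hq
    refine ⟨f.op, ?_⟩
    ext g
    obtain ⟨q, rfl⟩ := hy g
    let χ : (F.obj X.unop ⟶ I) →ₗ[End I] (F.obj Z.unop ⟶ I) :=
      ((preadditiveYonedaObj I).map (F.map f).op).hom
    have hχ (t : Fin n) : χ (y t) = ψ (y t) := hf t
    change χ _ = ψ _
    rw [_root_.map_sum, _root_.map_sum]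
    exact Finset.sum_congr rfl fun t _ => by rw [_root_.map_smul, _root_.map_smul, hχ]
  have h3 : (F.op ⋙ L).EssSurj := by
    refine ⟨fun E => ?_⟩
    have : Module.Finite (End I) E.obj := (ModuleCat.isFG_iff _).1 E.property
    obtain ⟨n, π, hπ⟩ := Module.Finite.exists_fin' (End I) E.obj
    obtain ⟨X, y, hy, hy'⟩ := h.exists_presentation n (LinearMap.ker π)
    let ρ := Fintype.linearCombination (End I) y
    have hρ : LinearMap.ker ρ = LinearMap.ker π := Submodule.ext hy'
    have hρ' : Function.Surjective ρ := hy
    let e : (F.obj X ⟶ I) ≃ₗ[End I] E.obj := (ρ.quotKerEquivOfSurjective hρ').symm.trans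
      ((Submodule.quotEquivOfEq _ _ hρ).trans (π.quotKerEquivOfSurjective hπ))
    exact ⟨Opposite.op X, ⟨(ModuleCat.isFG (End I)).isoMk e.toModuleIso⟩⟩
  have h4 : (F.op ⋙ L).IsEquivalence := { }
  have h5 : L.IsEquivalence := isEquivalence_of_comp_left F.op L
  infer_instance

/-- Dualized functors can be recognized after a change of the ambient category. -/
lemma IsDualizedBy.transport {C' : Type u₃} [Category.{v₂} C'] [Preadditive C'] {F : D ⥤ C}
    {I : C} (h : F.IsDualizedBy I) (G : D ⥤ C') (I' : C')
    (φ : ∀ X, (F.obj X ⟶ I) ≃+ (G.obj X ⟶ I')) (ψ : End I ≃+* End I')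
    (hφ : ∀ {X Z : D} (f : Z ⟶ X) (x : F.obj X ⟶ I), φ Z (F.map f ≫ x) = G.map f ≫ φ X x)
    (hψ : ∀ (X : D) (q : End I) (x : F.obj X ⟶ I), φ X (q • x) = ψ q • φ X x) :
    G.IsDualizedBy I' := by
  have key : ∀ {X : D} {n : ℕ} (y : Fin n → (F.obj X ⟶ I)) (q : Fin n → End I),
      φ X (∑ t, q t • y t) = ∑ t, ψ (q t) • φ X (y t) := by
    intro X n y q
    rw [_root_.map_sum]
    exact Finset.sum_congr rfl fun t _ => hψ _ _ _
  have key' : ∀ {X : D} {n : ℕ} (y : Fin n → (F.obj X ⟶ I)) (q : Fin n → End I'),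
      ∑ t, q t • φ X (y t) = φ X (∑ t, ψ.symm (q t) • y t) := by
    intro X n y q
    rw [key]
    simp
  have gen : ∀ {X : D} {n : ℕ} (y : Fin n → (F.obj X ⟶ I)),
      (∀ g : F.obj X ⟶ I, ∃ q : Fin n → End I, ∑ t, q t • y t = g) →
      ∀ g : G.obj X ⟶ I', ∃ q : Fin n → End I', ∑ t, q t • φ X (y t) = g := by
    intro X n y hy g
    obtain ⟨q, hq⟩ := hy ((φ X).symm g)
    exact ⟨fun t => ψ (q t), by rw [← key, hq, AddEquiv.apply_symm_apply]⟩
  refine ⟨fun X => ?_, fun n N => ?_⟩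
  · obtain ⟨n, y, h1, h2, h3⟩ := h.exists_family X
    refine ⟨n, fun t => φ X (y t), fun Z f g hfg => h1 Z f g fun t => (φ Z).injective ?_,
      gen y h2, fun Z x hx => ?_⟩
    · rw [hφ, hφ, hfg]
    · obtain ⟨f, hf⟩ := h3 Z (fun t => (φ Z).symm (x t)) fun q hq => (φ Z).injective <| by
        rw [key, _root_.map_zero]
        simp only [AddEquiv.apply_symm_apply]
        refine hx _ ?_
        rw [← key, hq, _root_.map_zero]
      exact ⟨f, fun t => by rw [← hφ, hf, AddEquiv.apply_symm_apply]⟩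
  · let N' : Submodule (End I) (Fin n → End I) :=
      { carrier := {q | (fun t => ψ (q t)) ∈ N}
        add_mem' := fun {a b} ha hb => by
          have := N.add_mem ha hb
          simpa [Pi.add_def] using this
        zero_mem' := by
          have := N.zero_mem
          simpa [Pi.zero_def] using this
        smul_mem' := fun c a ha => by
          have := N.smul_mem (ψ c) ha
          simpa only [Set.mem_ofPred_eq, Pi.smul_def, smul_eq_mul, _root_.map_mul] using this }
    have hN' : ∀ q : Fin n → End I, q ∈ N' ↔ (fun t => ψ (q t)) ∈ N := fun _ => Iff.rfl
    obtain ⟨X, y, h1, h2⟩ := h.exists_presentation n N'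
    refine ⟨X, fun t => φ X (y t), gen y h1, fun q => ?_⟩
    rw [key', _root_.map_eq_zero_iff (φ X) (φ X).injective, h2, hN']
    simp

end CategoryTheory.Functor

/-! ### The heart as the category of pure unipotent modules, and its duality. -/

namespace DGMod

variable {k : Type w} [CommRing k] {R : DGAlgebra.{w, u} k}

section Pow

variable {M N P : DGMod R} {n : ℕ}

/-- For `P = M` and scalars acting by `q • y = y ≫ q`, this identifies linear combinations of the `f
t` over `End M` with composites of `powLift f` with morphisms `M^n ⟶ M`. -/
lemma powLift_comp (f : Fin n → (N ⟶ M)) (e : M.pow n ⟶ P) :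
    powLift f ≫ e = ∑ t, f t ≫ powι t ≫ e := by
  refine DGMod.hom_ext fun i x => ?_
  rw [sum_f, comp_f, ← pow_sum_eq ((powLift f).f i x), map_sum]
  rfl

/-- The morphism out of a power with given components. -/
def powDesc (f : Fin n → (M ⟶ P)) : M.pow n ⟶ P := ∑ t, powπ t ≫ f t

lemma powDesc_f (f : Fin n → (M ⟶ P)) {i : ℤ} (x : (M.pow n).X i) :
    (powDesc f).f i x = ∑ t, (f t).f i ((powπ t).f i x) := by
  rw [powDesc, sum_f]
  rfl

lemma powι_powDesc (f : Fin n → (M ⟶ P)) (t : Fin n) : powι t ≫ powDesc f = f t := by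
  refine DGMod.hom_ext fun i x => ?_
  rw [comp_f, powDesc_f, Finset.sum_eq_single t]
  · rw [powπ_powι, if_pos rfl]
  · intro s _ hs
    rw [powπ_powι, if_neg hs, map_zero]
  · simp

lemma powDesc_powι (e : M.pow n ⟶ P) : powDesc (fun t => powι t ≫ e) = e := by
  refine DGMod.hom_ext fun i x => ?_
  conv_rhs => rw [← pow_sum_eq x, map_sum]
  exact powDesc_f _ x

end Pow

variable [R.Admissible]

lemma IsPure.isUnipotent_of_isPerfect {M : DGMod R} (hM : IsPure M)
    (h : IsPerfect R ((toHot R).obj M)) : IsUnipotent M :=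
  hM.isUnipotent fun _ hC f => h.toHot_map_eq_zero hC f

/-- For pure modules unipotence is the same as perfection, and perfection passes to powers. -/
lemma IsUnipotent.pow {M : DGMod R} (hM : IsPure M) (hM' : IsUnipotent M) (n : ℕ) :
    IsUnipotent (M.pow n) :=
  (hM.pow n).isUnipotent_of_isPerfect ((hM.isPerfect hM').pow n)

variable (R) in
/-- The pure unipotent dg modules. -/
def isPureUnipotent : ObjectProperty (DGMod R) := fun M => IsPure M ∧ IsUnipotent M

/-- A pure unipotent dg module without first cohomology which receives nonzero morphisms from all
`L̂`, with `L` simple, dualizes the pure unipotent dg modules. -/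
lemma IsPure.isDualizedBy {J : DGMod R} (hJ : IsPure J) (hJu : IsUnipotent J)
    (hJ' : ∀ x : J.X 1, J.d (rfl : (1 : ℤ) + 1 = 1 + 1) x = 0 → ∃ y, J.d (zero_add 1) y = x)
    (hL : ∀ (L : Type u) [AddCommGroup L] [Module (R.gr 0)ᵐᵒᵖ L]
      [IsSimpleModule (R.gr 0)ᵐᵒᵖ L], ∃ f : hat R L ⟶ J, f ≠ 0) :
    (isPureUnipotent R).ι.IsDualizedBy J := by
  have hsmul {X : DGMod R} (q : End J) (y : X ⟶ J) : q • y = y ≫ q := rfl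
  have hpow (n : ℕ) := hJ.pow n
  have hpow' (n : ℕ) := hJu.pow hJ n
  refine ⟨?_, ?_⟩
  · rintro ⟨X, hX, hX'⟩
    have := hX.isArtinian
    obtain ⟨n, y, hy⟩ := Submodule.exists_fin_family_inf
      fun h : X ⟶ J => LinearMap.ker (Hom.lin h 0)
    have hy0 (v : X.X 0) (hv : ∀ t, (y t).f 0 v = 0) : v = 0 := by
      by_contra hv0
      obtain ⟨h, hh⟩ := hX.exists_apply_ne_zero hX' hJ hJ' hL v hv0
      exact hh (hy v hv h)
    have hY0 (v : X.X 0) (hv : (powLift y).f 0 v = 0) : v = 0 :=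
      hy0 v fun t => congrArg ((powπ t).f 0) hv
    refine ⟨n, y, ?_, fun g => ?_, ?_⟩
    · rintro ⟨Z, hZ, _⟩ f g hfg
      refine InducedCategory.hom_ext (hZ.hom_ext fun z => sub_eq_zero.1 (hy0 _ fun t => ?_))
      rw [map_sub, sub_eq_zero]
      exact congrArg (fun φ : Z ⟶ J => φ.f 0 z) (hfg t)
    · obtain ⟨e, he⟩ := hX.exists_factorization (hpow n) (hpow' n) hJ' (powLift y) g
        fun v hv => by rw [hY0 v hv, map_zero]
      refine ⟨fun t => powι t ≫ e, ?_⟩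
      rw [← he, powLift_comp]
      rfl
    · rintro ⟨Z, hZ, _⟩ x hx
      change Fin n → (Z ⟶ J) at x
      -- If some element of `Z` were mapped outside the image of `X` in `J^n`, a morphism from the
      -- cokernel to `J` would detect it. Its components form a relation among the `y t`, hence
      -- among the `x t`, and that relation kills the element.
      have h1 : powLift x ≫ cokerπ (powLift y) = 0 := by
        refine hZ.hom_ext fun z => ?_
        by_contra hz
        obtain ⟨h, hh⟩ := (hX.coker (hpow n) (powLift y)).exists_apply_ne_zero
          ((hpow' n).coker _) hJ hJ' hL _ hz
        refine hh ?_
        have h2 := hx (fun t => powι t ≫ cokerπ (powLift y) ≫ h) (by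
          refine (powLift_comp y (cokerπ (powLift y) ≫ h)).symm.trans ?_
          refine DGMod.hom_ext fun i v => ?_
          rw [comp_f, comp_f, (cokerπ_eq_zero (powLift y) _).2 ⟨v, rfl⟩, map_zero, zero_f])
        have h3 := (powLift_comp x (cokerπ (powLift y) ≫ h)).trans h2
        exact congrArg (fun φ : Z ⟶ J => φ.f 0 z) h3
      have h2 {i : ℤ} (z : Z.X i) : ∃ v, (powLift y).f i v = (powLift x).f i z :=
        (cokerπ_eq_zero (powLift y) _).1
          (congrArg (fun φ : Z ⟶ DGMod.coker (powLift y) => φ.f i z) h1)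
      obtain ⟨s, hs⟩ := hX.exists_quasi_inverse (hpow n) (powLift y)
      have hinj {i : ℤ} (v : X.X i) (hv : (powLift y).f i v = 0) : v = 0 := by
        have h3 : s.f (add_zero i) ((powLift y).f i v) = v :=
          hX.ext (g := s.precompHom (powLift y)) (g' := GMap.id X) (fun v => by
            rw [GMap.precompHom_f, GMap.id_f, ← sub_eq_zero]
            refine hY0 _ ?_
            rw [map_sub, hs, sub_self]) (add_zero i) v
        rw [← h3, hv, map_zero]
      have hf {i : ℤ} (z : Z.X i) :
          (powLift y).f i (s.f (add_zero i) ((powLift x).f i z)) = (powLift x).f i z := by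
        obtain ⟨v, hv⟩ := h2 z
        rw [← hv, hs]
      -- Although `s` is only graded, the composite commutes with the differentials because `powLift
      -- y` is injective and inverts `s` on its image.
      let f : Z ⟶ X := (s.precompHom (powLift x)).toHom fun {i j} h z => by
        rw [GMap.precompHom_f, GMap.precompHom_f, ← sub_eq_zero]
        refine hinj _ ?_
        rw [map_sub, hf, (powLift y).map_d, hf, (powLift x).map_d, sub_self]
      refine ⟨ObjectProperty.homMk f, fun t => DGMod.hom_ext fun i z => ?_⟩
      exact congrArg ((powπ t).f i) (hf z)
  · intro n N
    have := (hpow n).isArtinian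
    -- Finitely many elements of `N`, viewed as morphisms `J^n ⟶ J`, already cut out the common
    -- kernel of all of `N` in degree zero. This common kernel is the object dual to the quotient by
    -- `N`.
    obtain ⟨m, a, ha⟩ := Submodule.exists_fin_family_inf
      fun q : N => LinearMap.ker (Hom.lin (powDesc (P := J) q.1) 0)
    let Y : J.pow n ⟶ J.pow m := powLift fun i => powDesc (a i).1
    have hY (v : (J.pow n).X 0) (hv : Y.f 0 v = 0) (q : N) : (powDesc (P := J) q.1).f 0 v = 0 :=
      ha v (fun i => congrArg ((powπ i).f 0) hv) q
    have hK : IsPure (DGMod.ker Y) := (hpow n).ker (hpow m) Y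
    have hK' : IsUnipotent (DGMod.ker Y) := (hpow' n).ker (hpow n) (hpow m) Y
    have hsum (q : Fin n → End J) :
        ∑ t, q t • (kerι Y ≫ powπ t) = kerι Y ≫ powDesc (P := J) q := by
      simp only [hsmul, powDesc, Preadditive.comp_sum, Category.assoc]
    refine ⟨⟨DGMod.ker Y, hK, hK'⟩, fun t => kerι Y ≫ powπ t, fun g => ?_, fun q => ?_⟩
    · obtain ⟨e, he⟩ := hK.exists_factorization (hpow n) (hpow' n) hJ' (kerι Y) g fun v hv => by
        rw [kerι_injective Y 0 (hv.trans (map_zero _).symm), map_zero]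
      refine ⟨fun t => powι t ≫ e, ?_⟩
      rw [← he]
      refine (hsum _).trans ?_
      rw [powDesc_powι]
    · refine Iff.trans (b := kerι Y ≫ powDesc (P := J) q = 0) (by rw [← hsum])
        ⟨fun h => ?_, fun h => ?_⟩
      -- A morphism `J^n ⟶ J` vanishing on the kernel of `Y` factors through `Y` by injectivity of
      -- `J`. The components of the factorization express `q` as a combination of the chosen
      -- elements `a i` of `N`.
      · obtain ⟨e, he⟩ := (hpow n).exists_factorization (hpow m) (hpow' m) hJ' Y
          (powDesc (P := J) q) fun v hv =>
            congrArg (fun φ : DGMod.ker Y ⟶ J => φ.f 0 (kerMk Y v hv)) h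
        have hq : q = ∑ i, (show End J from powι i ≫ e) • (a i).1 := by
          funext t
          rw [Finset.sum_apply]
          have h1 : powι t ≫ Y ≫ e = q t := by rw [he, powι_powDesc]
          rw [← h1, powLift_comp, Preadditive.comp_sum]
          refine Finset.sum_congr rfl fun i _ => ?_
          rw [← Category.assoc, powι_powDesc]
          rfl
        rw [hq]
        exact sum_mem fun i _ => N.smul_mem _ (a i).2
      · refine hK.hom_ext fun v => ?_
        exact hY _ (f_kerι Y v) ⟨q, h⟩

/-- Homotopic morphisms of pure dg modules are equal. -/
lemma IsPure.eq_of_toHot_map_eq {M N : DGMod R} (hM : IsPure M) (hN : IsPure N) {f g : M ⟶ N}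
    (h : (toHot R).map f = (toHot R).map g) : f = g := by
  obtain ⟨s⟩ := (toHot_map_eq_iff _ _).1 h
  have hs : ∀ {i j : ℤ} (e : i + -1 = j) (x : M.X i), s.toGMap.f e x = 0 := fun e x =>
    hM.ext (g := s.toGMap) (g' := 0) (fun x => by
      rw [hN.eq_zero_of_neg (by omega) (s.toGMap.f _ x), GMap.zero_f]) e x
  refine DGMod.hom_ext fun i x => ?_
  rw [s.eq_add (sub_add_cancel i 1) rfl, hs, hs, map_zero, add_zero, add_zero]

/-- Away from degree zero `M̄` itself vanishes: `M^i` is zero for `i < 0` and equals `M^0 A^i` for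
`i > 0`. -/
lemma IsPure.isHeart {M : DGMod R} (hM : IsPure M) (hM' : IsUnipotent M) :
    isHeart R ((toHot R).obj M) := by
  refine ⟨hM.isPerfect hM', fun i hi => ?_⟩
  have h : ∀ x : M.bar.X i, x = 0 := by
    intro x
    obtain ⟨x, rfl⟩ := toBar_surjective M i x
    rw [toBar_eq_zero]
    rcases lt_or_gt_of_ne hi with hi | hi
    · rw [hM.eq_zero_of_neg hi x]
      exact zero_mem _
    · have hx := hM.mem_gen x
      refine (AddSubgroup.closure_mono ?_) hx
      rintro _ ⟨u, -, a, rfl⟩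
      exact ⟨0, i, _, hi, u, a, rfl⟩
  refine ⟨fun a b => ?_⟩
  induction a using QuotientAddGroup.induction_on with
  | H a =>
    induction b using QuotientAddGroup.induction_on with
    | H b => exact congrArg _ (Subtype.ext ((h _).trans (h _).symm))

variable (R) in
/-- The functor from pure unipotent dg modules to the heart. -/
def toHeart : (isPureUnipotent R).FullSubcategory ⥤ Heart R :=
  (isHeart R).lift ((isPureUnipotent R).ι ⋙ toHot R) fun M => M.property.1.isHeart M.property.2

lemma exists_toHeart_iso (X : Heart R) :
    ∃ M : (isPureUnipotent R).FullSubcategory, Nonempty ((toHeart R).obj M ≅ X) := by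
  obtain ⟨M, hM, ⟨e⟩⟩ := exists_isPure X.property
  have hM' := hM.isUnipotent_of_isPerfect (.summand ⟨e.inv, e.hom, e.inv_hom_id⟩ X.property.1)
  exact ⟨⟨M, hM, hM'⟩, ⟨(isHeart R).isoMk e.symm⟩⟩

instance : (toHeart R).IsEquivalence where
  faithful := ⟨fun {X Y} f g h => InducedCategory.hom_ext <|
    X.property.1.eq_of_toHot_map_eq Y.property.1
      (congrArg (fun φ : (toHeart R).obj X ⟶ (toHeart R).obj Y => φ.hom) h)⟩
  full := ⟨fun {X Y} f => by
    obtain ⟨g, hg⟩ := (toHot R).map_surjective f.hom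
    exact ⟨ObjectProperty.homMk g, InducedCategory.hom_ext hg⟩⟩
  essSurj := ⟨fun X => exists_toHeart_iso X⟩

/-- Morphisms of pure unipotent dg modules are the same as morphisms in the heart. -/
def toHeartEquiv (X Y : (isPureUnipotent R).FullSubcategory) :
    (X.obj ⟶ Y.obj) ≃+ ((toHeart R).obj X ⟶ (toHeart R).obj Y) :=
  AddEquiv.ofBijective (AddMonoidHom.mk' (fun f => (toHeart R).map (ObjectProperty.homMk f))
    (fun f g => InducedCategory.hom_ext ((toHot R).map_add (f := f) (g := g))))
    ⟨fun f g h => congrArg (fun φ : X ⟶ Y => φ.hom) ((toHeart R).map_injective h), fun f => by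
      obtain ⟨g, rfl⟩ := (toHeart R).map_surjective f
      exact ⟨g.hom, rfl⟩⟩

lemma toHeartEquiv_comp {X Y Z : (isPureUnipotent R).FullSubcategory} (f : X.obj ⟶ Y.obj)
    (g : Y.obj ⟶ Z.obj) :
    toHeartEquiv X Z (f ≫ g) = toHeartEquiv X Y f ≫ toHeartEquiv Y Z g :=
  (toHeart R).map_comp (ObjectProperty.homMk f) (ObjectProperty.homMk g)

omit [R.Admissible] in
/-- The vanishing of the first cohomology is a homotopy invariant. -/
lemma exists_d_eq_of_iso {X : Hot R} {J : DGMod R} (e : X ≅ (toHot R).obj J)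
    (h : Subsingleton (X.as.cohomology 1)) (x : J.X 1)
    (hx : J.d (rfl : (1 : ℤ) + 1 = 1 + 1) x = 0) : ∃ y, J.d (zero_add 1) y = x := by
  obtain ⟨f, hf⟩ := (toHot R).map_surjective (X := X.as) e.hom
  obtain ⟨g, hg⟩ := (toHot R).map_surjective (Y := X.as) e.inv
  obtain ⟨s⟩ := (toHot_map_eq_iff (g ≫ f) (𝟙 J)).1 (by
    rw [Functor.map_comp, hf, hg, CategoryTheory.Functor.map_id]
    exact e.inv_hom_id)
  obtain ⟨y, hy⟩ := exists_d_eq_of_subsingleton h (zero_add 1) rfl (g.f 1 x)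
    (by rw [← g.map_d, hx, map_zero])
  have h1 := s.eq_add (zero_add 1) rfl x
  rw [hx, map_zero, add_zero, comp_f, id_f, ← hy, f.map_d, ← sub_eq_iff_eq_add, ← map_sub] at h1
  exact ⟨_, h1⟩

end DGMod

theorem proposition6p8 {k : Type w} [CommRing k] (R : DGAlgebra.{w, u} k) [R.Admissible]
    (I : DGMod.Heart R)
    (hI : Subsingleton (I.obj.as.cohomology 1))
    (hL : ∀ (L : Type u) [AddCommGroup L] [Module (R.gr 0)ᵐᵒᵖ L] [IsSimpleModule (R.gr 0)ᵐᵒᵖ L],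
      ∃ f : DGMod.heartHat R L ⟶ I, Mono f) :
    ∃ hfg : ∀ M : (DGMod.Heart R)ᵒᵖ, ModuleCat.isFG (End I) ((preadditiveYonedaObj I).obj M),
      ((ModuleCat.isFG (End I)).lift (preadditiveYonedaObj I) hfg).rightOp.IsEquivalence := by
  obtain ⟨J, ⟨e⟩⟩ := DGMod.exists_toHeart_iso I
  have e' : I.obj ≅ (DGMod.toHot R).obj J.obj := (DGMod.isHeart R).ι.mapIso e.symm
  have hJ := J.property.1.isDualizedBy J.property.2 (DGMod.exists_d_eq_of_iso e' hI) (by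
    intro L _ _ _
    obtain ⟨f, hf⟩ := hL L
    obtain ⟨g, hg⟩ := (DGMod.toHot R).map_surjective (f.hom ≫ e'.hom)
    refine ⟨g, ?_⟩
    -- Only nonvanishing is taken from the monomorphism: if it were zero, the identity of `L̂` would
    -- vanish in the heart, and then in `dgMod`, as homotopic morphisms of pure modules are equal.
    rintro rfl
    have h1 : f.hom = 0 := by
      rw [(DGMod.toHot R).map_zero] at hg
      rw [← cancel_mono e'.hom, Limits.zero_comp]
      exact hg.symm
    have h2 : 𝟙 (DGMod.heartHat R L) = 0 := by
      rw [← cancel_mono f]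
      refine InducedCategory.hom_ext ?_
      change 𝟙 _ ≫ f.hom = 0 ≫ f.hom
      rw [h1, Limits.comp_zero, Limits.comp_zero]
    refine DGMod.id_hat_ne_zero (R := R) (L := L)
      (DGMod.isPure_hat.eq_of_toHot_map_eq DGMod.isPure_hat ?_)
    rw [(DGMod.toHot R).map_zero]
    exact congrArg (fun φ : DGMod.heartHat R L ⟶ DGMod.heartHat R L => φ.hom) h2)
  let φ (X : (DGMod.isPureUnipotent R).FullSubcategory) :
      (X.obj ⟶ J.obj) ≃+ ((DGMod.toHeart R).obj X ⟶ I) :=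
    { toFun := fun x => DGMod.toHeartEquiv X J x ≫ e.hom
      invFun := fun y => (DGMod.toHeartEquiv X J).symm (y ≫ e.inv)
      left_inv := fun x => by simp
      right_inv := fun y => by simp
      map_add' := fun x y => by simp }
  -- Conjugation by `e`, which makes the identification `φ` of the Hom groups semilinear.
  let ψ : End J.obj ≃+* End I :=
    { toFun := fun q => e.inv ≫ φ J q
      invFun := fun q => (φ J).symm (e.hom ≫ q)
      left_inv := fun q => by simp
      right_inv := fun q => by simp
      map_add' := fun q q' => by
        rw [← Preadditive.comp_add]
        exact congrArg (e.inv ≫ ·) (map_add (φ J) q q')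
      map_mul' := fun q q' => by
        simp only [φ, AddEquiv.coe_mk, Equiv.coe_fn_mk, End.mul_def, Category.assoc,
          e.hom_inv_id_assoc]
        rw [DGMod.toHeartEquiv_comp, Category.assoc] }
  refine (hJ.transport (DGMod.toHeart R) I φ ψ (fun {X Z} f x => ?_)
    fun X q x => ?_).exists_isEquivalence
  · change DGMod.toHeartEquiv Z J (f.hom ≫ x) ≫ e.hom = _
    rw [DGMod.toHeartEquiv_comp, Category.assoc]
    rfl
  · change DGMod.toHeartEquiv X J (x ≫ q) ≫ e.hom =
      (DGMod.toHeartEquiv X J x ≫ e.hom) ≫ e.inv ≫ DGMod.toHeartEquiv J J q ≫ e.hom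
    rw [DGMod.toHeartEquiv_comp (Y := J)]
    simp

end
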